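/- Let $p>2$ be a prime, $F$ a finite extension of $\mathbb{Q}_p$, $E/F$ the unramified quadratic extension, $x\mapsto\bar x$ the nontrivial element of $\mathrm{Gal}(E/F)$, $\varpi$ a uniformizer of $F$, $q$ the cardinality of the residue field of $F$, and $v$ the valuation on $E$ with $v(\varpi)=1$ and $v(0)=\infty$. Let $|x|_F=q^{-v(x)}$ and $\eta(x)=(-1)^{v(x)}$ for $x\in F^\times$. Let $S_2(F)=\{g\in \mathrm{GL}_2(E): g\bar g=1\}$ and $K'_{S,\le r}=S_2(F)\cap\varpi^{-r}\mathrm{Mat}_2(\mathcal O_E)$ for $r\ge 0$. Let $V'_2(F)=F^2\times(F^2)^\vee$ (column vectors and row vectors). For $(\gamma,\mathbf u,\mathbf v^\top)\in S_2(F)\times V_2'(F)$, a test function $\phi$ on $S_2(F)$ and $s\in\mathbb{C}$ put $$\mathrm{Orb}((\gamma,\mathbf u,\mathbf v^\top),\phi,s)=\int_{\mathrm{GL}_2(F)}\phi(h\gamma h^{-1})\,\mathbf 1_{\mathcal O_F^2\times(\mathcal O_F^2)^\vee}(h\mathbf u,\mathbf v^\top h^{-1})\,\eta(\det h)\,|\det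 h|_F^{-s}\,dh,$$ where $dh$ is the Haar measure giving $\mathrm{GL}_2(\mathcal O_F)$ volume $1$, and let $\partial\mathrm{Orb}((\gamma,\mathbf u,\mathbf v^\top),\phi)$ be the derivative of this function of $s$ at $s=0$. A triple $(A,\mathbf u,\mathbf v^\top)$ over $E$ is regular semisimple if $(\mathbf u,A\mathbf u)$ and $(\mathbf v^\top,\mathbf v^\top A)$ are bases of $E^2$. Let $(S_2(F)\times V'_2(F))_{\mathrm{rs}}^-$ be the set of regular semisimple $(\gamma,\mathbf u,\mathbf v^\top)\in S_2(F)\times V'_2(F)$ that match a regular semisimple $(g,w)\in \mathrm U(\mathbb V)\times\mathbb V$, where $\mathbb V$ is the non-split nondegenerate $2$-dimensional $E/F$-Hermitian space; matching means that $\begin{pmatrix}\gamma&\mathbf u\\ \mathbf v^\top&0\end{pmatrix}$ and $\begin{pmatrix}g&w\\ w^*&0\end{pmatrix}$, with $w^*=\langle\cdot,w\rangle$, are conjugate by an element of $\mathrm{GL}_2(E)$ (embedded in $\mathrm{GL}_3(E)$ as the upper left block), and that $(g,w)$ is regular semisimple means that $(g,w,w^*)$ is. Let $$(\gamma,\mathbf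 u,\mathbf v^\top)=\left(\begin{pmatrix}a&b\\c&d\end{pmatrix},\begin{pmatrix}0\\1\end{pmatrix},\begin{pmatrix}0&e\end{pmatrix}\right)\in(S_2(F)\times V'_2(F))_{\mathrm{rs}}^-,\qquad a,b,c,d\in E,\ e\in F.$$ (In this situation $b,c,e$ are automatically nonzero and $v(b)+v(c)$ is automatically odd and positive.) Let $r\ge1$ and put $$N=\min\left(v(e),\ \tfrac{v(b)+v(c)-1}{2}+r,\ v(d-a)+r\right),\qquad \varkappa=v(e)-(v(d-a)+r)$$ (with $\varkappa=-\infty$ if $d=a$), and $$C=\begin{cases}\frac{\varkappa-1}{2}&\text{if }\varkappa>0\text{ is odd and }v(b)+v(c)>2v(d-a),\\[2pt] \frac{\varkappa+v(b)+v(c)-2v(d-a)-1}{2}&\text{if }\varkappa\ge0\text{ is even and }v(b)+v(c)>2v(d-a),\\[2pt] v(e)-N&\text{if }v(e)\ge\frac{v(b)+v(c)-1}{2}+r\text{ and }2v(d-a)>v(b)+v(c),\\[2pt] 0&\text{otherwise,}\end{cases}$$ $$C'=\begin{cases}C+1&\text{if }\varkappa\ge0\text{ and }v(b)+v(c)>2v(d-a),\\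 0&\text{otherwise.}\end{cases}$$ Then, for $\phi=\mathbf 1_{K'_{S,\le r}}+\mathbf 1_{K'_{S,\le r-1}}$, the integral defining $\mathrm{Orb}((\gamma,\mathbf u,\mathbf v^\top),\phi,s)$ converges absolutely for every $s\in\mathbb{C}$, it is differentiable in $s$ at $s=0$, and $$\frac{(-1)^{v(c)+r}}{\log q}\,\partial\mathrm{Orb}\bigl((\gamma,\mathbf u,\mathbf v^\top),\mathbf 1_{K'_{S,\le r}}+\mathbf 1_{K'_{S,\le r-1}}\bigr)=\sum_{j=0}^{N}q^j+C\,q^{N}+C'\,q^{N-1},$$ where the sum over $j$ is empty if $N<0$ (which happens only if $v(e)<0$, and then both sides are $0$). -/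

import Mathlib

open MeasureTheory
open scoped Matrix

noncomputable section

namespace SemiLie

/-- `ϖ` generates the maximal ideal `{x | ‖x‖ < 1}` of the ring of integers `{x | ‖x‖ ≤ 1}`. -/
def IsUniformizer {K : Type*} [NormedField K] (ϖ : K) : Prop :=
  ϖ ≠ 0 ∧ ‖ϖ‖ < 1 ∧ ∀ x : K, ‖x‖ < 1 → ‖x‖ ≤ ‖ϖ‖

/-- `E / F` is unramified: a uniformizer of `F` is still a uniformizer of `E`
(the residue fields are finite, so separability of the residue extension is automatic). -/
def IsUnramified (F E : Type*) [NormedField F] [NormedField E] [NormedAlgebra F E] : Prop :=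
  ∀ ϖ : F, IsUniformizer ϖ → IsUniformizer (algebraMap F E ϖ)

/-- The number `q` of elements of the residue field of `F`. -/
def residueCard (F : Type*) [NormedField F] [IsUltrametricDist F] : ℕ :=
  Nat.card (IsLocalRing.ResidueField (NormedField.valuation (K := F)).valuationSubring)

open Classical in
/-- The integer valuation `v(x)` of a nonzero `x`, normalized by `v(ϖ) = 1`: the integer `n` such
that `‖x‖ = ‖ϖ‖ ^ n`.  (The value at `0` is the placeholder `0`; see `ord` for `v(0) = ∞`.) -/
def val {K : Type*} [NormedField K] (ϖ x : K) : ℤ :=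
  if h : ∃ n : ℤ, ‖x‖ = ‖ϖ‖ ^ n then h.choose else 0

open Classical in
/-- The valuation with the convention `v(0) = ∞`. -/
def ord {K : Type*} [NormedField K] (ϖ x : K) : WithTop ℤ :=
  if x = 0 then ⊤ else (val ϖ x : WithTop ℤ)

section Spaces

variable {F E : Type*} [NormedField F] [NormedField E] [NormedAlgebra F E]

/-- The entrywise conjugate of an invertible matrix. -/
def conjGL (σ : E ≃ₐ[F] E) (g : GL (Fin 2) E) : GL (Fin 2) E :=
  Matrix.GeneralLinearGroup.map (σ : E →+* E) g

/-- The inclusion `GL₂(F) → GL₂(E)`. -/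
def extGL (E : Type*) [NormedField E] [NormedAlgebra F E] (h : GL (Fin 2) F) : GL (Fin 2) E :=
  Matrix.GeneralLinearGroup.map (algebraMap F E) h

/-- The symmetric space `S₂(F) = {g ∈ GL₂(E) | g ḡ = 1}`. -/
def S2 (σ : E ≃ₐ[F] E) : Set (GL (Fin 2) E) := {g | g * conjGL σ g = 1}

theorem conjGL_extGL (σ : E ≃ₐ[F] E) (h : GL (Fin 2) F) :
    conjGL σ (extGL E h) = extGL E h := by
  ext i j
  simp [conjGL, extGL]

/-- The action `h • γ = h γ h⁻¹` of `GL₂(F)` on `S₂(F)`. -/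
def actS2 {σ : E ≃ₐ[F] E} (h : GL (Fin 2) F) (γ : S2 σ) : S2 σ :=
  ⟨extGL E h * (γ : GL (Fin 2) E) * (extGL E h)⁻¹, by
    have hγ : (γ : GL (Fin 2) E) * conjGL σ γ = 1 := γ.2
    have hh := conjGL_extGL (E := E) σ h
    show _ * conjGL σ _ = 1
    have : conjGL σ (extGL E h * (γ : GL (Fin 2) E) * (extGL E h)⁻¹)
        = extGL E h * conjGL σ γ * (extGL E h)⁻¹ := by
      conv_rhs => rw [← hh]
      simp only [conjGL, map_mul, map_inv]
    rw [this]
    calc _ = extGL E h * ((γ : GL (Fin 2) E) * conjGL σ γ) * (extGL E h)⁻¹ := by group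
      _ = 1 := by rw [hγ]; group⟩

/-- `K'_{S,≤r} = S₂(F) ∩ ϖ^{-r} Mat₂(O_E)`. -/
def KSle (σ : E ≃ₐ[F] E) (ϖ : F) (r : ℕ) : Set (S2 σ) :=
  {g | ∀ i j, ‖(algebraMap F E ϖ) ^ r * (g : GL (Fin 2) E) i j‖ ≤ 1}

/-- The indicator function of `K'_{S,≤r}`. -/
def indKSle (σ : E ≃ₐ[F] E) (ϖ : F) (r : ℕ) : S2 σ → ℂ :=
  (KSle σ ϖ r).indicator 1

/-- The indicator function of `O_F² × (O_F²)^∨` on `V'₂(F) = F² × (F²)^∨`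
(column vectors and row vectors). -/
def indInt : (Fin 2 → F) × (Fin 2 → F) → ℂ :=
  Set.indicator {x | (∀ i, ‖x.1 i‖ ≤ 1) ∧ ∀ i, ‖x.2 i‖ ≤ 1} 1

/-- `GL₂(O_F)` inside `GL₂(F)`. -/
def integralGL (F : Type*) [NormedField F] : Set (GL (Fin 2) F) :=
  {h | (∀ i j, ‖h i j‖ ≤ 1) ∧ ∀ i j, ‖h⁻¹ i j‖ ≤ 1}

/-- The quadratic character `η` of `F^×` attached to the unramified extension `E / F`. -/
def eta (ϖ x : F) : ℂ := (-1) ^ val ϖ x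

/-- The normalized absolute value `|x|_F = q^{-v(x)}` of a nonzero `x`. -/
def absF [IsUltrametricDist F] (ϖ x : F) : ℝ := (residueCard F : ℝ) ^ (-val ϖ x)

/-- The integrand of the weighted orbital integral at `(γ, u, vᵀ)` for the test function
`φ ⊗ 1_{O_F² × (O_F²)^∨}`. -/
def orbIntegrand [IsUltrametricDist F] (ϖ : F) {σ : E ≃ₐ[F] E} (γ : S2 σ) (u v : Fin 2 → F)
    (φ : S2 σ → ℂ) (s : ℂ) (h : GL (Fin 2) F) : ℂ :=
  φ (actS2 h γ)
    * indInt ((h : Matrix (Fin 2) (Fin 2) F) *ᵥ u, v ᵥ* ((h⁻¹ : GL (Fin 2) F) : Matrix _ _ F))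
    * eta ϖ (h : Matrix (Fin 2) (Fin 2) F).det
    * (absF ϖ (h : Matrix (Fin 2) (Fin 2) F).det : ℂ) ^ (-s)

/-- The weighted orbital integral `Orb((γ, u, vᵀ), φ ⊗ 1_{O_F² × (O_F²)^∨}, s)`. -/
def Orb [IsUltrametricDist F] [MeasurableSpace (GL (Fin 2) F)] (μ : Measure (GL (Fin 2) F))
    (ϖ : F) {σ : E ≃ₐ[F] E} (γ : S2 σ) (u v : Fin 2 → F) (φ : S2 σ → ℂ) (s : ℂ) : ℂ :=
  ∫ h, orbIntegrand ϖ γ u v φ s h ∂μ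

/-- `∂Orb((γ, u, vᵀ), φ)`, the derivative of the weighted orbital integral at `s = 0`. -/
def dOrb [IsUltrametricDist F] [MeasurableSpace (GL (Fin 2) F)] (μ : Measure (GL (Fin 2) F))
    (ϖ : F) {σ : E ≃ₐ[F] E} (γ : S2 σ) (u v : Fin 2 → F) (φ : S2 σ → ℂ) : ℂ :=
  deriv (Orb μ ϖ γ u v φ) 0

/-- A triple (matrix, column vector, row vector) is regular semisimple: `(u, A u)` and
`(vᵀ, vᵀ A)` are bases of `E²`. -/
def IsRegSS (A : Matrix (Fin 2) (Fin 2) E) (u v : Fin 2 → E) : Prop :=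
  LinearIndependent E (fun i : Fin 2 => (A ^ (i : ℕ)) *ᵥ u) ∧
    LinearIndependent E (fun i : Fin 2 => v ᵥ* (A ^ (i : ℕ)))

/-- Conjugate transpose with respect to `σ`. -/
def adj (σ : E ≃ₐ[F] E) (A : Matrix (Fin 2) (Fin 2) E) : Matrix (Fin 2) (Fin 2) E :=
  (A.map σ)ᵀ

/-- `J` is the Gram matrix of a nondegenerate non-split Hermitian form `⟨x, y⟩ = y^* J x` on `E²`:
it is not isometric to the split form, whose Gram matrix is antidiagonal with entries `1`. -/
def IsNonsplitHermitian (σ : E ≃ₐ[F] E) (J : Matrix (Fin 2) (Fin 2) E) : Prop :=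
  adj σ J = J ∧ J.det ≠ 0 ∧
    ¬ ∃ P : GL (Fin 2) E,
      adj σ (P : Matrix (Fin 2) (Fin 2) E) * J * (P : Matrix (Fin 2) (Fin 2) E) = !![0, 1; 1, 0]

/-- For a Hermitian form with Gram matrix `J`, the row vector `w^*`, i.e. the functional
`x ↦ ⟨x, w⟩`. -/
def hermStar (σ : E ≃ₐ[F] E) (J : Matrix (Fin 2) (Fin 2) E) (w : Fin 2 → E) : Fin 2 → E :=
  (fun i => σ (w i)) ᵥ* J

/-- `(γ, u, vᵀ) ∈ (S₂(F) × V'₂(F))_rs^-`: it is regular semisimple, and it matches some regular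
semisimple `(g, w)` in `U(V₂^-) × V₂^-`, that is, the block matrices `[γ, u; vᵀ, 0]` and
`[g, w; w^*, 0]` are conjugate by an element `P` of `GL₂(E)`. -/
def IsRegSSMinus {σ : E ≃ₐ[F] E} (γ : S2 σ) (u v : Fin 2 → F) : Prop :=
  IsRegSS ((γ : GL (Fin 2) E) : Matrix (Fin 2) (Fin 2) E)
      (fun i => algebraMap F E (u i)) (fun i => algebraMap F E (v i)) ∧
    ∃ J : Matrix (Fin 2) (Fin 2) E, IsNonsplitHermitian σ J ∧
      ∃ (g : GL (Fin 2) E) (w : Fin 2 → E),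
        adj σ (g : Matrix (Fin 2) (Fin 2) E) * J * (g : Matrix (Fin 2) (Fin 2) E) = J ∧
        IsRegSS (g : Matrix (Fin 2) (Fin 2) E) w (hermStar σ J w) ∧
        ∃ P : GL (Fin 2) E,
          P * (γ : GL (Fin 2) E) * P⁻¹ = g ∧
          (P : Matrix (Fin 2) (Fin 2) E) *ᵥ (fun i => algebraMap F E (u i)) = w ∧
          (fun i => algebraMap F E (v i)) ᵥ* ((P⁻¹ : GL (Fin 2) E) : Matrix _ _ E) = hermStar σ J w

end Spaces

section Constants

/-- `N = min(v(e), (v(b)+v(c)-1)/2 + r, v(d-a) + r)`.  Here `vb`, `vc`, `ve` are the valuations of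
the nonzero elements `b`, `c`, `e`, and `δ = v(d-a)` may be `∞`; the minimum is always finite.
The number `vb + vc - 1` is even where this is used. -/
def constN (r : ℕ) (vb vc ve : ℤ) (δ : WithTop ℤ) : ℤ :=
  (min (ve : WithTop ℤ)
    (min (((vb + vc - 1) / 2 + r : ℤ) : WithTop ℤ) (δ + ((r : ℤ) : WithTop ℤ)))).untopD 0

/-- `ϰ = v(e) - (v(d-a) + r)`; only used under the condition `2 v(d-a) < v(b) + v(c)`, which
forces `v(d-a)` to be finite. -/
def kappa (r : ℕ) (ve : ℤ) (δ : WithTop ℤ) : ℤ := ve - (δ.untopD 0 + r)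

open Classical in
/-- The constant `C`. -/
def constC (r : ℕ) (vb vc ve : ℤ) (δ : WithTop ℤ) : ℚ :=
  let ϰ := kappa r ve δ
  if 0 < ϰ ∧ Odd ϰ ∧ δ + δ < ((vb + vc : ℤ) : WithTop ℤ) then
    ((ϰ : ℚ) - 1) / 2
  else if 0 ≤ ϰ ∧ Even ϰ ∧ δ + δ < ((vb + vc : ℤ) : WithTop ℤ) then
    ((ϰ : ℚ) + vb + vc - 2 * (δ.untopD 0 : ℤ) - 1) / 2
  else if (vb + vc - 1) / 2 + r ≤ ve ∧ ((vb + vc : ℤ) : WithTop ℤ) < δ + δ then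
    (ve : ℚ) - constN r vb vc ve δ
  else 0

open Classical in
/-- The constant `C'`. -/
def constC' (r : ℕ) (vb vc ve : ℤ) (δ : WithTop ℤ) : ℚ :=
  if 0 ≤ kappa r ve δ ∧ δ + δ < ((vb + vc : ℤ) : WithTop ℤ) then
    constC r vb vc ve δ + 1
  else 0

end Constants

end SemiLie

end

/-! The integrand is left invariant under GL₂(O_F), so the Iwasawa decomposition turns the integral
into a sum over triangular matrices with rows (ϖ^m, y) and (0, ϖ^n), y taken modulo ϖ^n. Right
translation by triangular matrices preserves the volume of GL₂(O_F), so every coset counts with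
weight 1 (`integral_eq_sum_of_left_invariant`). The lattice factor says that y is integral and 0 ≤ n
≤ v(e). Put m = k + v(c). After multiplication by the conjugate of c, the condition on hγh⁻¹ becomes
a bound on the F-valued form ϖ^(2k) B + ϖ^k y D - ε y², where v(B) = l = v(b) + v(c), v(D) = v(d-a)
and ε is a unit (`actS2_upperGL_mem_KSle_iff`). Only finitely many k contribute, so the integral is
a finite sum of exponentials in s. Its derivative at 0 is log q times the sum of (-1)^j j · #{y},
with j = k + n + v(c).

Non-splitness enters once: if d d̄ - 1 were a norm from E, the Hermitian space would contain an
isotropic vector. This element equals -c b̄, and elements of even valuation are norms, so l is odd;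
positivity follows (`odd_val_add_val_and_pos`).

If 2v(d-a) > l, oddness of l prevents cancellation in the form, and y runs over a ball around 0
(`card_formCond_single`). If 2v(d-a) < l, the form splits over F by Hensel, and y runs over a ball
around 0 or over two disjoint balls around the roots (`card_formCond_split`). In the alternating sum
over k, consecutive k with the same ball collapse to a single power of q. The radii r and r-1 come
with opposite signs, so adding the two test functions is a difference which telescopes
(`singleRange_sub`, `threeRange_sub`). Summing over n gives the formula (`sum_single_eq`,
`sum_three_eq`). -/

namespace SemiLie

/-! ### Valuations attached to a uniformizer. -/

section Val

variable {K : Type*} [NormedField K] {ϖ : K}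

theorem IsUniformizer.norm_pos (h : IsUniformizer ϖ) : 0 < ‖ϖ‖ := norm_pos_iff.2 h.1

theorem IsUniformizer.zpow_le_zpow_iff (h : IsUniformizer ϖ) {m n : ℤ} :
    ‖ϖ‖ ^ m ≤ ‖ϖ‖ ^ n ↔ n ≤ m :=
  zpow_le_zpow_iff_right_of_lt_one₀ h.norm_pos h.2.1

theorem IsUniformizer.zpow_lt_zpow_iff (h : IsUniformizer ϖ) {m n : ℤ} :
    ‖ϖ‖ ^ m < ‖ϖ‖ ^ n ↔ n < m :=
  zpow_lt_zpow_iff_right_of_lt_one₀ h.norm_pos h.2.1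

theorem IsUniformizer.zpow_inj (h : IsUniformizer ϖ) {m n : ℤ} :
    ‖ϖ‖ ^ m = ‖ϖ‖ ^ n ↔ m = n :=
  zpow_right_inj₀ h.norm_pos h.2.1.ne

theorem IsUniformizer.exists_norm_eq_zpow (h : IsUniformizer ϖ) {x : K} (hx : x ≠ 0) :
    ∃ n : ℤ, ‖x‖ = ‖ϖ‖ ^ n := by
  have h1 : 1 < ‖ϖ‖⁻¹ := (one_lt_inv₀ h.norm_pos).2 h.2.1
  obtain ⟨n, hn1, hn2⟩ := exists_mem_Ico_zpow (norm_pos_iff.2 hx) h1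
  refine ⟨-n, le_antisymm ?_ (by simpa using hn1)⟩
  -- No norm lies strictly between ‖ϖ‖ and 1, so this strict bound improves to ‖x‖ ≤ ‖ϖ‖^(-n).
  have hlt : ‖x * ϖ ^ (n + 1)‖ < 1 := by
    rw [norm_mul, norm_zpow]
    calc ‖x‖ * ‖ϖ‖ ^ (n + 1) < ‖ϖ‖⁻¹ ^ (n + 1) * ‖ϖ‖ ^ (n + 1) :=
          mul_lt_mul_of_pos_right hn2 (zpow_pos h.norm_pos _)
      _ = 1 := by rw [← mul_zpow, inv_mul_cancel₀ h.norm_pos.ne', one_zpow]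
  have := h.2.2 _ hlt
  rw [norm_mul, norm_zpow, zpow_add_one₀ h.norm_pos.ne', ← mul_assoc] at this
  have h3 : ‖x‖ * ‖ϖ‖ ^ n ≤ 1 := le_of_mul_le_mul_right (by simpa using this) h.norm_pos
  rw [zpow_neg, ← one_div]
  exact (le_div_iff₀ (zpow_pos h.norm_pos _)).2 h3

theorem val_eq_of_norm (h : IsUniformizer ϖ) {x : K} {n : ℤ} (hx : ‖x‖ = ‖ϖ‖ ^ n) :
    val ϖ x = n := by
  have hex : ∃ n : ℤ, ‖x‖ = ‖ϖ‖ ^ n := ⟨n, hx⟩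
  rw [val, dif_pos hex]
  exact h.zpow_inj.1 (hex.choose_spec.symm.trans hx)

theorem norm_eq_zpow_val (h : IsUniformizer ϖ) {x : K} (hx : x ≠ 0) :
    ‖x‖ = ‖ϖ‖ ^ val ϖ x := by
  obtain ⟨n, hn⟩ := h.exists_norm_eq_zpow hx
  rw [val_eq_of_norm h hn, hn]

theorem val_mul (h : IsUniformizer ϖ) {x y : K} (hx : x ≠ 0) (hy : y ≠ 0) :
    val ϖ (x * y) = val ϖ x + val ϖ y :=
  val_eq_of_norm h (by
    rw [norm_mul, norm_eq_zpow_val h hx, norm_eq_zpow_val h hy, zpow_add₀ h.norm_pos.ne'])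

end Val

/-! ### Ultrametric inequalities and square roots of principal units. -/

section Ultra

variable {K : Type*} [NormedField K] [IsUltrametricDist K]

theorem norm_add_le_of_le {x y : K} {t : ℝ} (hx : ‖x‖ ≤ t) (hy : ‖y‖ ≤ t) : ‖x + y‖ ≤ t :=
  (IsUltrametricDist.norm_add_le_max x y).trans (max_le hx hy)

theorem norm_sub_le_of_le {x y : K} {t : ℝ} (hx : ‖x‖ ≤ t) (hy : ‖y‖ ≤ t) : ‖x - y‖ ≤ t := by
  rw [sub_eq_add_neg]
  exact norm_add_le_of_le hx (by rwa [norm_neg])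

theorem norm_add_eq_left {x y : K} (h : ‖y‖ < ‖x‖) : ‖x + y‖ = ‖x‖ := by
  rw [IsUltrametricDist.norm_add_eq_max_of_norm_ne_norm h.ne', max_eq_left h.le]

theorem norm_sub_eq_left {x y : K} (h : ‖y‖ < ‖x‖) : ‖x - y‖ = ‖x‖ := by
  rw [sub_eq_add_neg]; exact norm_add_eq_left (by rwa [norm_neg])

theorem norm_sub_eq_right {x y : K} (h : ‖x‖ < ‖y‖) : ‖x - y‖ = ‖y‖ := by
  rw [norm_sub_rev]; exact norm_sub_eq_left h

/-- A principal unit of a complete nonarchimedean field with `|2| = 1` is a square. -/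
theorem exists_sq_eq_of_norm_sub_one_lt [CompleteSpace K] (h2 : ‖(2 : K)‖ = 1) {x : K}
    (hx : ‖x - 1‖ < 1) : ∃ y : K, y ^ 2 = x := by
  have h20 : (2 : K) ≠ 0 := by
    intro h; rw [h, norm_zero] at h2; exact zero_ne_one h2
  set t := x - 1 with ht
  let S : Set K := Metric.closedBall 0 ‖t‖
  -- A fixed point z satisfies 2z + z² = t, that is, (1 + z)² = 1 + t = x.
  let f : K → K := fun z => (t - z ^ 2) / 2
  have hmem : ∀ z, z ∈ S ↔ ‖z‖ ≤ ‖t‖ := fun z => by simp [S]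
  have hmaps : Set.MapsTo f S S := by
    intro z hz
    rw [hmem] at hz ⊢
    simp only [f, norm_div, h2, div_one]
    refine norm_sub_le_of_le le_rfl ?_
    rw [norm_pow, sq]
    calc ‖z‖ * ‖z‖ ≤ ‖t‖ * 1 :=
          mul_le_mul hz (hz.trans hx.le) (norm_nonneg _) (norm_nonneg _)
      _ = ‖t‖ := mul_one _
  have hcontr : ContractingWith ‖t‖₊ (hmaps.restrict f S S) := by
    refine ⟨by exact_mod_cast hx, LipschitzWith.of_dist_le_mul ?_⟩
    rintro ⟨z, hz⟩ ⟨w, hw⟩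
    rw [hmem] at hz hw
    rw [Subtype.dist_eq, Subtype.dist_eq]
    simp only [Set.MapsTo.val_restrict_apply, f, dist_eq_norm, coe_nnnorm]
    have : (t - z ^ 2) / 2 - (t - w ^ 2) / 2 = -((z + w) * (z - w)) / 2 := by ring
    rw [this, norm_div, h2, div_one, norm_neg, norm_mul]
    exact mul_le_mul_of_nonneg_right (norm_add_le_of_le hz hw) (norm_nonneg _)
  have hcomplete : IsComplete S := Metric.isClosed_closedBall.isComplete
  obtain ⟨z, -, hz, -⟩ := hcontr.exists_fixedPoint' hcomplete hmaps (x := 0) (by simp [S])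
    (edist_ne_top _ _)
  refine ⟨1 + z, ?_⟩
  have hz' : (t - z ^ 2) / 2 = z := hz
  have : t = 2 * z + z ^ 2 := by
    rw [div_eq_iff h20] at hz'; linear_combination hz'
  have hx1 : x = 1 + t := by rw [ht]; ring
  rw [hx1, this]; ring

end Ultra

/-! ### Representatives of the ring of integers modulo ϖ^n. -/

section Reps

variable {K : Type*} [NormedField K]

/-- `Y` is a complete set of representatives of the ring of integers modulo `ϖ ^ n`. -/
def IsReps (ϖ : K) (n : ℕ) (Y : Finset K) : Prop :=
  (∀ y ∈ Y, ‖y‖ ≤ 1) ∧ ∀ x : K, ‖x‖ ≤ 1 → ∃! y, y ∈ Y ∧ ‖x - y‖ ≤ ‖ϖ‖ ^ n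

variable {ϖ : K}

theorem IsReps.eq_of_norm_sub_le {n : ℕ} {Y : Finset K} (hY : IsReps ϖ n Y) {y z : K}
    (hy : y ∈ Y) (hz : z ∈ Y) (h : ‖y - z‖ ≤ ‖ϖ‖ ^ n) : y = z := by
  obtain ⟨w, -, hw⟩ := hY.2 y (hY.1 y hy)
  rw [hw y ⟨hy, by simp⟩, hw z ⟨hz, h⟩]

theorem card_ball_image (h : IsUniformizer ϖ) [DecidableEq K] (S : Finset K) (c : K) (j : ℕ) :
    (S.image fun y => (y - c) / ϖ ^ j).card = S.card := by
  refine Finset.card_image_of_injective _ fun y z hyz => ?_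
  have h0 : ϖ ^ j ≠ 0 := pow_ne_zero _ h.1
  simpa [div_left_inj' h0] using hyz

variable [IsUltrametricDist K]

theorem exists_isReps [ProperSpace K] (h : IsUniformizer ϖ) (n : ℕ) :
    ∃ Y : Finset K, IsReps ϖ n Y := by
  have hpos : 0 < ‖ϖ‖ ^ n := pow_pos h.norm_pos n
  let r : Setoid {x : K // ‖x‖ ≤ 1} :=
    { r := fun x y => ‖(x : K) - y‖ ≤ ‖ϖ‖ ^ n
      iseqv := ⟨fun x => by simp, fun {x y} hxy => by rwa [norm_sub_rev],
        fun {x y z} hxy hyz => by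
          have := norm_add_le_of_le hxy hyz
          rwa [sub_add_sub_cancel] at this⟩ }
  let S : Set K := Set.range fun a : Quotient r => (a.out : K)
  have hinj : ∀ y ∈ S, ∀ z ∈ S, ‖y - z‖ ≤ ‖ϖ‖ ^ n → y = z := by
    rintro _ ⟨a, rfl⟩ _ ⟨b, rfl⟩ hab
    have : a.out ≈ b.out := hab
    have := Quotient.sound this
    rw [Quotient.out_eq, Quotient.out_eq] at this
    rw [this]
  have hS : S.Finite := by
    -- Finiteness comes from compactness: distinct representatives cannot lie in the same ball of
    -- radius ‖ϖ‖^n.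
    have hc : TotallyBounded (Metric.closedBall (0 : K) 1) :=
      (isCompact_closedBall _ _).totallyBounded
    obtain ⟨t, ht, hcov⟩ := Metric.totallyBounded_iff.1 hc _ hpos
    have hex : ∀ y ∈ S, ∃ a ∈ t, dist y a < ‖ϖ‖ ^ n := by
      rintro _ ⟨a, rfl⟩
      have : (a.out : K) ∈ Metric.closedBall (0 : K) 1 := by simpa using a.out.2
      simpa using hcov this
    choose! f hf1 hf2 using hex
    refine Set.Finite.of_finite_image (ht.subset (Set.image_subset_iff.2 hf1)) ?_
    intro y hy z hz hyz
    refine hinj y hy z hz ?_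
    have h1 : ‖y - f y‖ ≤ ‖ϖ‖ ^ n := by rw [← dist_eq_norm]; exact (hf2 y hy).le
    have h2 : ‖z - f z‖ ≤ ‖ϖ‖ ^ n := by rw [← dist_eq_norm]; exact (hf2 z hz).le
    replace hyz : f y = f z := hyz
    rw [← hyz] at h2
    simpa using norm_sub_le_of_le h1 h2
  refine ⟨hS.toFinset, ?_, ?_⟩
  · simp only [Set.Finite.mem_toFinset]
    rintro _ ⟨a, rfl⟩
    exact a.out.2
  · intro x hx
    refine ⟨((Quotient.mk r ⟨x, hx⟩).out : K), ⟨by simp [S], ?_⟩, ?_⟩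
    · have : (Quotient.mk r ⟨x, hx⟩).out ≈ ⟨x, hx⟩ := Quotient.mk_out (s := r) ⟨x, hx⟩
      rw [norm_sub_rev]; exact this
    · rintro y ⟨hy, hxy⟩
      refine hinj y (by simpa using hy) _ ⟨_, rfl⟩ ?_
      have h1 : ‖((Quotient.mk r ⟨x, hx⟩).out : K) - x‖ ≤ ‖ϖ‖ ^ n :=
        Quotient.mk_out (s := r) ⟨x, hx⟩
      have := norm_add_le_of_le h1 hxy
      rw [norm_sub_rev]
      simpa using this

open Classical in
-- The affine map y ↦ (y - c)/ϖ^j carries the ball of radius ‖ϖ‖^j around c onto the whole ring of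
-- integers and coarsens the modulus to ϖ^(n-j). Ball counts thus reduce to counts of complete
-- systems.
theorem IsReps.ball (h : IsUniformizer ϖ) {n j : ℕ} (hj : j ≤ n) {Y : Finset K}
    (hY : IsReps ϖ n Y) {c : K} (hc : ‖c‖ ≤ 1) :
    IsReps ϖ (n - j) ({y ∈ Y | ‖y - c‖ ≤ ‖ϖ‖ ^ j}.image fun y => (y - c) / ϖ ^ j) := by
  have hpos : 0 < ‖ϖ‖ ^ j := pow_pos h.norm_pos j
  have h0 : ϖ ^ j ≠ 0 := pow_ne_zero _ h.1
  have hj1 : ‖ϖ‖ ^ j ≤ 1 := pow_le_one₀ h.norm_pos.le h.2.1.le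
  have hmul : ‖ϖ‖ ^ n = ‖ϖ‖ ^ (n - j) * ‖ϖ‖ ^ j := by rw [← pow_add, Nat.sub_add_cancel hj]
  have key : ∀ x y : K, ‖x - (y - c) / ϖ ^ j‖ ≤ ‖ϖ‖ ^ (n - j) ↔
      ‖(c + ϖ ^ j * x) - y‖ ≤ ‖ϖ‖ ^ n := by
    intro x y
    have : (c + ϖ ^ j * x) - y = (x - (y - c) / ϖ ^ j) * ϖ ^ j := by field_simp; ring
    rw [this, norm_mul, norm_pow, hmul, mul_le_mul_iff_left₀ hpos]
  constructor
  · simp only [Finset.mem_image, Finset.mem_filter]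
    rintro _ ⟨y, ⟨-, hy⟩, rfl⟩
    rwa [norm_div, norm_pow, div_le_one hpos]
  · intro x hx
    have hx1 : ‖ϖ ^ j * x‖ ≤ ‖ϖ‖ ^ j := by
      rw [norm_mul, norm_pow]; exact mul_le_of_le_one_right hpos.le hx
    obtain ⟨y, ⟨hy, hxy⟩, huniq⟩ := hY.2 (c + ϖ ^ j * x) (norm_add_le_of_le hc (hx1.trans hj1))
    refine ⟨(y - c) / ϖ ^ j, ⟨?_, (key x y).2 hxy⟩, ?_⟩
    · refine Finset.mem_image_of_mem _ (Finset.mem_filter.2 ⟨hy, ?_⟩)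
      have h1 : ‖(c + ϖ ^ j * x) - y‖ ≤ ‖ϖ‖ ^ j :=
        hxy.trans (pow_le_pow_of_le_one h.norm_pos.le h.2.1.le hj)
      have := norm_sub_le_of_le hx1 h1
      rwa [show ϖ ^ j * x - (c + ϖ ^ j * x - y) = y - c by ring] at this
    · rintro _ ⟨hz, hxz⟩
      obtain ⟨z, hz', rfl⟩ := Finset.mem_image.1 hz
      rw [huniq z ⟨(Finset.mem_filter.1 hz').1, (key x z).1 hxz⟩]

theorem residue_eq_iff (h : IsUniformizer ϖ)
    (x y : (NormedField.valuation (K := K)).valuationSubring) :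
    IsLocalRing.residue _ x = IsLocalRing.residue _ y ↔ ‖(x : K) - y‖ ≤ ‖ϖ‖ := by
  rw [← sub_eq_zero, ← map_sub, IsLocalRing.residue_eq_zero_iff,
    ← ValuationSubring.coe_mem_nonunits_iff, ValuationSubring.mem_nonunits_iff_or]
  have hm : ∀ z : K, z ∈ (NormedField.valuation (K := K)).valuationSubring ↔ ‖z‖ ≤ 1 :=
    fun z => Iff.rfl
  rw [hm, norm_inv]
  set z : K := ((x - y : (NormedField.valuation (K := K)).valuationSubring) : K) with hz
  have hz' : z = x - y := by simp [hz]
  rw [← hz']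
  constructor
  · rintro (hz | hz)
    · simp [hz]
    · refine h.2.2 _ ?_
      rcases eq_or_ne z 0 with h0 | h0
      · simp [h0]
      · exact (one_lt_inv₀ (norm_pos_iff.2 h0)).1 (not_le.1 hz)
  · intro hle
    rcases eq_or_ne z 0 with h0 | h0
    · exact Or.inl h0
    · exact Or.inr (not_le.2 ((one_lt_inv₀ (norm_pos_iff.2 h0)).2 (hle.trans_lt h.2.1)))

theorem IsReps.card_one (h : IsUniformizer ϖ) {Y : Finset K} (hY : IsReps ϖ 1 Y) :
    Y.card = residueCard K := by
  rw [residueCard, ← Nat.card_eq_finsetCard]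
  refine Nat.card_congr (Equiv.ofBijective (fun y : Y =>
    IsLocalRing.residue (NormedField.valuation (K := K)).valuationSubring
      ⟨y, hY.1 y y.2⟩) ⟨?_, ?_⟩)
  · intro y z hyz
    have := (residue_eq_iff h _ _).1 hyz
    exact Subtype.ext (hY.eq_of_norm_sub_le y.2 z.2 (by simpa using this))
  · intro r
    obtain ⟨x, rfl⟩ := IsLocalRing.residue_surjective r
    obtain ⟨y, ⟨hy, hxy⟩, -⟩ := hY.2 x x.2
    refine ⟨⟨y, hy⟩, (residue_eq_iff h _ _).2 ?_⟩
    rw [norm_sub_rev]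
    simpa using hxy

open Classical in
-- Induction on n: the system splits into q residue discs, and each rescales to a system modulo one
-- power of ϖ less.
theorem IsReps.card [ProperSpace K] (h : IsUniformizer ϖ) {n : ℕ} {Y : Finset K}
    (hY : IsReps ϖ n Y) : Y.card = residueCard K ^ n := by
  induction n generalizing Y with
  | zero =>
    rw [pow_zero, Finset.card_eq_one]
    obtain ⟨y, ⟨hy, -⟩, hu⟩ := hY.2 0 (by simp)
    refine ⟨y, Finset.eq_singleton_iff_unique_mem.2 ⟨hy, fun z hz => hu z ⟨hz, ?_⟩⟩⟩
    simpa using hY.1 z hz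
  | succ n ih =>
    obtain ⟨R, hR⟩ := exists_isReps h 1
    have hex : ∀ y ∈ Y, ∃ s, s ∈ R ∧ ‖y - s‖ ≤ ‖ϖ‖ ^ 1 := fun y hy => (hR.2 y (hY.1 y hy)).exists
    choose! f hf1 hf2 using hex
    rw [Finset.card_eq_sum_card_fiberwise (f := f) (t := R) hf1, pow_succ', ← hR.card_one h,
      ← smul_eq_mul, ← Finset.sum_const]
    refine Finset.sum_congr rfl fun s hs => ?_
    have hfib : {y ∈ Y | f y = s} = {y ∈ Y | ‖y - s‖ ≤ ‖ϖ‖ ^ 1} := by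
      refine Finset.filter_congr fun y hy => ⟨fun e => e ▸ hf2 y hy, fun e => ?_⟩
      exact (hR.2 y (hY.1 y hy)).unique ⟨hf1 y hy, hf2 y hy⟩ ⟨hs, e⟩
    rw [hfib, ← card_ball_image h _ s 1]
    rw [hR.card_one h]
    exact ih (hY.ball h (Nat.le_add_left 1 n) (hR.1 s hs))

open Classical in
theorem IsReps.card_ball [ProperSpace K] (h : IsUniformizer ϖ) {n j : ℕ} (hj : j ≤ n)
    {Y : Finset K} (hY : IsReps ϖ n Y) {c : K} (hc : ‖c‖ ≤ 1) :
    {y ∈ Y | ‖y - c‖ ≤ ‖ϖ‖ ^ j}.card = residueCard K ^ (n - j) := by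
  rw [← card_ball_image h _ c j]
  exact (hY.ball h hj hc).card h

theorem one_lt_residueCard [ProperSpace K] (h : IsUniformizer ϖ) : 1 < residueCard K := by
  obtain ⟨R, hR⟩ := exists_isReps h 1
  rw [← hR.card_one h, Finset.one_lt_card]
  obtain ⟨y, ⟨hy, h1⟩, -⟩ := hR.2 0 (by simp)
  obtain ⟨z, ⟨hz, h2⟩, -⟩ := hR.2 1 (by simp)
  refine ⟨y, hy, z, hz, ?_⟩
  rintro rfl
  have := norm_sub_le_of_le h2 h1
  simp at this
  exact absurd this (not_le.2 h.2.1)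

end Reps

/-! ### Iwasawa decomposition and the cosets of GL₂(O_F). -/

section Iwasawa

variable {F : Type*} [NormedField F]

/-- The upper triangular matrix with rows `(x, y)` and `(0, z)`. -/
def upperGL (x y z : F) (hx : x ≠ 0) (hz : z ≠ 0) : GL (Fin 2) F where
  val := !![x, y; 0, z]
  inv := !![x⁻¹, -y / (x * z); 0, z⁻¹]
  val_inv := by
    ext i j; fin_cases i <;> fin_cases j <;> simp [Matrix.mul_apply, hx, hz] ; field_simp; ring
  inv_val := by
    ext i j; fin_cases i <;> fin_cases j <;> simp [Matrix.mul_apply, hx, hz] ; field_simp; ring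

/-- The lower unipotent matrix with rows `(1, 0)` and `(t, 1)`. -/
def lowerGL (t : F) : GL (Fin 2) F where
  val := !![1, 0; t, 1]
  inv := !![1, 0; -t, 1]
  val_inv := by ext i j; fin_cases i <;> fin_cases j <;> simp [Matrix.mul_apply]
  inv_val := by ext i j; fin_cases i <;> fin_cases j <;> simp [Matrix.mul_apply]

/-- The permutation matrix of the transposition. -/
def swapGL (F : Type*) [NormedField F] : GL (Fin 2) F where
  val := !![0, 1; 1, 0]
  inv := !![0, 1; 1, 0]
  val_inv := by ext i j; fin_cases i <;> fin_cases j <;> simp [Matrix.mul_apply]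
  inv_val := by ext i j; fin_cases i <;> fin_cases j <;> simp [Matrix.mul_apply]

theorem upperGL_val (x y z : F) (hx : x ≠ 0) (hz : z ≠ 0) :
    (upperGL x y z hx hz : Matrix (Fin 2) (Fin 2) F) = !![x, y; 0, z] := rfl

theorem upperGL_inv_val (x y z : F) (hx : x ≠ 0) (hz : z ≠ 0) :
    ((upperGL x y z hx hz)⁻¹ : GL (Fin 2) F).val = !![x⁻¹, -y / (x * z); 0, z⁻¹] := rfl

theorem upperGL_inv (x y z : F) (hx : x ≠ 0) (hz : z ≠ 0) :
    (upperGL x y z hx hz)⁻¹ =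
      upperGL x⁻¹ (-y / (x * z)) z⁻¹ (inv_ne_zero hx) (inv_ne_zero hz) :=
  Units.ext rfl

theorem upperGL_mul (x y z x' y' z' : F) (hx : x ≠ 0) (hz : z ≠ 0) (hx' : x' ≠ 0)
    (hz' : z' ≠ 0) : upperGL x y z hx hz * upperGL x' y' z' hx' hz' =
      upperGL (x * x') (x * y' + y * z') (z * z') (mul_ne_zero hx hx') (mul_ne_zero hz hz') := by
  ext i j
  fin_cases i <;> fin_cases j <;> simp [upperGL_val]

theorem upperGL_congr {x y z x' y' z' : F} {hx : x ≠ 0} {hz : z ≠ 0} {hx' : x' ≠ 0}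
    {hz' : z' ≠ 0} (h1 : x = x') (h2 : y = y') (h3 : z = z') :
    upperGL x y z hx hz = upperGL x' y' z' hx' hz' := by
  subst h1 h2 h3; rfl

variable [IsUltrametricDist F]

/-- `GL₂(O_F)` as a subgroup of `GL₂(F)`. -/
def integralSubgroup (F : Type*) [NormedField F] [IsUltrametricDist F] :
    Subgroup (GL (Fin 2) F) where
  carrier := integralGL F
  one_mem' := by
    have : ∀ i j, ‖(1 : Matrix (Fin 2) (Fin 2) F) i j‖ ≤ 1 := by
      intro i j; by_cases h : i = j <;> simp [Matrix.one_apply, h]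
    exact ⟨this, by rw [inv_one]; exact this⟩
  mul_mem' := by
    have key : ∀ A B : Matrix (Fin 2) (Fin 2) F, (∀ i j, ‖A i j‖ ≤ 1) → (∀ i j, ‖B i j‖ ≤ 1) →
        ∀ i j, ‖(A * B) i j‖ ≤ 1 := by
      intro A B hA hB i j
      rw [Matrix.mul_apply, Fin.sum_univ_two]
      refine norm_add_le_of_le ?_ ?_ <;> rw [norm_mul] <;>
        exact mul_le_one₀ (hA _ _) (norm_nonneg _) (hB _ _)
    rintro g h ⟨hg1, hg2⟩ ⟨hh1, hh2⟩
    refine ⟨key _ _ hg1 hh1, ?_⟩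
    rw [mul_inv_rev]
    exact key _ _ hh2 hg2
  inv_mem' := by
    rintro g ⟨h1, h2⟩
    exact ⟨h2, by simpa using h1⟩

theorem upperGL_mem {x y z : F} {hx : x ≠ 0} {hz : z ≠ 0} (h1 : ‖x‖ = 1) (h2 : ‖y‖ ≤ 1)
    (h3 : ‖z‖ = 1) : upperGL x y z hx hz ∈ integralSubgroup F := by
  constructor <;> intro i j
  · rw [upperGL_val]
    fin_cases i <;> fin_cases j <;> simp [h1, h2, h3]
  · rw [upperGL_inv_val]
    fin_cases i <;> fin_cases j <;> simp [h1, h2, h3]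

theorem lowerGL_mem {t : F} (h : ‖t‖ ≤ 1) : lowerGL t ∈ integralSubgroup F := by
  constructor <;> intro i j
  · change ‖(!![1, 0; t, 1] : Matrix (Fin 2) (Fin 2) F) i j‖ ≤ 1
    fin_cases i <;> fin_cases j <;> simp [h]
  · change ‖(!![1, 0; -t, 1] : Matrix (Fin 2) (Fin 2) F) i j‖ ≤ 1
    fin_cases i <;> fin_cases j <;> simp [h]

theorem swapGL_mem : swapGL F ∈ integralSubgroup F := by
  constructor <;> intro i j
  · change ‖(!![0, 1; 1, 0] : Matrix (Fin 2) (Fin 2) F) i j‖ ≤ 1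
    fin_cases i <;> fin_cases j <;> simp
  · change ‖(!![0, 1; 1, 0] : Matrix (Fin 2) (Fin 2) F) i j‖ ≤ 1
    fin_cases i <;> fin_cases j <;> simp

theorem exists_mul_eq_of_lower_left_zero {ϖ : F} (hϖ : IsUniformizer ϖ) (h : GL (Fin 2) F)
    (h0 : h 1 0 = 0) :
    ∃ κ ∈ integralSubgroup F, ∃ (m n : ℤ) (y : F),
      κ * h = upperGL (ϖ ^ m) y (ϖ ^ n) (zpow_ne_zero _ hϖ.1) (zpow_ne_zero _ hϖ.1) := by
  have hdet : h 0 0 * h 1 1 ≠ 0 := by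
    have := h.det_ne_zero
    rw [Matrix.det_fin_two, h0, mul_zero, sub_zero] at this
    exact this
  have hx := left_ne_zero_of_mul hdet
  have hz := right_ne_zero_of_mul hdet
  set m := val ϖ (h 0 0)
  set n := val ϖ (h 1 1)
  have hu : ∀ (x : F) (hx : x ≠ 0), ‖ϖ ^ val ϖ x / x‖ = 1 := by
    intro x hx
    rw [norm_div, norm_zpow, ← norm_eq_zpow_val hϖ hx, div_self (norm_ne_zero_iff.2 hx)]
  have hne : ∀ (x : F) (hx : x ≠ 0), ϖ ^ val ϖ x / x ≠ 0 :=
    fun x hx => div_ne_zero (zpow_ne_zero _ hϖ.1) hx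
  refine ⟨upperGL _ 0 _ (hne _ hx) (hne _ hz), upperGL_mem (hu _ hx) (by simp) (hu _ hz),
    m, n, ϖ ^ m / h 0 0 * h 0 1, ?_⟩
  ext i j
  rw [Units.val_mul, Matrix.mul_apply, Fin.sum_univ_two, upperGL_val, upperGL_val]
  fin_cases i <;> fin_cases j <;> simp [h0, m, n, hx, hz]

/-- Row reduction over O_F: after a swap the upper entry of the first column has the larger norm,
and an integral lower unipotent matrix clears the entry below it. The diagonal is then normalized to
powers of ϖ by units. -/
theorem exists_eq_mul_upperGL {ϖ : F} (hϖ : IsUniformizer ϖ) (h : GL (Fin 2) F) :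
    ∃ κ ∈ integralSubgroup F, ∃ (m n : ℤ) (y : F),
      h = κ * upperGL (ϖ ^ m) y (ϖ ^ n) (zpow_ne_zero _ hϖ.1) (zpow_ne_zero _ hϖ.1) := by
  suffices ∃ κ ∈ integralSubgroup F, (κ * h) 1 0 = 0 by
    obtain ⟨κ, hκ, h0⟩ := this
    obtain ⟨κ', hκ', m, n, y, he⟩ := exists_mul_eq_of_lower_left_zero hϖ _ h0
    refine ⟨(κ' * κ)⁻¹, inv_mem (mul_mem hκ' hκ), m, n, y, ?_⟩
    rw [← he]; group
  have main : ∀ g : GL (Fin 2) F, ‖g 1 0‖ ≤ ‖g 0 0‖ →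
      ∃ κ ∈ integralSubgroup F, (κ * g) 1 0 = 0 := by
    intro g hg
    have hp : g 0 0 ≠ 0 := by
      intro h0
      have h1 : g 1 0 = 0 := by rw [h0, norm_zero] at hg; exact norm_le_zero_iff.1 hg
      have := g.det_ne_zero
      rw [Matrix.det_fin_two, h0, h1] at this
      simp at this
    refine ⟨lowerGL (-(g 1 0) / g 0 0), lowerGL_mem ?_, ?_⟩
    · rw [norm_div, norm_neg]
      exact div_le_one_of_le₀ hg (norm_nonneg _)
    · simp [lowerGL, Matrix.mul_apply, hp]
  rcases le_total ‖h 1 0‖ ‖h 0 0‖ with hle | hle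
  · exact main h hle
  · obtain ⟨κ, hκ, h0⟩ := main (swapGL F * h) (by simpa [swapGL, Matrix.mul_apply] using hle)
    exact ⟨κ * swapGL F, mul_mem hκ swapGL_mem, by rwa [mul_assoc]⟩

theorem upperGL_coset_unique {ϖ : F} (hϖ : IsUniformizer ϖ) {κ : GL (Fin 2) F}
    (hκ : κ ∈ integralSubgroup F) {m n m' n' : ℤ} {y y' : F}
    (h : κ * upperGL (ϖ ^ m) y (ϖ ^ n) (zpow_ne_zero _ hϖ.1) (zpow_ne_zero _ hϖ.1)
      = upperGL (ϖ ^ m') y' (ϖ ^ n') (zpow_ne_zero _ hϖ.1) (zpow_ne_zero _ hϖ.1)) :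
    m = m' ∧ n = n' ∧ ‖y' - y‖ ≤ ‖ϖ‖ ^ n := by
  have key : ∀ {κ : GL (Fin 2) F} (hκ : κ ∈ integralSubgroup F) {m n m' n' : ℤ} {y y' : F}
    (h : κ * upperGL (ϖ ^ m) y (ϖ ^ n) (zpow_ne_zero _ hϖ.1) (zpow_ne_zero _ hϖ.1)
      = upperGL (ϖ ^ m') y' (ϖ ^ n') (zpow_ne_zero _ hϖ.1) (zpow_ne_zero _ hϖ.1)),
      m ≤ m' ∧ n ≤ n' ∧ ‖y' - ϖ ^ (m' - m) * y‖ ≤ ‖ϖ‖ ^ n := by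
    intro κ hκ m n m' n' y y' h
    have hk : κ = upperGL (ϖ ^ m') y' (ϖ ^ n') (zpow_ne_zero _ hϖ.1) (zpow_ne_zero _ hϖ.1) *
        (upperGL (ϖ ^ m) y (ϖ ^ n) (zpow_ne_zero _ hϖ.1) (zpow_ne_zero _ hϖ.1))⁻¹ := by
      rw [← h]; group
    rw [upperGL_inv, upperGL_mul] at hk
    have h00 := hκ.1 0 0
    have h01 := hκ.1 0 1
    have h11 := hκ.1 1 1
    rw [hk, upperGL_val] at h00 h01 h11
    simp only [Matrix.of_apply, Matrix.cons_val', Matrix.cons_val_zero, Matrix.cons_val_one,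
      Matrix.cons_val_fin_one] at h00 h01 h11
    have hd : ∀ a b : ℤ, ‖ϖ ^ a * (ϖ ^ b)⁻¹‖ ≤ 1 → b ≤ a := by
      intro a b hab
      rw [← zpow_neg, ← zpow_add₀ hϖ.1, norm_zpow, ← zpow_zero ‖ϖ‖, hϖ.zpow_le_zpow_iff] at hab
      omega
    refine ⟨hd _ _ h00, hd _ _ h11, ?_⟩
    have hz : ϖ ^ n ≠ 0 := zpow_ne_zero _ hϖ.1
    have hx : ϖ ^ m ≠ 0 := zpow_ne_zero _ hϖ.1
    have : y' - ϖ ^ (m' - m) * y = (ϖ ^ m' * (-y / (ϖ ^ m * ϖ ^ n)) + y' * (ϖ ^ n)⁻¹) * ϖ ^ n := by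
      rw [zpow_sub₀ hϖ.1]; field_simp; ring
    rw [this, norm_mul, norm_zpow]
    exact mul_le_of_le_one_left (zpow_nonneg (norm_nonneg _) _) h01
  obtain ⟨h1, h2, h3⟩ := key hκ h
  -- Integrality of κ gives one inequality between the exponents, and integrality of its inverse
  -- gives the other.
  obtain ⟨h4, h5, -⟩ := key (inv_mem hκ) (inv_mul_eq_iff_eq_mul.2 h.symm)
  obtain rfl : m = m' := le_antisymm h1 h4
  refine ⟨rfl, le_antisymm h2 h5, by simpa using h3⟩

theorem upperGL_eq_mul_of_norm_sub_le {x y y' z : F} {hx : x ≠ 0} {hz : z ≠ 0}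
    (h : ‖y - y'‖ ≤ ‖z‖) : ∃ κ ∈ integralSubgroup F,
      upperGL x y z hx hz = κ * upperGL x y' z hx hz := by
  refine ⟨upperGL 1 ((y - y') / z) 1 one_ne_zero one_ne_zero,
    upperGL_mem (by simp) ?_ (by simp), ?_⟩
  · rw [norm_div]; exact div_le_one_of_le₀ h (norm_nonneg _)
  · rw [upperGL_mul]
    exact upperGL_congr (by simp) (by field_simp; ring) (by simp)

end Iwasawa

/-! ### GL₂(O_F) is open and compact. -/

section Haar

variable {F : Type*} [NormedField F]

theorem continuous_entry (i j : Fin 2) : Continuous fun h : GL (Fin 2) F => h i j :=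
  (Units.continuous_val (M := Matrix (Fin 2) (Fin 2) F)).matrix_elem i j

variable [IsUltrametricDist F]

theorem isOpen_integralGL : IsOpen (integralGL F) := by
  have h1 : ∀ i j : Fin 2, IsOpen {h : GL (Fin 2) F | ‖h i j‖ ≤ 1} := by
    intro i j
    have := (IsUltrametricDist.isOpen_closedBall (0 : F) one_ne_zero).preimage
      (continuous_entry (F := F) i j)
    simpa [Set.preimage] using this
  have : integralGL F = (⋂ i, ⋂ j, {h : GL (Fin 2) F | ‖h i j‖ ≤ 1}) ∩
      (⋂ i, ⋂ j, (fun h : GL (Fin 2) F => h⁻¹) ⁻¹' {h : GL (Fin 2) F | ‖h i j‖ ≤ 1}) := by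
    ext h; simp [integralGL]
  rw [this]
  exact (isOpen_iInter_of_finite fun i => isOpen_iInter_of_finite fun j => h1 i j).inter
    (isOpen_iInter_of_finite fun i => isOpen_iInter_of_finite fun j =>
      (h1 i j).preimage continuous_inv)

theorem isCompact_integralGL {F : Type*} [NormedField F] [ProperSpace F] : IsCompact (integralGL F) := by
  let S : Set (Matrix (Fin 2) (Fin 2) F) :=
    Set.univ.pi fun _ => Set.univ.pi fun _ => Metric.closedBall (0 : F) 1
  have hS : IsCompact S := isCompact_univ_pi fun _ => isCompact_univ_pi fun _ =>
    isCompact_closedBall _ _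
  have hS' : IsCompact (S ×ˢ (MulOpposite.unop ⁻¹' S) :
      Set (Matrix (Fin 2) (Fin 2) F × (Matrix (Fin 2) (Fin 2) F)ᵐᵒᵖ)) := by
    refine hS.prod ?_
    exact (MulOpposite.opHomeomorph (M := Matrix (Fin 2) (Fin 2) F)).symm.isCompact_preimage.2 hS
  -- The unit group carries the topology induced by g ↦ (g, g⁻¹), which is a closed embedding;
  -- bounding both components therefore yields a compact set.
  have := (Units.isClosedEmbedding_embedProduct
    (α := Matrix (Fin 2) (Fin 2) F)).isCompact_preimage hS'
  convert this using 1
  ext h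
  have hmem : ∀ A : Matrix (Fin 2) (Fin 2) F, A ∈ S ↔ ∀ i j, ‖A i j‖ ≤ 1 := fun A =>
    ⟨fun hA i j => mem_closedBall_zero_iff.1 (hA i trivial j trivial),
      fun hA i _ j _ => mem_closedBall_zero_iff.2 (hA i j)⟩
  change _ ↔ h.val ∈ S ∧ h⁻¹.val ∈ S
  rw [hmem, hmem]
  rfl

end Haar

/-! ### Volumes of cosets and integration over them. -/

section Modular

variable {F : Type*} [NormedField F]

theorem locallyCompactSpace_GL [ProperSpace F] : LocallyCompactSpace (GL (Fin 2) F) := by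
  have : LocallyCompactSpace (Matrix (Fin 2) (Fin 2) F) :=
    inferInstanceAs (LocallyCompactSpace (Fin 2 → Fin 2 → F))
  exact inferInstanceAs (LocallyCompactSpace (Matrix (Fin 2) (Fin 2) F)ˣ)

/-- A character of `GL₂(F)` with values in the nonnegative reals that is trivial on the centre
is trivial on upper triangular matrices. -/
theorem character_upperGL_eq_one {ϖ : F} (hϖ : IsUniformizer ϖ) (Δ : GL (Fin 2) F →* NNReal)
    (hcentre : ∀ (x : F) (hx : x ≠ 0), Δ (upperGL x 0 x hx hx) = 1) (x y z : F) (hx : x ≠ 0)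
    (hz : z ≠ 0) : Δ (upperGL x y z hx hz) = 1 := by
  have hconj : ∀ g h : GL (Fin 2) F, Δ (g * h * g⁻¹) = Δ h := by
    intro g h
    rw [map_mul, map_mul, mul_right_comm, ← map_mul, mul_inv_cancel, map_one, one_mul]
  have hswap : ∀ (x : F) (hx : x ≠ 0),
      swapGL F * upperGL x 0 1 hx one_ne_zero * (swapGL F)⁻¹ = upperGL 1 0 x one_ne_zero hx := by
    intro x hx
    rw [mul_inv_eq_iff_eq_mul]
    ext i j
    rw [Units.val_mul, Units.val_mul, upperGL_val, upperGL_val]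
    fin_cases i <;> fin_cases j <;> simp [swapGL, Matrix.mul_apply]
  -- diag(x, 1) and diag(1, x) are conjugate and their product is central, so the square of the
  -- value is 1; nonnegativity removes the sign.
  have hdiag : ∀ (x : F) (hx : x ≠ 0), Δ (upperGL x 0 1 hx one_ne_zero) = 1 := by
    intro x hx
    have h1 : Δ (upperGL x 0 1 hx one_ne_zero) * Δ (upperGL x 0 1 hx one_ne_zero) = 1 := by
      nth_rewrite 2 [← hconj (swapGL F)]
      rw [hswap, ← map_mul, upperGL_mul, ← hcentre x hx]
      exact congrArg Δ (upperGL_congr (by simp) (by simp) (by simp))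
    have h2 : Δ (upperGL x 0 1 hx one_ne_zero) ^ 2 = 1 := by rw [sq, h1]
    exact (pow_eq_one_iff_of_nonneg zero_le two_ne_zero).1 h2
  -- Conjugation by diag(ϖ, 1) multiplies the off-diagonal entry by ϖ. Starting from t/(ϖ - 1), the
  -- entry grows by exactly t, so the unipotent matrix with entry t is a commutator.
  have hunip : ∀ t : F, Δ (upperGL 1 t 1 one_ne_zero one_ne_zero) = 1 := by
    intro t
    have hϖ1 : ϖ - 1 ≠ 0 := by
      intro h
      have := hϖ.2.1
      rw [sub_eq_zero.1 h, norm_one] at this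
      exact lt_irrefl _ this
    have h1 := hconj (upperGL ϖ 0 1 hϖ.1 one_ne_zero)
      (upperGL 1 (t / (ϖ - 1)) 1 one_ne_zero one_ne_zero)
    rw [upperGL_inv, upperGL_mul, upperGL_mul] at h1
    have h2 : upperGL (ϖ * 1 * ϖ⁻¹) (ϖ * 1 * (-0 / (ϖ * 1)) + (ϖ * (t / (ϖ - 1)) + 0 * 1) * 1⁻¹)
        (1 * 1 * 1⁻¹) (by simp [hϖ.1]) (by simp) =
        upperGL 1 (t / (ϖ - 1)) 1 one_ne_zero one_ne_zero *
          upperGL 1 t 1 one_ne_zero one_ne_zero := by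
      rw [upperGL_mul]
      refine upperGL_congr (by field_simp [hϖ.1]) ?_ (by simp)
      field_simp
      ring
    rw [h2, map_mul] at h1
    have h3 : Δ (upperGL 1 (t / (ϖ - 1)) 1 one_ne_zero one_ne_zero) ≠ 0 := by
      intro h0
      have := map_mul Δ (upperGL 1 (t / (ϖ - 1)) 1 one_ne_zero one_ne_zero)
        (upperGL 1 (t / (ϖ - 1)) 1 one_ne_zero one_ne_zero)⁻¹
      rw [mul_inv_cancel, map_one, h0, zero_mul] at this
      exact one_ne_zero this
    exact mul_left_cancel₀ h3 (by rw [h1, mul_one])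
  have : upperGL x y z hx hz = upperGL z 0 z hz hz * upperGL (x / z) 0 1 (div_ne_zero hx hz)
      one_ne_zero * upperGL 1 (y / x) 1 one_ne_zero one_ne_zero := by
    rw [upperGL_mul, upperGL_mul]
    exact upperGL_congr (by field_simp) (by field_simp; ring) (by simp)
  rw [this, map_mul, map_mul, hcentre, hdiag, hunip, one_mul, one_mul]

variable [ProperSpace F] [IsUltrametricDist F] [MeasurableSpace (GL (Fin 2) F)]
  [BorelSpace (GL (Fin 2) F)] (μ : Measure (GL (Fin 2) F)) [μ.IsHaarMeasure]

/-- Right translation scales Haar measure by the modular character. That character is trivial on the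
centre, where left and right translations agree, hence on all triangular matrices by
`character_upperGL_eq_one`. -/
theorem measure_preimage_mul_right_upperGL {ϖ : F} (hϖ : IsUniformizer ϖ) (x y z : F)
    (hx : x ≠ 0) (hz : z ≠ 0) :
    μ ((fun g => g * upperGL x y z hx hz) ⁻¹' integralGL F) = μ (integralGL F) := by
  have : LocallyCompactSpace (GL (Fin 2) F) := locallyCompactSpace_GL
  have hmeas : Measurable fun g => g * upperGL x y z hx hz :=
    (continuous_mul_const (upperGL x y z hx hz)).measurable
  rw [← Measure.map_apply hmeas isOpen_integralGL.measurableSet]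
  have hcl : IsCompact (closure (integralGL F)) := isCompact_integralGL.closure
  rw [Measure.measure_isMulInvariant_eq_smul_of_isCompact_closure _ μ hcl,
    ← Measure.modularCharacterFun_eq_haarScalarFactor]
  have hΔ : Measure.modularCharacter (upperGL x y z hx hz) = 1 := by
    refine character_upperGL_eq_one hϖ _ (fun t ht => ?_) x y z hx hz
    have hmap : Measure.map (· * upperGL t 0 t ht ht) μ = μ := by
      have : (fun g => g * upperGL t 0 t ht ht) = fun g => upperGL t 0 t ht ht * g := by
        funext g
        ext i j
        rw [Units.val_mul, Units.val_mul, upperGL_val, Matrix.mul_apply, Matrix.mul_apply]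
        fin_cases i <;> fin_cases j <;> simp [mul_comm]
      rw [this]
      exact map_mul_left_eq_self μ _
    change Measure.modularCharacterFun _ = 1
    rw [Measure.modularCharacterFun_eq_haarScalarFactor μ]
    simp only [hmap, Measure.haarScalarFactor_self]
  change Measure.modularCharacter (upperGL x y z hx hz) • _ = _
  rw [hΔ, one_smul]

/-- Integration over a finite union of cosets of `GL₂(O_F)`. -/
theorem integral_eq_sum_of_left_invariant (hμ : μ (integralGL F) = 1) {ϖ : F}
    (hϖ : IsUniformizer ϖ) {ι : Type*} (T : Finset ι) (m n : ι → ℤ) (y : ι → F)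
    (f : GL (Fin 2) F → ℂ) (hf : ∀ κ ∈ integralSubgroup F, ∀ h, f (κ * h) = f h)
    (hT : ∀ i ∈ T, ∀ j ∈ T, m i = m j → n i = n j → ‖y j - y i‖ ≤ ‖ϖ‖ ^ n i → i = j)
    (hsupp : ∀ h, f h ≠ 0 → ∃ i ∈ T, ∃ κ ∈ integralSubgroup F, h = κ *
      upperGL (ϖ ^ m i) (y i) (ϖ ^ n i) (zpow_ne_zero _ hϖ.1) (zpow_ne_zero _ hϖ.1)) :
    Integrable f μ ∧ ∫ h, f h ∂μ = ∑ i ∈ T, f (upperGL (ϖ ^ m i) (y i) (ϖ ^ n i)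
      (zpow_ne_zero _ hϖ.1) (zpow_ne_zero _ hϖ.1)) := by
  set g : ι → GL (Fin 2) F := fun i => upperGL (ϖ ^ m i) (y i) (ϖ ^ n i)
    (zpow_ne_zero _ hϖ.1) (zpow_ne_zero _ hϖ.1) with hg
  -- S i is the coset GL₂(O_F) · g i. These cosets have volume 1 and are disjoint, and f is constant
  -- on each and vanishes outside their union.
  let S : ι → Set (GL (Fin 2) F) := fun i => (fun h => h * (g i)⁻¹) ⁻¹' integralGL F
  have hSm : ∀ i, MeasurableSet (S i) := fun i =>
    (isOpen_integralGL.preimage (continuous_mul_const (g i)⁻¹)).measurableSet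
  have hSμ : ∀ i, μ (S i) = 1 := by
    intro i
    simp only [S, hg, upperGL_inv]
    rw [measure_preimage_mul_right_upperGL μ hϖ, hμ]
  have hval : ∀ i, ∀ h ∈ S i, f h = f (g i) := by
    intro i h hh
    have := hf _ (show h * (g i)⁻¹ ∈ integralSubgroup F from hh) (g i)
    rwa [inv_mul_cancel_right] at this
  have hdisj : ∀ i ∈ T, ∀ j ∈ T, ∀ h, h ∈ S i → h ∈ S j → i = j := by
    intro i hi j hj h h1 h2
    have hk : (h * (g j)⁻¹)⁻¹ * (h * (g i)⁻¹) ∈ integralSubgroup F :=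
      mul_mem (inv_mem h2) h1
    obtain ⟨e1, e2, e3⟩ := upperGL_coset_unique hϖ hk (m := m i) (n := n i) (y := y i)
      (m' := m j) (n' := n j) (y' := y j) (by
        change _ * g i = g j
        group)
    exact hT i hi j hj e1 e2 e3
  have hfeq : f = fun h => ∑ i ∈ T, (S i).indicator (fun _ => f (g i)) h := by
    funext h
    by_cases hex : ∃ i ∈ T, h ∈ S i
    · obtain ⟨i, hi, hhi⟩ := hex
      rw [Finset.sum_eq_single_of_mem i hi, Set.indicator_of_mem hhi, hval i h hhi]
      intro j hj hji
      exact Set.indicator_of_notMem (fun hhj => hji (hdisj j hj i hi h hhj hhi)) _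
    · rw [Finset.sum_eq_zero fun i hi =>
        Set.indicator_of_notMem (fun hh => hex ⟨i, hi, hh⟩) _]
      by_contra h0
      obtain ⟨i, hi, κ, hκ, rfl⟩ := hsupp h h0
      refine hex ⟨i, hi, ?_⟩
      change κ * g i * (g i)⁻¹ ∈ integralSubgroup F
      rwa [mul_inv_cancel_right]
  have hint : ∀ i ∈ T, Integrable ((S i).indicator fun _ => f (g i)) μ := by
    intro i _
    rw [integrable_indicator_iff (hSm i)]
    exact integrableOn_const (by rw [hSμ]; exact ENNReal.one_ne_top)
  constructor
  · rw [hfeq]; exact integrable_finsetSum _ hint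
  · rw [hfeq, integral_finsetSum _ hint]
    refine Finset.sum_congr rfl fun i hi => ?_
    rw [← hfeq, integral_indicator_const _ (hSm i), Measure.real, hSμ]
    simp [hg]

end Modular

/-! ### Alternating sums over k for fixed n. -/

section Sums

theorem neg_one_zpow_eq_of_even_sub {a b : ℤ} (h : Even (a - b)) : (-1 : ℂ) ^ a = (-1) ^ b := by
  rw [← sub_add_cancel a b, zpow_add₀ (by norm_num), h.neg_one_zpow, one_mul]

theorem neg_one_zpow_add_one (a : ℤ) : (-1 : ℂ) ^ (a + 1) = -(-1) ^ a := by
  rw [zpow_add₀ (by norm_num), zpow_one, mul_neg_one]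

theorem sum_Ico_int_succ_top {M : Type*} [AddCommMonoid M] {a b : ℤ} (h : a ≤ b) (f : ℤ → M) :
    ∑ i ∈ Finset.Ico a (b + 1), f i = ∑ i ∈ Finset.Ico a b, f i + f b := by
  rw [← Finset.insert_Ico_right_eq_Ico_add_one h, Finset.sum_insert (by simp), add_comm]

theorem sum_Ico_int_consecutive {M : Type*} [AddCommMonoid M] {a b c : ℤ} (h₁ : a ≤ b)
    (h₂ : b ≤ c) (f : ℤ → M) :
    ∑ i ∈ Finset.Ico a c, f i = ∑ i ∈ Finset.Ico a b, f i + ∑ i ∈ Finset.Ico b c, f i := by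
  rw [← Finset.sum_union (Finset.Ico_disjoint_Ico_consecutive a b c),
    Finset.Ico_union_Ico_eq_Ico h₁ h₂]

/-- The indices 2j - 1 and 2j share the value w j, and their signed factors -(2j - 1 + X) and 2j + X
add up to 1. The shift X disappears. -/
theorem sum_Ico_pairs (w : ℤ → ℂ) (X : ℂ) {a b : ℤ} (hab : a ≤ b) :
    ∑ i ∈ Finset.Ico (2 * a - 1) (2 * b - 1), (-1 : ℂ) ^ i * (i + X) * w ((i + 1) / 2)
      = ∑ j ∈ Finset.Ico a b, w j := by
  induction b, hab using Int.leInduction with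
  | base => simp
  | succ b hab ih =>
    rw [show 2 * (b + 1) - 1 = 2 * b - 1 + 1 + 1 by ring, sum_Ico_int_succ_top (by omega),
      sum_Ico_int_succ_top (by omega), sum_Ico_int_succ_top hab, ih,
      show (2 * b - 1 + 1) / 2 = b by omega, show (2 * b - 1 + 1 + 1) / 2 = b by omega,
      neg_one_zpow_add_one, Odd.neg_one_zpow ⟨b - 1, by ring⟩]
    push_cast
    ring

/-- A primitive of `k ↦ (-1) ^ (k + c) * (k + c)`. -/
noncomputable def altPrim (c k : ℤ) : ℂ := -((-1) ^ (k + c) * (2 * (k + c) - 1) / 4)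

theorem sum_Ico_alt (c : ℤ) {a b : ℤ} (hab : a ≤ b) :
    ∑ k ∈ Finset.Ico a b, (-1 : ℂ) ^ (k + c) * ((k : ℂ) + c) = altPrim c b - altPrim c a := by
  induction b, hab using Int.leInduction with
  | base => simp
  | succ b hab ih =>
    rw [sum_Ico_int_succ_top hab, ih, altPrim, altPrim, altPrim,
      show b + 1 + c = b + c + 1 by ring, neg_one_zpow_add_one]
    push_cast
    ring

theorem sum_Ico_ite_le (f : ℤ → ℂ) {lo a b : ℤ} (h1 : lo ≤ a) (h2 : a ≤ b) :
    ∑ k ∈ Finset.Ico lo b, (if a ≤ k then f k else 0) = ∑ k ∈ Finset.Ico a b, f k := by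
  rw [sum_Ico_int_consecutive h1 h2, Finset.sum_eq_zero, zero_add]
  · exact Finset.sum_congr rfl fun k hk => if_pos (Finset.mem_Ico.1 hk).1
  · exact fun k hk => if_neg (not_le.2 (Finset.mem_Ico.1 hk).2)

variable (w : ℤ → ℂ) (n r : ℕ) (vc : ℤ)

/-- Substitution i = k + n - r: the argument of w becomes half of i rounded up, and the remaining
sign depends only on r + v(c). -/
theorem sum_shift (a b : ℤ) :
    ∑ k ∈ Finset.Ico (a - n + r) (b - n + r), (-1 : ℂ) ^ (k + (n + vc)) *
        ((k : ℂ) + ((n + vc : ℤ) : ℂ)) * w ((k + n - r + 1) / 2)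
      = (-1) ^ (r + vc) * ∑ i ∈ Finset.Ico a b, (-1 : ℂ) ^ i * (i + ((r + vc : ℤ) : ℂ)) *
          w ((i + 1) / 2) := by
  rw [Finset.mul_sum, show a - n + r = a + (-n + r) by ring,
    show b - n + r = b + (-n + r) by ring, ← Finset.sum_Ico_add']
  refine Finset.sum_congr rfl fun i _ => ?_
  rw [show i + (-n + r) + (n + vc) = (r + vc) + i by ring, zpow_add₀ (by norm_num),
    show i + (-(n : ℤ) + r) + n - r + 1 = i + 1 by ring]
  push_cast
  ring

/-- Because l is odd, the shifted interval from 2n - 2r - l to 2n starts at an odd index and ends at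
an even one, so it decomposes exactly into the pairs of `sum_Ico_pairs`. -/
theorem sum_of_single_range {l lo hi : ℤ} (hl : Odd l) (hl0 : 0 < l) (cnt : ℤ → ℂ)
    (hcnt : ∀ k, cnt k = if n - r - l ≤ k ∧ k ≤ n + r then w ((k + n - r + 1) / 2) else 0)
    (hlo : lo ≤ n - r - l) (hhi : n + r < hi) :
    ∑ k ∈ Finset.Ico lo hi, (-1 : ℂ) ^ (k + (n + vc)) * ((k : ℂ) + ((n + vc : ℤ) : ℂ)) * cnt k
      = (-1) ^ (r + vc) * ∑ j ∈ Finset.Ico (n - r - (l - 1) / 2 : ℤ) (n + 1), w j := by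
  obtain ⟨h, rfl⟩ := hl
  rw [← Finset.sum_subset (s₁ := Finset.Ico (n - r - (2 * h + 1) : ℤ) (n + r + 1))
    (Finset.Ico_subset_Ico hlo (by omega))]
  · rw [← sum_Ico_pairs w ((r + vc : ℤ) : ℂ) (by omega), ← sum_shift w n r vc,
      show (2 * h + 1 - 1) / 2 = h by omega,
      show 2 * (n - r - h : ℤ) - 1 - n + r = n - r - (2 * h + 1) by ring,
      show 2 * ((n : ℤ) + 1) - 1 - n + r = n + r + 1 by ring]
    refine Finset.sum_congr rfl fun k hk => ?_
    rw [Finset.mem_Ico] at hk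
    rw [hcnt, if_pos (by omega)]
  · intro k _ hk
    rw [Finset.mem_Ico] at hk
    rw [hcnt, if_neg (by omega), mul_zero]

/-- With R = n - r - δ, the range k > R - δ pairs off as before. Below R - δ the weight is constant
on two half-lines with the same right end. Their left ends -δ and δ - l have opposite parity, which
produces the term l - 2δ; the unpaired index k = R - δ contributes to the remaining 1/2. -/
theorem sum_of_three_ranges {l δ lo hi : ℤ} (hl : Odd l) (hδ : 0 ≤ δ) (hl2 : 2 * δ < l)
    (hR : 0 ≤ n - r - δ) (cnt : ℤ → ℂ)
    (hcnt : ∀ k, cnt k = if n - r - 2 * δ ≤ k then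
        (if k ≤ n + r then w ((k + n - r + 1) / 2) else 0)
      else (if -δ ≤ k then w (n - r - δ) else 0) + (if δ - l ≤ k then w (n - r - δ) else 0))
    (hlo : lo ≤ δ - l) (hhi : n + r < hi) :
    ∑ k ∈ Finset.Ico lo hi, (-1 : ℂ) ^ (k + (n + vc)) * ((k : ℂ) + ((n + vc : ℤ) : ℂ)) * cnt k
      = (-1) ^ (r + vc) * (∑ j ∈ Finset.Ico (n - r - δ + 1 : ℤ) (n + 1), w j +
        w (n - r - δ) * ((1 + (-1) ^ (n - r - δ : ℤ) * (l - 2 * δ)) / 2)) := by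
  set R : ℤ := n - r - δ with hRdef
  set c : ℤ := n + vc with hc
  set hh : ℤ → ℂ := fun k => (-1 : ℂ) ^ (k + c) * ((k : ℂ) + (c : ℂ)) with hhdef
  have hlow : ∑ k ∈ Finset.Ico lo (R - δ), hh k * cnt k =
      w R * (2 * altPrim c (R - δ) - altPrim c (-δ) - altPrim c (δ - l)) := by
    have : ∀ k ∈ Finset.Ico lo (R - δ), hh k * cnt k =
        w R * ((if -δ ≤ k then hh k else 0) + (if δ - l ≤ k then hh k else 0)) := by
      intro k hk
      rw [Finset.mem_Ico] at hk
      rw [hcnt, if_neg (by omega)]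
      split_ifs <;> ring
    rw [Finset.sum_congr rfl this, ← Finset.mul_sum, Finset.sum_add_distrib,
      sum_Ico_ite_le _ (by omega) (by omega), sum_Ico_ite_le _ (by omega) (by omega),
      sum_Ico_alt c (by omega), sum_Ico_alt c (by omega)]
    ring
  have hhigh : ∑ k ∈ Finset.Ico (n + r + 1 : ℤ) hi, hh k * cnt k = 0 := by
    refine Finset.sum_eq_zero fun k hk => ?_
    rw [Finset.mem_Ico] at hk
    rw [hcnt, if_pos (by omega), if_neg (by omega), mul_zero]
  have hmid : ∑ k ∈ Finset.Ico (R - δ + 1) (n + r + 1 : ℤ), hh k * cnt k =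
      (-1) ^ (r + vc) * ∑ j ∈ Finset.Ico (R + 1) (n + 1 : ℤ), w j := by
    rw [← sum_Ico_pairs w ((r + vc : ℤ) : ℂ) (by omega), ← sum_shift w n r vc,
      show 2 * (R + 1) - 1 - n + r = R - δ + 1 by omega,
      show 2 * ((n : ℤ) + 1) - 1 - n + r = n + r + 1 by ring]
    refine Finset.sum_congr rfl fun k hk => ?_
    rw [Finset.mem_Ico] at hk
    rw [hcnt, if_pos (by omega), if_pos (by omega)]
  -- At k = R - δ the number k + n - r equals 2R, so the ball already has radius exponent R, but its
  -- odd partner 2R - 1 lies in the constant regime.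
  have hsing : hh (R - δ) * cnt (R - δ) = (-1) ^ (r + vc) * ((R - δ + c : ℤ) : ℂ) * w R := by
    rw [hcnt, if_pos (by omega), if_pos (by omega), show (R - δ + n - r + 1) / 2 = R by omega,
      hhdef]
    simp only
    rw [neg_one_zpow_eq_of_even_sub (b := r + vc) ⟨R, by omega⟩]
    push_cast
    ring
  rw [sum_Ico_int_consecutive (b := R - δ) (by omega) (by omega),
    sum_Ico_int_consecutive (a := R - δ) (b := n + r + 1) (by omega) (by omega),
    sum_Ico_int_consecutive (a := R - δ) (b := R - δ + 1) (by omega) (by omega),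
    sum_Ico_int_succ_top le_rfl, Finset.Ico_self, Finset.sum_empty, zero_add]
  change ∑ k ∈ Finset.Ico lo (R - δ), hh k * cnt k + (hh (R - δ) * cnt (R - δ) +
    ∑ k ∈ Finset.Ico (R - δ + 1) (n + r + 1 : ℤ), hh k * cnt k +
      ∑ k ∈ Finset.Ico (n + r + 1 : ℤ) hi, hh k * cnt k) = _
  rw [hlow, hhigh, hmid, hsing, altPrim, altPrim, altPrim,
    neg_one_zpow_eq_of_even_sub (a := R - δ + c) (b := r + vc) ⟨R, by omega⟩,
    neg_one_zpow_eq_of_even_sub (a := -δ + c) (b := R + (r + vc)) ⟨0, by omega⟩]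
  obtain ⟨h, rfl⟩ := hl
  -- Oddness of l flips this sign relative to the endpoint -δ, so in the two boundary terms
  -- everything cancels except the difference l - 2δ.
  rw [neg_one_zpow_eq_of_even_sub (a := δ - (2 * h + 1) + c) (b := R + (r + vc) + 1)
    ⟨δ - h - 1, by omega⟩, neg_one_zpow_add_one,
    zpow_add₀ (by norm_num : (-1 : ℂ) ≠ 0) R (r + vc)]
  push_cast
  ring

end Sums

/-! ### Summation over n and comparison with the constants. -/

section Totals

/-- The number of classes modulo `ϖ ^ n` in the ball of radius `|ϖ| ^ j`, for `j ≤ n`. -/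
def ballCount (Q : ℂ) (n : ℕ) (j : ℤ) : ℂ := Q ^ (n - j.toNat)

/-- The contribution of `n` when `k` ranges over a single interval. -/
noncomputable def singleRange (Q : ℂ) (h : ℤ) (n r : ℕ) : ℂ :=
  ∑ j ∈ Finset.Ico (n - r - h : ℤ) (n + 1), ballCount Q n j

/-- The contribution of `n` when `k` ranges over three intervals. -/
noncomputable def threeRange (Q : ℂ) (l δ : ℤ) (n r : ℕ) : ℂ :=
  ∑ j ∈ Finset.Ico (n - r - δ + 1 : ℤ) (n + 1), ballCount Q n j +
    ballCount Q n (n - r - δ) * ((1 + (-1) ^ (n - r - δ : ℤ) * (l - 2 * δ)) / 2)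

variable (Q : ℂ)

theorem sum_Ico_int_eq_add_bot {M : Type*} [AddCommMonoid M] {a b : ℤ} (h : a < b) (f : ℤ → M) :
    ∑ i ∈ Finset.Ico a b, f i = f a + ∑ i ∈ Finset.Ico (a + 1) b, f i := by
  rw [sum_Ico_int_consecutive (b := a + 1) (by omega) (by omega), sum_Ico_int_succ_top le_rfl]
  simp

/-- Raising r by one adds just one term at the bottom of the summation range. -/
theorem singleRange_sub {h : ℤ} (hh : 0 ≤ h) (n r : ℕ) :
    singleRange Q h n (r + 1) - singleRange Q h n r = ballCount Q n (n - (r + 1) - h) := by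
  rw [singleRange, singleRange, sum_Ico_int_eq_add_bot (by push_cast; omega)]
  push_cast
  rw [show (n - (r + 1) - h + 1 : ℤ) = n - r - h by ring]
  ring

/-- R drops by one: the term at the old R enters the full sum with coefficient 1 while half of it,
with alternating correction, leaves. What remains has the same coefficient as the new boundary term.
-/
theorem threeRange_sub {l δ : ℤ} (hδ : 0 ≤ δ) (n r : ℕ) (hR : 0 ≤ (n - (r + 1) - δ : ℤ)) :
    threeRange Q l δ n (r + 1) - threeRange Q l δ n r =
      (Q ^ (r + δ.toNat + 1) + Q ^ (r + δ.toNat)) *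
        ((1 + (-1) ^ (n - (r + 1) - δ : ℤ) * (l - 2 * δ)) / 2) := by
  rw [threeRange, threeRange, sum_Ico_int_eq_add_bot (by push_cast; omega)]
  push_cast
  rw [show (n - (r + 1) - δ + 1 : ℤ) = n - r - δ by ring,
    show (n - r - δ : ℤ) = n - (r + 1) - δ + 1 by ring, neg_one_zpow_add_one, ballCount,
    ballCount, show n - (n - (r + 1) - δ + 1 : ℤ).toNat = r + δ.toNat by omega,
    show n - (n - (r + 1) - δ : ℤ).toNat = r + δ.toNat + 1 by omega]
  ring

theorem sum_Icc_zpow (N : ℤ) :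
    ∑ j ∈ Finset.Icc (0 : ℤ) N, Q ^ j = ∑ n ∈ Finset.range (N + 1).toNat, Q ^ n := by
  refine (Finset.sum_bij (fun (n : ℕ) _ => (n : ℤ)) ?_ ?_ ?_ ?_).symm
  · intro n hn; rw [Finset.mem_range] at hn; rw [Finset.mem_Icc]; omega
  · intro a _ b _ h; exact_mod_cast h
  · intro j hj
    rw [Finset.mem_Icc] at hj
    exact ⟨j.toNat, by rw [Finset.mem_range]; omega, by omega⟩
  · intro n _; simp

theorem constN_eq (r : ℕ) {vb vc ve : ℤ} {δ : WithTop ℤ}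
    (h : ((vb + vc : ℤ) : WithTop ℤ) < δ + δ) :
    constN r vb vc ve δ = min ve ((vb + vc - 1) / 2 + r) := by
  rw [constN]
  induction δ using WithTop.recTopCoe with
  | top => rw [top_add, min_top_right, ← WithTop.coe_min, WithTop.untopD_coe]
  | coe d =>
    rw [← WithTop.coe_add, WithTop.coe_lt_coe] at h
    rw [← WithTop.coe_add, ← WithTop.coe_min, ← WithTop.coe_min, WithTop.untopD_coe]
    omega

theorem constN_eq_of_lt (r : ℕ) {vb vc ve d : ℤ} (h : d + d < vb + vc) :
    constN r vb vc ve d = min ve (d + r) := by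
  rw [constN, ← WithTop.coe_add, ← WithTop.coe_min, ← WithTop.coe_min, WithTop.untopD_coe]
  omega

theorem sum_single_eq (r : ℕ) {vb vc : ℤ} (ve : ℤ) {δ : WithTop ℤ}
    (hpos : 0 < vb + vc) (h : ((vb + vc : ℤ) : WithTop ℤ) < δ + δ) :
    ∑ n ∈ Finset.range (ve + 1).toNat, (singleRange Q ((vb + vc - 1) / 2) n (r + 1)
        - singleRange Q ((vb + vc - 1) / 2) n r) =
      (∑ j ∈ Finset.Icc (0 : ℤ) (constN (r + 1) vb vc ve δ), Q ^ j)
        + (constC (r + 1) vb vc ve δ : ℂ) * Q ^ constN (r + 1) vb vc ve δ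
        + (constC' (r + 1) vb vc ve δ : ℂ) * Q ^ (constN (r + 1) vb vc ve δ - 1) := by
  have hlt : ¬ δ + δ < ((vb + vc : ℤ) : WithTop ℤ) := h.not_gt
  have hC' : constC' (r + 1) vb vc ve δ = 0 := by
    rw [constC', if_neg (fun hc => hlt hc.2)]
  have hC : constC (r + 1) vb vc ve δ =
      if (vb + vc - 1) / 2 + (r + 1 : ℕ) ≤ ve then (ve : ℚ) - constN (r + 1) vb vc ve δ else 0 := by
    simp only [constC]
    rw [if_neg (fun hc => hlt hc.2.2), if_neg (fun hc => hlt hc.2.2)]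
    simp only [h, and_true]
  rw [hC, hC', sum_Icc_zpow, constN_eq _ h]
  set m : ℕ := ((vb + vc - 1) / 2 + (r + 1 : ℕ)).toNat with hm
  have hm' : (vb + vc - 1) / 2 + (r + 1 : ℕ) = (m : ℤ) := by omega
  -- The truncation in `ballCount` turns the single surviving power into Q^min(n, m): a geometric
  -- sum up to m, then a constant tail that accounts for C.
  have hterm : ∀ n : ℕ, singleRange Q ((vb + vc - 1) / 2) n (r + 1)
        - singleRange Q ((vb + vc - 1) / 2) n r = Q ^ min n m := by
    intro n
    rw [singleRange_sub Q (by omega), ballCount]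
    congr 1
    omega
  simp only [hterm, hm']
  rcases lt_or_ge ve m with hve | hve
  · rw [min_eq_left hve.le, if_neg (not_le.2 hve)]
    simp only [Rat.cast_zero, zero_mul, add_zero]
    refine Finset.sum_congr rfl fun n hn => ?_
    rw [Finset.mem_range] at hn
    rw [min_eq_left (by omega)]
  · rw [min_eq_right hve, if_pos hve]
    obtain ⟨t, rfl⟩ := Int.le.dest hve
    rw [show ((m + t + 1 : ℤ)).toNat = m + 1 + t by omega,
      show ((m + 1 : ℤ)).toNat = m + 1 by omega, Finset.sum_range_add]
    have h1 : ∀ x ∈ Finset.range (m + 1), Q ^ min x m = Q ^ x := fun x hx => by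
      rw [Finset.mem_range] at hx; rw [min_eq_left (by omega)]
    have h2 : ∀ x ∈ Finset.range t, Q ^ min (m + 1 + x) m = Q ^ m := fun x _ => by
      rw [min_eq_right (by omega)]
    rw [Finset.sum_congr rfl h1, Finset.sum_congr rfl h2]
    simp

theorem sum_half_alt (x : ℂ) (t : ℕ) :
    ∑ i ∈ Finset.range (t + 1), (1 + (-1) ^ i * x) / 2 =
      if Even t then t / 2 + (1 + x) / 2 else (t + 1) / 2 := by
  induction t with
  | zero => simp
  | succ t ih =>
    rw [Finset.sum_range_succ, ih]
    by_cases ht : Even t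
    · have h2 : ¬ Even (t + 1) := by rw [Nat.even_add_one]; exact not_not.2 ht
      rw [if_pos ht, if_neg h2, pow_succ, ht.neg_one_pow]; push_cast; ring
    · have h2 : Even (t + 1) := by rw [Nat.even_add_one]; exact ht
      rw [if_neg ht, if_pos h2, h2.neg_one_pow]; push_cast; ring

theorem sum_three_eq (r : ℕ) {vb vc d : ℤ} (ve : ℤ) (hd : 0 ≤ d)
    (h : d + d < vb + vc) :
    ∑ n ∈ Finset.range (ve + 1).toNat,
        (if (n : ℤ) < r + 1 + d then singleRange Q ((vb + vc - 1) / 2) n (r + 1)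
          - singleRange Q ((vb + vc - 1) / 2) n r
        else threeRange Q (vb + vc) d n (r + 1) - threeRange Q (vb + vc) d n r) =
      (∑ j ∈ Finset.Icc (0 : ℤ) (constN (r + 1) vb vc ve d), Q ^ j)
        + (constC (r + 1) vb vc ve d : ℂ) * Q ^ constN (r + 1) vb vc ve d
        + (constC' (r + 1) vb vc ve d : ℂ) * Q ^ (constN (r + 1) vb vc ve d - 1) := by
  have hlt : (d : WithTop ℤ) + d < ((vb + vc : ℤ) : WithTop ℤ) := by
    rw [← WithTop.coe_add, WithTop.coe_lt_coe]; exact h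
  have hkap : kappa (r + 1) ve (d : WithTop ℤ) = ve - (d + (r + 1 : ℕ)) := rfl
  have hlt' : ¬ ((vb + vc : ℤ) : WithTop ℤ) < (d : WithTop ℤ) + d := hlt.not_gt
  rw [constN_eq_of_lt _ h, sum_Icc_zpow]
  -- The radius here is r + 1, so N = min(ve, m + 1), and m + 1 is the first n with two disjoint
  -- balls.
  set m : ℕ := (d + r).toNat with hm
  have hm' : d + (r + 1 : ℕ) = ((m + 1 : ℕ) : ℤ) := by omega
  have hlow : ∀ n < m + 1, (if (n : ℤ) < r + 1 + d then
      singleRange Q ((vb + vc - 1) / 2) n (r + 1) - singleRange Q ((vb + vc - 1) / 2) n r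
        else threeRange Q (vb + vc) d n (r + 1) - threeRange Q (vb + vc) d n r) = Q ^ n := by
    intro n hn
    rw [if_pos (by omega), singleRange_sub Q (by omega), ballCount]
    congr 1
    omega
  rw [hm'] at hkap ⊢
  rcases lt_or_ge ve (m + 1 : ℕ) with hve | hve
  · have hC : constC (r + 1) vb vc ve d = 0 := by
      simp only [constC, hkap]
      rw [if_neg (by omega), if_neg (by omega), if_neg (fun hc => hlt' hc.2)]
    have hC' : constC' (r + 1) vb vc ve d = 0 := by
      simp only [constC', hkap]
      rw [if_neg (by omega)]
    rw [hC, hC', min_eq_left hve.le]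
    simp only [Rat.cast_zero, zero_mul, add_zero]
    refine Finset.sum_congr rfl fun n hn => ?_
    rw [Finset.mem_range] at hn
    exact hlow n (by omega)
  · obtain ⟨t, rfl⟩ := Int.le.dest hve
    have hk : kappa (r + 1) (((m + 1 : ℕ) : ℤ) + t) (d : WithTop ℤ) = t := by rw [hkap]; ring
    -- The tail from n = m + 1 to ve has ϰ + 1 terms; their alternating sum depends on the parity of
    -- ϰ, which explains the two formulas for C.
    have hC : (constC (r + 1) vb vc (((m + 1 : ℕ) : ℤ) + t) d : ℂ) + 1 =
        ∑ i ∈ Finset.range (t + 1), (1 + (-1) ^ i * ((vb + vc : ℤ) - 2 * (d : ℂ))) / 2 := by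
      rw [sum_half_alt]
      simp only [constC, hk, hlt, and_true]
      by_cases ht : Even t
      · rw [if_pos ht, if_neg (fun hc => Int.not_odd_iff_even.2 (by exact_mod_cast ht) hc.2),
          if_pos ⟨by omega, by exact_mod_cast ht⟩]
        simp only [WithTop.untopD_coe]
        push_cast
        ring
      · rw [if_neg ht, if_pos ⟨by
          rcases Nat.eq_zero_or_pos t with h0 | h0
          · exact absurd (h0 ▸ Even.zero) ht
          · omega, by rw [Int.odd_coe_nat]; exact Nat.not_even_iff_odd.1 ht⟩]
        push_cast
        ring
    have hC' : constC' (r + 1) vb vc (((m + 1 : ℕ) : ℤ) + t) d =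
        constC (r + 1) vb vc (((m + 1 : ℕ) : ℤ) + t) d + 1 := by
      rw [constC', if_pos ⟨by omega, hlt⟩]
    rw [hC', min_eq_right hve,
      show ((((m + 1 : ℕ) : ℤ) + t + 1)).toNat = m + 1 + (t + 1) by omega,
      show (((m + 1 : ℕ) : ℤ) + 1).toNat = m + 1 + 1 by omega, Finset.sum_range_add,
      Finset.sum_range_succ _ (m + 1)]
    rw [Finset.sum_congr rfl fun n hn => hlow n (Finset.mem_range.1 hn)]
    have hhigh : ∀ i ∈ Finset.range (t + 1),
        (if ((m + 1 + i : ℕ) : ℤ) < r + 1 + d then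
          singleRange Q ((vb + vc - 1) / 2) (m + 1 + i) (r + 1)
            - singleRange Q ((vb + vc - 1) / 2) (m + 1 + i) r
        else threeRange Q (vb + vc) d (m + 1 + i) (r + 1)
          - threeRange Q (vb + vc) d (m + 1 + i) r) =
        (Q ^ (m + 1) + Q ^ m) * ((1 + (-1) ^ i * ((vb + vc : ℤ) - 2 * (d : ℂ))) / 2) := by
      intro i _
      rw [if_neg (by omega), threeRange_sub Q hd _ _ (by omega),
        show r + d.toNat = m by omega,
        show ((m + 1 + i : ℕ) - (r + 1) - d : ℤ) = (i : ℕ) by omega, zpow_natCast]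
    -- The tail is (C + 1)(Q^N + Q^(N-1)). One copy of Q^N completes the geometric sum, leaving C
    -- Q^N and C' Q^(N-1) with C' = C + 1.
    rw [Finset.sum_congr rfl hhigh, ← Finset.mul_sum, ← hC,
      show ((m + 1 : ℕ) : ℤ) - 1 = (m : ℕ) by push_cast; ring, zpow_natCast, zpow_natCast]
    push_cast
    ring

end Totals

/-! ### Counting solutions of the quadratic inequality modulo ϖ^n. -/

section Counting

variable {K : Type*} [NormedField K]

/-- The conditions cut out by the test function, in terms of `k` and `y`, for the binary
quadratic form with coefficients `B`, `D` and `-ε`. -/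
def FormCond (ϖ B D ε : K) (n r : ℕ) (k : ℤ) (y : K) : Prop :=
  ‖y‖ ≤ ‖ϖ‖ ^ (k - r) ∧ k ≤ n + r ∧
    ‖ϖ ^ (2 * k) * B + ϖ ^ k * y * D - ε * y ^ 2‖ ≤ ‖ϖ‖ ^ (k + n - r)

variable [IsUltrametricDist K] [ProperSpace K] {ϖ : K}

open Classical in
theorem IsReps.card_ball_int (h : IsUniformizer ϖ) {n : ℕ} {j : ℤ} (hj : j ≤ n) {Y : Finset K}
    (hY : IsReps ϖ n Y) {c : K} (hc : ‖c‖ ≤ 1) :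
    ({y ∈ Y | ‖y - c‖ ≤ ‖ϖ‖ ^ j}.card : ℂ) = ballCount (residueCard K) n j := by
  have : {y ∈ Y | ‖y - c‖ ≤ ‖ϖ‖ ^ j} = {y ∈ Y | ‖y - c‖ ≤ ‖ϖ‖ ^ j.toNat} := by
    refine Finset.filter_congr fun y hy => ?_
    rcases le_total 0 j with hj0 | hj0
    · rw [← zpow_natCast, Int.toNat_of_nonneg hj0]
    · have h1 : ‖y - c‖ ≤ 1 := norm_sub_le_of_le (hY.1 y hy) hc
      rw [Int.toNat_of_nonpos hj0, pow_zero]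
      refine ⟨fun _ => h1, fun _ => h1.trans ?_⟩
      rw [← zpow_zero ‖ϖ‖, h.zpow_le_zpow_iff]
      exact hj0
  rw [this, hY.card_ball h (by omega) hc, ballCount]
  push_cast
  rfl

omit [ProperSpace K] in
-- The outer terms have valuations 2k + l and 2v(y) of opposite parity. The valuation of the middle
-- term exceeds their average, so the smaller of the two alone determines the norm of the form.
theorem norm_form_le_iff (h : IsUniformizer ϖ) {B D ε : K} {l : ℤ} (hl : Odd l)
    (hB : ‖B‖ = ‖ϖ‖ ^ l) (hD : ‖D‖ ≤ ‖ϖ‖ ^ ((l + 1) / 2)) (hε : ‖ε‖ = 1) (k M : ℤ) (y : K) :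
    ‖ϖ ^ (2 * k) * B + ϖ ^ k * y * D - ε * y ^ 2‖ ≤ ‖ϖ‖ ^ M ↔
      M ≤ 2 * k + l ∧ ‖y‖ ≤ ‖ϖ‖ ^ ((M + 1) / 2) := by
  have hne := h.norm_pos.ne'
  obtain ⟨t, rfl⟩ := hl
  have hB' : ‖ϖ ^ (2 * k) * B‖ = ‖ϖ‖ ^ (2 * k + (2 * t + 1)) := by
    rw [norm_mul, norm_zpow, hB, ← zpow_add₀ hne]
  by_cases hy : y = 0
  · subst hy
    simp only [mul_zero, zero_mul, add_zero, ne_eq, OfNat.ofNat_ne_zero, not_false_eq_true,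
      zero_pow, sub_zero, norm_zero]
    rw [hB', h.zpow_le_zpow_iff]
    exact ⟨fun h1 => ⟨h1, (zpow_pos h.norm_pos _).le⟩, fun h1 => h1.1⟩
  · have hyv := norm_eq_zpow_val h hy
    set v := val ϖ y
    have hε' : ‖ε * y ^ 2‖ = ‖ϖ‖ ^ (2 * v) := by
      rw [norm_mul, norm_pow, hyv, hε, one_mul, ← zpow_natCast, ← zpow_mul, mul_comm]
      rfl
    have hD' : ‖ϖ ^ k * y * D‖ ≤ ‖ϖ‖ ^ (k + v + (t + 1)) := by
      rw [norm_mul, norm_mul, norm_zpow, hyv, zpow_add₀ hne, zpow_add₀ hne k v]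
      refine mul_le_mul_of_nonneg_left ?_ (by positivity)
      rwa [show (2 * t + 1 + 1) / 2 = t + 1 by omega] at hD
    rw [hyv, h.zpow_le_zpow_iff]
    by_cases hc : 2 * k + (2 * t + 1) < 2 * v
    · rw [add_sub_assoc, norm_add_eq_left, hB', h.zpow_le_zpow_iff]
      · omega
      · rw [hB']
        refine (norm_sub_le_of_le (t := ‖ϖ‖ ^ (2 * k + (2 * t + 1) + 1)) (hD'.trans ?_)
          (hε'.le.trans ?_)).trans_lt ?_
        · rw [h.zpow_le_zpow_iff]; omega
        · rw [h.zpow_le_zpow_iff]; omega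
        · rw [h.zpow_lt_zpow_iff]; omega
    · rw [norm_sub_eq_right, hε', h.zpow_le_zpow_iff]
      · omega
      · rw [hε']
        refine (norm_add_le_of_le (t := ‖ϖ‖ ^ (2 * v + 1)) (hB'.le.trans ?_)
          (hD'.trans ?_)).trans_lt ?_
        · rw [h.zpow_le_zpow_iff]; omega
        · rw [h.zpow_le_zpow_iff]; omega
        · rw [h.zpow_lt_zpow_iff]; omega

open Classical in
theorem card_formCond_single (h : IsUniformizer ϖ) {B D ε : K} {l : ℤ} (hl : Odd l)
    (hB : ‖B‖ = ‖ϖ‖ ^ l) (hD : ‖D‖ ≤ ‖ϖ‖ ^ ((l + 1) / 2)) (hε : ‖ε‖ = 1) {n : ℕ} {Y : Finset K}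
    (hY : IsReps ϖ n Y) (r : ℕ) (k : ℤ) :
    ({y ∈ Y | FormCond ϖ B D ε n r k y}.card : ℂ) =
      if n - r - l ≤ k ∧ k ≤ n + r then ballCount (residueCard K) n ((k + n - r + 1) / 2)
        else 0 := by
  split_ifs with hk
  · rw [← hY.card_ball_int h (by omega) (c := 0) (by simp)]
    congr 2
    refine Finset.filter_congr fun y _ => ?_
    rw [FormCond, norm_form_le_iff h hl hB hD hε, sub_zero]
    -- The bound on the diagonal entries is automatic: k ≤ n + r makes (k + n - r + 1)/2 at least k
    -- - r.
    refine ⟨fun hy => hy.2.2.2, fun hy => ⟨hy.trans ?_, hk.2, by omega, hy⟩⟩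
    rw [h.zpow_le_zpow_iff]
    omega
  · rw [Nat.cast_eq_zero, Finset.card_eq_zero, Finset.filter_eq_empty_iff]
    intro y _ hy
    rw [FormCond, norm_form_le_iff h hl hB hD hε] at hy
    exact hk ⟨by omega, by omega⟩

open Classical in
-- The centre need not be integral. If it is not, the ball either contains 0, hence all integers
-- since then R < 0, or contains no integer at all.
theorem card_ball_far (h : IsUniformizer ϖ) {n : ℕ} {Y : Finset K} (hY : IsReps ϖ n Y) {c : K}
    {v R : ℤ} (hc : ‖c‖ = ‖ϖ‖ ^ v) (hR : R ≤ n) :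
    ({y ∈ Y | ‖y - c‖ ≤ ‖ϖ‖ ^ R}.card : ℂ) =
      if min 0 R ≤ v then ballCount (residueCard K) n R else 0 := by
  have hpow : ∀ j : ℤ, ‖ϖ‖ ^ j ≤ 1 ↔ 0 ≤ j := fun j => by
    rw [← zpow_zero ‖ϖ‖, h.zpow_le_zpow_iff]
  split_ifs with hv
  · by_cases hv0 : 0 ≤ v
    · exact hY.card_ball_int h hR (by rw [hc, hpow]; exact hv0)
    · rw [← hY.card_ball_int h hR (c := 0) (by simp)]
      congr 2
      refine Finset.filter_congr fun y hy => ?_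
      have h1 : ‖ϖ‖ ^ v ≤ ‖ϖ‖ ^ R := by rw [h.zpow_le_zpow_iff]; omega
      have h2 : ‖y‖ ≤ ‖ϖ‖ ^ R := (hY.1 y hy).trans (by
        rw [← zpow_zero ‖ϖ‖, h.zpow_le_zpow_iff]; omega)
      rw [sub_zero]
      exact ⟨fun _ => h2, fun _ => norm_sub_le_of_le h2 (hc.le.trans h1)⟩
  · rw [Nat.cast_eq_zero, Finset.card_eq_zero, Finset.filter_eq_empty_iff]
    intro y hy hyc
    have h1 : ‖y‖ < ‖c‖ := (hY.1 y hy).trans_lt (by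
      rw [hc, ← zpow_zero ‖ϖ‖, h.zpow_lt_zpow_iff]; omega)
    rw [norm_sub_eq_right h1, hc, h.zpow_le_zpow_iff] at hyc
    omega

omit [ProperSpace K] in
/-- The product of the distances of `y` to `α` and `β` in the two regimes. -/
theorem norm_mul_le_iff_near (h : IsUniformizer ϖ) {α β : K} {a M : ℤ} (hα : ‖α‖ = ‖ϖ‖ ^ a)
    (hβ : ‖β‖ < ‖α‖) (hM : M ≤ 2 * a) (y : K) :
    ‖(y - α) * (y - β)‖ ≤ ‖ϖ‖ ^ M ↔ ‖y‖ ≤ ‖ϖ‖ ^ ((M + 1) / 2) := by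
  have hα' : ‖α‖ ≤ ‖ϖ‖ ^ ((M + 1) / 2) := by rw [hα, h.zpow_le_zpow_iff]; omega
  constructor
  · intro hle
    by_contra hy
    rw [not_le] at hy
    have h1 : ‖α‖ < ‖y‖ := hα'.trans_lt hy
    rw [norm_mul, norm_sub_eq_left h1, norm_sub_eq_left (hβ.trans h1)] at hle
    have hy0 : y ≠ 0 := by rintro rfl; rw [norm_zero] at h1; exact (norm_nonneg _).not_gt h1
    rw [norm_eq_zpow_val h hy0, ← zpow_add₀ h.norm_pos.ne', h.zpow_le_zpow_iff] at hle
    rw [norm_eq_zpow_val h hy0, h.zpow_lt_zpow_iff] at hy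
    omega
  · intro hy
    rw [norm_mul]
    calc ‖y - α‖ * ‖y - β‖ ≤ ‖ϖ‖ ^ ((M + 1) / 2) * ‖ϖ‖ ^ ((M + 1) / 2) :=
          mul_le_mul (norm_sub_le_of_le hy hα') (norm_sub_le_of_le hy (hβ.le.trans hα'))
            (norm_nonneg _) (zpow_nonneg (norm_nonneg _) _)
      _ ≤ ‖ϖ‖ ^ M := by
        rw [← zpow_add₀ h.norm_pos.ne', h.zpow_le_zpow_iff]; omega

omit [ProperSpace K] in
-- The roots are at distance ‖α‖, so y is at distance at least ‖α‖ from one of them. A product this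
-- small forces y close to the other.
theorem norm_mul_le_iff_far (h : IsUniformizer ϖ) {α β : K} {a R : ℤ} (hα : ‖α‖ = ‖ϖ‖ ^ a)
    (hβ : ‖β‖ < ‖α‖) (hR : a < R) (y : K) :
    ‖(y - α) * (y - β)‖ ≤ ‖ϖ‖ ^ (R + a) ↔ ‖y - α‖ ≤ ‖ϖ‖ ^ R ∨ ‖y - β‖ ≤ ‖ϖ‖ ^ R := by
  have hpos : 0 < ‖ϖ‖ ^ a := zpow_pos h.norm_pos _
  have hRa : ‖ϖ‖ ^ R < ‖ϖ‖ ^ a := by rw [h.zpow_lt_zpow_iff]; exact hR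
  have hαβ : ‖α - β‖ = ‖ϖ‖ ^ a := by rw [norm_sub_eq_left hβ, hα]
  have hβα : ‖β - α‖ = ‖ϖ‖ ^ a := by rw [norm_sub_rev, hαβ]
  rw [norm_mul, zpow_add₀ h.norm_pos.ne']
  constructor
  · intro hle
    by_contra hc
    rw [not_or, not_le, not_le] at hc
    have h1 : ‖ϖ‖ ^ a ≤ max ‖y - β‖ ‖y - α‖ := by
      rw [← hαβ, show α - β = (y - β) - (y - α) by ring, sub_eq_add_neg]
      refine (IsUltrametricDist.norm_add_le_max _ _).trans ?_
      rw [norm_neg]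
    rcases le_max_iff.1 h1 with h2 | h2
    · exact absurd hle (not_le.2 (mul_lt_mul hc.1 h2 hpos (norm_nonneg _)))
    · rw [mul_comm] at hle
      exact absurd hle (not_le.2 (mul_lt_mul hc.2 h2 hpos (norm_nonneg _)))
  · rintro (h1 | h1)
    · have : ‖y - β‖ = ‖ϖ‖ ^ a := by
        rw [show y - β = (α - β) + (y - α) by ring, norm_add_eq_left, hαβ]
        rw [hαβ]; exact h1.trans_lt hRa
      rw [this]; exact mul_le_mul_of_nonneg_right h1 hpos.le
    · have : ‖y - α‖ = ‖ϖ‖ ^ a := by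
        rw [show y - α = (β - α) + (y - β) by ring, norm_add_eq_left, hβα]
        rw [hβα]; exact h1.trans_lt hRa
      rw [this, mul_comm]; exact mul_le_mul_of_nonneg_right h1 hpos.le

open Classical in
-- The roots in y are ϖ^k ρ₁ and ϖ^k ρ₂, and the larger has valuation k + δ. The threshold k = n - r
-- - 2δ is where the required precision k + n - r equals 2(k + δ): above it the roots are
-- indistinguishable from 0, below it they are separated by disjoint balls.
theorem card_formCond_split (h : IsUniformizer ϖ) {B D ε ρ₁ ρ₂ : K} {l δ : ℤ} (hε : ‖ε‖ = 1)
    (hδ : 0 ≤ δ) (hlδ : 2 * δ < l) (hρ₁ : ‖ρ₁‖ = ‖ϖ‖ ^ δ) (hρ₂ : ‖ρ₂‖ = ‖ϖ‖ ^ (l - δ))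
    (hD : D = ε * (ρ₁ + ρ₂)) (hB : B = -ε * (ρ₁ * ρ₂)) {n : ℕ} {Y : Finset K}
    (hY : IsReps ϖ n Y) (r : ℕ) (k : ℤ) :
    ({y ∈ Y | FormCond ϖ B D ε n r k y}.card : ℂ) =
      if n - r - 2 * δ ≤ k then
        (if k ≤ n + r then ballCount (residueCard K) n ((k + n - r + 1) / 2) else 0)
      else (if -δ ≤ k then ballCount (residueCard K) n (n - r - δ) else 0) +
        (if δ - l + min 0 (n - r - δ) ≤ k then ballCount (residueCard K) n (n - r - δ) else 0) := by
  have hne := h.norm_pos.ne'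
  set α := ϖ ^ k * ρ₁ with hαdef
  set β := ϖ ^ k * ρ₂ with hβdef
  have hα : ‖α‖ = ‖ϖ‖ ^ (k + δ) := by rw [norm_mul, norm_zpow, hρ₁, zpow_add₀ hne]
  have hβ : ‖β‖ = ‖ϖ‖ ^ (k + (l - δ)) := by
    rw [norm_mul, norm_zpow, hρ₂, zpow_add₀ hne]
  have hβα : ‖β‖ < ‖α‖ := by rw [hα, hβ, h.zpow_lt_zpow_iff]; omega
  have hform : ∀ y : K, ‖ϖ ^ (2 * k) * B + ϖ ^ k * y * D - ε * y ^ 2‖ = ‖(y - α) * (y - β)‖ := by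
    intro y
    have : ϖ ^ (2 * k) * B + ϖ ^ k * y * D - ε * y ^ 2 = -ε * ((y - α) * (y - β)) := by
      rw [hD, hB, hαdef, hβdef, two_mul, zpow_add₀ h.1]; ring
    rw [this, norm_mul, norm_neg, hε, one_mul]
  split_ifs with hk1 hk2
  · rw [← hY.card_ball_int h (by omega) (c := 0) (by simp)]
    congr 2
    refine Finset.filter_congr fun y _ => ?_
    rw [FormCond, hform, norm_mul_le_iff_near h hα hβα (by omega), sub_zero]
    refine ⟨fun hy => hy.2.2, fun hy => ⟨hy.trans ?_, hk2, hy⟩⟩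
    rw [h.zpow_le_zpow_iff]
    omega
  · rw [Nat.cast_eq_zero, Finset.card_eq_zero, Finset.filter_eq_empty_iff]
    intro y _ hy
    exact hk2 hy.2.1
  all_goals
    have hunion : {y ∈ Y | FormCond ϖ B D ε n r k y} =
        {y ∈ Y | ‖y - α‖ ≤ ‖ϖ‖ ^ (n - r - δ : ℤ)} ∪
          {y ∈ Y | ‖y - β‖ ≤ ‖ϖ‖ ^ (n - r - δ : ℤ)} := by
      rw [← Finset.filter_or]
      refine Finset.filter_congr fun y _ => ?_
      rw [FormCond, hform, show k + n - r = (n - r - δ) + (k + δ) by ring,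
        norm_mul_le_iff_far h hα hβα (by omega)]
      refine ⟨fun hy => hy.2.2, fun hy => ⟨?_, by omega, hy⟩⟩
      have hRk : ‖ϖ‖ ^ (n - r - δ : ℤ) ≤ ‖ϖ‖ ^ (k - r) := by rw [h.zpow_le_zpow_iff]; omega
      have hαk : ‖α‖ ≤ ‖ϖ‖ ^ (k - r) := by rw [hα, h.zpow_le_zpow_iff]; omega
      rcases hy with hy | hy
      · have := norm_add_le_of_le (hy.trans hRk) hαk
        rwa [sub_add_cancel] at this
      · have := norm_add_le_of_le (hy.trans hRk) (hβα.le.trans hαk)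
        rwa [sub_add_cancel] at this
    have hdisj : Disjoint {y ∈ Y | ‖y - α‖ ≤ ‖ϖ‖ ^ (n - r - δ : ℤ)}
        {y ∈ Y | ‖y - β‖ ≤ ‖ϖ‖ ^ (n - r - δ : ℤ)} := by
      rw [Finset.disjoint_filter]
      intro y _ h1 h2
      have := norm_sub_le_of_le h2 h1
      rw [show y - β - (y - α) = α - β by ring, norm_sub_eq_left hβα, hα,
        h.zpow_le_zpow_iff] at this
      omega
    rw [hunion, Finset.card_union_of_disjoint hdisj, Nat.cast_add,
      card_ball_far h hY hα (by omega), card_ball_far h hY hβ (by omega)]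
    split_ifs <;> first | rfl | (exfalso; omega)

/-- A binary quadratic form whose linear coefficient dominates has roots in the field. -/
theorem exists_roots (h : IsUniformizer ϖ) (h2 : ‖(2 : K)‖ = 1) {B D ε : K} {l δ : ℤ}
    (hε : ‖ε‖ = 1) (hlδ : 2 * δ < l) (hB : ‖B‖ = ‖ϖ‖ ^ l) (hD : ‖D‖ = ‖ϖ‖ ^ δ) :
    ∃ ρ₁ ρ₂ : K, ‖ρ₁‖ = ‖ϖ‖ ^ δ ∧ ‖ρ₂‖ = ‖ϖ‖ ^ (l - δ) ∧ D = ε * (ρ₁ + ρ₂) ∧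
      B = -ε * (ρ₁ * ρ₂) := by
  have hne := h.norm_pos.ne'
  have h20 : (2 : K) ≠ 0 := norm_ne_zero_iff.1 (by rw [h2]; exact one_ne_zero)
  have h40 : (4 : K) ≠ 0 := by rw [show (4 : K) = 2 * 2 by norm_num]; exact mul_ne_zero h20 h20
  have hε0 : ε ≠ 0 := norm_ne_zero_iff.1 (by rw [hε]; exact one_ne_zero)
  have hD0 : D ≠ 0 := norm_ne_zero_iff.1 (by rw [hD]; exact (zpow_pos h.norm_pos _).ne')
  -- The discriminant is D²(1 + 4εB/D²), and 2δ < l makes the second factor a principal unit, hence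
  -- a square.
  obtain ⟨u, hu⟩ := exists_sq_eq_of_norm_sub_one_lt h2 (x := 1 + 4 * ε * B / D ^ 2) (by
    rw [add_sub_cancel_left, show (4 : K) = 2 * 2 by norm_num]
    simp only [norm_div, norm_mul, norm_pow, h2, hε, hB, hD, one_mul]
    rw [← zpow_natCast, ← zpow_mul, ← zpow_sub₀ hne, ← zpow_zero ‖ϖ‖, h.zpow_lt_zpow_iff]
    push_cast
    omega)
  have hsum : D = ε * ((D * (1 + u) / (2 * ε)) + (D * (1 - u) / (2 * ε))) := by
    field_simp; ring
  have hprod : B = -ε * ((D * (1 + u) / (2 * ε)) * (D * (1 - u) / (2 * ε))) := by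
    have : -ε * ((D * (1 + u) / (2 * ε)) * (D * (1 - u) / (2 * ε))) =
        -(D ^ 2 * (1 - u ^ 2) / (4 * ε)) := by field_simp; ring
    rw [this, hu]; field_simp; ring
  generalize D * (1 + u) / (2 * ε) = a at hsum hprod
  generalize D * (1 - u) / (2 * ε) = b at hsum hprod
  -- The roots cannot have equal norms: their sum has valuation δ, so both would have valuation at
  -- most δ, against the product having valuation l > 2δ.
  have main : ∀ a b : K, D = ε * (a + b) → B = -ε * (a * b) → ‖b‖ ≤ ‖a‖ →
      ‖a‖ = ‖ϖ‖ ^ δ ∧ ‖b‖ = ‖ϖ‖ ^ (l - δ) := by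
    intro a b hs hp hab
    have hs' : ‖a + b‖ = ‖ϖ‖ ^ δ := by rw [← hD, hs, norm_mul, hε, one_mul]
    have hp' : ‖a‖ * ‖b‖ = ‖ϖ‖ ^ l := by
      rw [← hB, hp, norm_mul, norm_neg, hε, one_mul, norm_mul]
    have hlt : ‖b‖ < ‖a‖ := by
      refine lt_of_le_of_ne hab fun he => ?_
      have h1 : ‖ϖ‖ ^ δ ≤ ‖a‖ := by rw [← hs']; exact norm_add_le_of_le le_rfl hab
      have h2 : ‖ϖ‖ ^ δ * ‖ϖ‖ ^ δ ≤ ‖ϖ‖ ^ l := by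
        rw [← hp', he]
        exact mul_le_mul h1 h1 (zpow_pos h.norm_pos _).le (norm_nonneg _)
      rw [← zpow_add₀ hne, h.zpow_le_zpow_iff] at h2
      omega
    have ha : ‖a‖ = ‖ϖ‖ ^ δ := by rw [← hs', norm_add_eq_left hlt]
    refine ⟨ha, ?_⟩
    rw [ha] at hp'
    rw [zpow_sub₀ hne, ← hp', mul_div_cancel_left₀ _ (zpow_pos h.norm_pos _).ne']
  rcases le_total ‖b‖ ‖a‖ with hab | hab
  · exact ⟨a, b, (main a b hsum hprod hab).1, (main a b hsum hprod hab).2, hsum, hprod⟩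
  · have h1 : D = ε * (b + a) := by rw [hsum, add_comm]
    have h2 : B = -ε * (b * a) := by rw [hprod, mul_comm b a]
    exact ⟨b, a, (main b a h1 h2 hab).1, (main b a h1 h2 hab).2, h1, h2⟩

end Counting

/-! ### The quadratic extension: conjugation and norms. -/

section Quadratic

variable {F E : Type*} [NormedField F] [NormedField E] [NormedAlgebra F E]

theorem exists_eq_add_mul (hdeg : Module.finrank F E = 2) {x : E}
    (hx : x ∉ Set.range (algebraMap F E)) (z : E) :
    ∃ s t : F, z = algebraMap F E s + algebraMap F E t * x := by
  have hli : LinearIndependent F ![(1 : E), x] := by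
    rw [LinearIndependent.pair_iff]
    intro s t hst
    rw [Algebra.smul_def, Algebra.smul_def, mul_one] at hst
    have ht : t = 0 := by
      by_contra ht
      refine hx ⟨-s / t, ?_⟩
      have ht' : algebraMap F E t ≠ 0 := by simpa using ht
      rw [map_div₀, map_neg, div_eq_iff ht']
      linear_combination -hst
    rw [ht, map_zero, zero_mul, add_zero] at hst
    exact ⟨by simpa using hst, ht⟩
  have hspan := hli.span_eq_top_of_card_eq_finrank (by simp [hdeg])
  have hz : z ∈ Submodule.span F (Set.range ![(1 : E), x]) := by rw [hspan]; trivial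
  rw [Matrix.range_cons, Matrix.range_cons, Matrix.range_empty, Set.union_empty,
    Set.singleton_union, Submodule.mem_span_pair] at hz
  obtain ⟨s, t, rfl⟩ := hz
  exact ⟨s, t, by rw [Algebra.smul_def, Algebra.smul_def, mul_one]⟩

theorem mem_range_of_fixed (hdeg : Module.finrank F E = 2) {σ : E ≃ₐ[F] E}
    (hσ : σ ≠ AlgEquiv.refl) {x : E} (hx : σ x = x) : ∃ s : F, algebraMap F E s = x := by
  by_contra hc
  refine hσ (AlgEquiv.ext fun z => ?_)
  obtain ⟨s, t, rfl⟩ := exists_eq_add_mul hdeg (x := x) hc z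
  simp [hx]

theorem exists_not_fixed {σ : E ≃ₐ[F] E} (hσ : σ ≠ AlgEquiv.refl) : ∃ x : E, σ x ≠ x := by
  by_contra! hc
  exact hσ (AlgEquiv.ext hc)

/-- x and σ x are the two roots of one quadratic polynomial over F, so σ x = t - x with t in F, and
applying σ again returns x. -/
theorem conj_conj (hdeg : Module.finrank F E = 2) {σ : E ≃ₐ[F] E}
    (hσ : σ ≠ AlgEquiv.refl) (z : E) : σ (σ z) = z := by
  obtain ⟨x, hx⟩ := exists_not_fixed hσ
  have hxr : x ∉ Set.range (algebraMap F E) := by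
    rintro ⟨s, rfl⟩; exact hx (by simp)
  obtain ⟨n, t, ht⟩ := exists_eq_add_mul hdeg hxr (x ^ 2)
  have ht' := congrArg σ ht
  simp only [map_pow, map_add, map_mul, AlgEquiv.commutes] at ht'
  have hsum : σ x = algebraMap F E t - x := by
    have : (σ x - x) * (σ x + x - algebraMap F E t) = 0 := by linear_combination ht' - ht
    rcases mul_eq_zero.1 this with h | h
    · exact absurd (sub_eq_zero.1 h) hx
    · linear_combination h
  have hσσ : σ (σ x) = x := by
    have := congrArg σ hsum
    rw [map_sub, AlgEquiv.commutes] at this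
    rw [this, hsum]; ring
  obtain ⟨s, u, rfl⟩ := exists_eq_add_mul hdeg hxr z
  simp [hσσ]

variable [IsUltrametricDist F]

theorem isUltrametricDist_of_normedAlgebra (F E : Type*) [NormedField F] [NormedField E]
    [NormedAlgebra F E] [IsUltrametricDist F] : IsUltrametricDist E := by
  refine IsUltrametricDist.isUltrametricDist_of_forall_norm_natCast_le_one fun n => ?_
  rw [← map_natCast (algebraMap F E), norm_algebraMap']
  exact IsUltrametricDist.norm_natCast_le_one F n

/-- The norm of E is the spectral norm over the complete field F, which depends only on the minimal
polynomial. -/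
theorem norm_conj [CompleteSpace F] {ϖ : F} (hϖ : IsUniformizer ϖ)
    (hdeg : Module.finrank F E = 2) (σ : E ≃ₐ[F] E) (x : E) : ‖σ x‖ = ‖x‖ := by
  let _ : NontriviallyNormedField F :=
    { ‹NormedField F› with
      non_trivial := ⟨ϖ⁻¹, by rw [norm_inv]; exact (one_lt_inv₀ hϖ.norm_pos).2 hϖ.2.1⟩ }
  have : FiniteDimensional F E := FiniteDimensional.of_finrank_pos (by rw [hdeg]; norm_num)
  rw [NormedAlgebra.norm_eq_spectralNorm F x, NormedAlgebra.norm_eq_spectralNorm F (σ x)]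
  exact (spectralNorm_eq_of_equiv σ x).symm

variable [ProperSpace F]

/-- Over the ring of integers of a nonarchimedean local field with `|2| = 1`, the equation
`s² - α t² = u` with units `α` and `u` is solvable. -/
theorem exists_sq_sub_mul_sq {ϖ : F} (hϖ : IsUniformizer ϖ) (h2 : ‖(2 : F)‖ = 1) {α u : F}
    (hα : ‖α‖ = 1) (hu : ‖u‖ = 1) : ∃ s t : F, s ^ 2 - α * t ^ 2 = u := by
  let O := (NormedField.valuation (K := F)).valuationSubring
  let k := IsLocalRing.ResidueField O
  have hfin : Finite k := Nat.finite_of_card_ne_zero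
    (show residueCard F ≠ 0 by have := one_lt_residueCard hϖ; omega)
  let _ : Fintype k := Fintype.ofFinite k
  have hα0 : α ≠ 0 := norm_ne_zero_iff.1 (by rw [hα]; exact one_ne_zero)
  have hres : ∀ x : O, IsLocalRing.residue O x = 0 ↔ ‖(x : F)‖ ≤ ‖ϖ‖ := by
    intro x
    have := residue_eq_iff hϖ x 0
    rwa [map_zero, ZeroMemClass.coe_zero, sub_zero] at this
  have hchar : ringChar k ≠ 2 := by
    intro hc
    have h20 : ((2 : ℕ) : k) = 0 := by rw [ringChar.spec, hc]
    have : IsLocalRing.residue O (2 : O) = 0 := by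
      rw [← h20, Nat.cast_ofNat]; exact map_ofNat _ 2
    rw [hres] at this
    have h2' : ‖(2 : F)‖ ≤ ‖ϖ‖ := this
    rw [h2] at h2'
    exact absurd h2' (not_le.2 hϖ.2.1)
  let α' : O := ⟨α, hα.le⟩
  let u' : O := ⟨u, hu.le⟩
  have hαres : IsLocalRing.residue O α' ≠ 0 := by
    rw [ne_eq, hres, not_le]
    change ‖ϖ‖ < ‖α‖
    rw [hα]; exact hϖ.2.1
  -- Two quadratic polynomials over a finite field of odd order take opposite values somewhere; this
  -- solves the equation in the residue field.
  obtain ⟨s, t, hst⟩ := FiniteField.exists_root_sum_quadratic (R := k)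
    (f := Polynomial.X ^ 2)
    (g := -Polynomial.C (IsLocalRing.residue O α') * Polynomial.X ^ 2
      - Polynomial.C (IsLocalRing.residue O u'))
    (by simp) (by
      rw [Polynomial.degree_sub_C, ← Polynomial.C_neg,
        Polynomial.degree_C_mul_X_pow _ (neg_ne_zero.2 hαres)]
      · rfl
      · rw [← Polynomial.C_neg, Polynomial.degree_C_mul_X_pow _ (neg_ne_zero.2 hαres)]
        norm_num) (FiniteField.odd_card_of_char_ne_two hchar)
  obtain ⟨s, rfl⟩ := IsLocalRing.residue_surjective s
  obtain ⟨t, rfl⟩ := IsLocalRing.residue_surjective t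
  have hlt : ‖(s : F) ^ 2 - α * (t : F) ^ 2 - u‖ < 1 := by
    have : IsLocalRing.residue O (s ^ 2 - α' * t ^ 2 - u') = 0 := by
      simp only [Polynomial.eval_pow, Polynomial.eval_X, Polynomial.eval_sub, Polynomial.eval_mul,
        Polynomial.eval_neg, Polynomial.eval_C] at hst
      rw [map_sub, map_sub, map_mul, map_pow, map_pow, ← hst]
      ring
    rw [hres] at this
    exact this.trans_lt hϖ.2.1
  generalize (s : F) = s at hlt
  have ht1 : ‖(t : F)‖ ≤ 1 := t.2
  generalize (t : F) = t at hlt ht1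
  -- The residue solution is lifted by correcting whichever of s and t is a unit; both cannot be
  -- non-units because u is a unit.
  by_cases hs : ‖s‖ = 1
  · have hs0 : s ≠ 0 := norm_ne_zero_iff.1 (by rw [hs]; exact one_ne_zero)
    obtain ⟨z, hz⟩ := exists_sq_eq_of_norm_sub_one_lt h2 (x := (u + α * t ^ 2) / s ^ 2) (by
      rw [show (u + α * t ^ 2) / s ^ 2 - 1 = -(s ^ 2 - α * t ^ 2 - u) / s ^ 2 by
        field_simp; ring, norm_div, norm_neg, norm_pow, hs, one_pow, div_one]
      exact hlt)
    refine ⟨s * z, t, ?_⟩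
    rw [mul_pow, hz]; field_simp; ring
  · by_cases ht : ‖t‖ = 1
    · have ht0 : t ≠ 0 := norm_ne_zero_iff.1 (by rw [ht]; exact one_ne_zero)
      obtain ⟨z, hz⟩ := exists_sq_eq_of_norm_sub_one_lt h2 (x := (s ^ 2 - u) / (α * t ^ 2)) (by
        rw [show (s ^ 2 - u) / (α * t ^ 2) - 1 = (s ^ 2 - α * t ^ 2 - u) / (α * t ^ 2) by
          field_simp; ring, norm_div, norm_mul, norm_pow, ht, hα, one_pow, mul_one, div_one]
        exact hlt)
      refine ⟨s, t * z, ?_⟩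
      rw [mul_pow, hz]; field_simp; ring
    · exfalso
      have ht' : ‖t‖ < 1 := lt_of_le_of_ne ht1 ht
      have h1 : ‖α * t ^ 2‖ < 1 := by
        rw [norm_mul, hα, one_mul, norm_pow]
        exact pow_lt_one₀ (norm_nonneg _) ht' two_ne_zero
      have h3 : ‖α * t ^ 2 + u‖ = 1 := by rw [add_comm, norm_add_eq_left (by rwa [hu]), hu]
      have h4 : ‖s ^ 2‖ = 1 := by
        rw [show s ^ 2 = (α * t ^ 2 + u) + (s ^ 2 - α * t ^ 2 - u) by ring, norm_add_eq_left
          (by rwa [h3]), h3]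
      rw [norm_pow] at h4
      exact hs ((pow_eq_one_iff_of_nonneg (norm_nonneg _) two_ne_zero).1 h4)

/-- For a unit x with σ x = -x and α = x², the norm of s + t x is s² - α t², which represents every
unit of F. Even powers of ϖ are norms of powers of ϖ. -/
theorem exists_mul_conj_eq (hdeg : Module.finrank F E = 2) (hunr : IsUnramified F E)
    {σ : E ≃ₐ[F] E} (hσ : σ ≠ AlgEquiv.refl) {ϖ : F} (hϖ : IsUniformizer ϖ)
    (h2 : ‖(2 : F)‖ = 1) {f : F} (hf : f ≠ 0) (heven : Even (val ϖ f)) :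
    ∃ t : E, t * σ t = algebraMap F E f := by
  obtain ⟨x₀, hx₀⟩ := exists_not_fixed hσ
  have hϖE := hunr ϖ hϖ
  set x₁ := x₀ - σ x₀ with hx₁
  have hx₁0 : x₁ ≠ 0 := sub_ne_zero.2 (Ne.symm hx₀)
  have hσx₁ : σ x₁ = -x₁ := by rw [hx₁, map_sub, conj_conj hdeg hσ]; ring
  -- Unramifiedness is what allows x₁ to be rescaled to a unit by a power of ϖ from F, without
  -- disturbing σ x₁ = -x₁.
  set x := x₁ * algebraMap F E (ϖ ^ (-val (algebraMap F E ϖ) x₁)) with hx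
  have hσx : σ x = -x := by rw [hx, map_mul, AlgEquiv.commutes, hσx₁]; ring
  have hxn : ‖x‖ = 1 := by
    rw [hx, norm_mul, map_zpow₀, norm_zpow, norm_eq_zpow_val hϖE hx₁0, ← zpow_add₀ hϖE.norm_pos.ne']
    simp
  obtain ⟨α, hα⟩ := mem_range_of_fixed hdeg hσ (x := x ^ 2) (by rw [map_pow, hσx]; ring)
  have hαn : ‖α‖ = 1 := by rw [← norm_algebraMap' E, hα, norm_pow, hxn, one_pow]
  obtain ⟨m, hm⟩ := heven
  obtain ⟨s, t, hst⟩ := exists_sq_sub_mul_sq hϖ h2 hαn (u := f * ϖ ^ (-(m + m))) (by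
    rw [norm_mul, norm_zpow, norm_eq_zpow_val hϖ hf, hm, ← zpow_add₀ hϖ.norm_pos.ne']
    simp)
  refine ⟨algebraMap F E (ϖ ^ m) * (algebraMap F E s + algebraMap F E t * x), ?_⟩
  have hf' : f = ϖ ^ m * ϖ ^ m * (s ^ 2 - α * t ^ 2) := by
    rw [hst, ← zpow_add₀ hϖ.1, mul_left_comm, ← zpow_add₀ hϖ.1, add_neg_cancel, zpow_zero, mul_one]
  rw [hf']
  simp only [map_mul, map_add, map_sub, map_pow, AlgEquiv.commutes, hσx, hα]
  ring

end Quadratic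

/-! ### Hermitian planes and the non-split condition. -/

section Hermitian

variable {F E : Type*} [NormedField F] [NormedField E] [NormedAlgebra F E]
  {σ : E ≃ₐ[F] E} {J : Matrix (Fin 2) (Fin 2) E}

/-- The Hermitian form with Gram matrix `J`, conjugate linear in the first variable. -/
def herm (σ : E ≃ₐ[F] E) (J : Matrix (Fin 2) (Fin 2) E) (x y : Fin 2 → E) : E :=
  hermStar σ J x ⬝ᵥ y

theorem herm_eq (x y : Fin 2 → E) :
    herm σ J x y = σ (x 0) * (J 0 0 * y 0 + J 0 1 * y 1) + σ (x 1) * (J 1 0 * y 0 + J 1 1 * y 1) := by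
  simp only [herm, hermStar, dotProduct, Matrix.vecMul, Fin.sum_univ_two]
  ring

theorem herm_symm (hσ2 : ∀ z, σ (σ z) = z) (hJ : adj σ J = J) (x y : Fin 2 → E) :
    herm σ J y x = σ (herm σ J x y) := by
  have hent : ∀ i j, σ (J i j) = J j i := fun i j => congrFun (congrFun hJ j) i
  simp only [herm_eq, map_add, map_mul, hσ2, hent]
  ring

theorem herm_add_left (x y z : Fin 2 → E) :
    herm σ J (x + y) z = herm σ J x z + herm σ J y z := by
  simp only [herm_eq, Pi.add_apply, map_add]; ring

theorem herm_add_right (x y z : Fin 2 → E) :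
    herm σ J x (y + z) = herm σ J x y + herm σ J x z := by
  simp only [herm_eq, Pi.add_apply]; ring

theorem herm_smul_left (t : E) (x y : Fin 2 → E) :
    herm σ J (t • x) y = σ t * herm σ J x y := by
  simp only [herm_eq, Pi.smul_apply, smul_eq_mul, map_mul]; ring

theorem herm_smul_right (t : E) (x y : Fin 2 → E) :
    herm σ J x (t • y) = t * herm σ J x y := by
  simp only [herm_eq, Pi.smul_apply, smul_eq_mul]; ring

theorem herm_mulVec (g : Matrix (Fin 2) (Fin 2) E) (hg : adj σ g * J * g = J)
    (x y : Fin 2 → E) : herm σ J (g *ᵥ x) (g *ᵥ y) = herm σ J x y := by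
  nth_rewrite 2 [← hg]
  simp only [herm_eq, adj, Matrix.mulVec, dotProduct, Fin.sum_univ_two, map_add, map_mul,
    Matrix.mul_apply, Matrix.transpose_apply, Matrix.map_apply]
  ring

/-- An isotropic vector z in a nondegenerate plane completes to a hyperbolic pair: choose y₁ pairing
to 1 with z and remove its length by subtracting half of it times z. -/
theorem exists_split_of_isotropic (hσ2 : ∀ z, σ (σ z) = z) (h2 : (2 : E) ≠ 0)
    (hJ : adj σ J = J) (hdet : J.det ≠ 0) {z : Fin 2 → E} (hz : z ≠ 0)
    (hiso : herm σ J z z = 0) : ∃ P : GL (Fin 2) E,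
      adj σ (P : Matrix (Fin 2) (Fin 2) E) * J * (P : Matrix (Fin 2) (Fin 2) E) = !![0, 1; 1, 0] := by
  obtain ⟨y₀, hy₀⟩ : ∃ y, herm σ J z y ≠ 0 := by
    by_contra! hc
    have h0 : hermStar σ J z = 0 := dotProduct_eq_zero _ hc
    have h1 : (fun i => σ (z i)) = 0 :=
      Matrix.eq_zero_of_vecMul_eq_zero hdet h0
    exact hz (funext fun i => by simpa using congrFun h1 i)
  obtain ⟨y₁, hy₁⟩ : ∃ y₁, herm σ J z y₁ = 1 :=
    ⟨(herm σ J z y₀)⁻¹ • y₀, by rw [herm_smul_right, inv_mul_cancel₀ hy₀]⟩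
  have hy₁' : herm σ J y₁ z = 1 := by rw [herm_symm hσ2 hJ z, hy₁, map_one]
  set t := herm σ J y₁ y₁
  have ht : σ t = t := (herm_symm hσ2 hJ y₁ y₁).symm
  set y := y₁ + (-(t / 2)) • z
  have hσt : σ (-(t / 2)) = -(t / 2) := by rw [map_neg, map_div₀, ht, map_ofNat]
  have hzy : herm σ J z y = 1 := by
    rw [herm_add_right, herm_smul_right, hy₁, hiso, mul_zero, add_zero]
  have hyz : herm σ J y z = 1 := by rw [herm_symm hσ2 hJ z, hzy, map_one]
  have hyy : herm σ J y y = 0 := by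
    change herm σ J (y₁ + (-(t / 2)) • z) y = 0
    rw [herm_add_left, herm_smul_left, hzy, hσt, herm_add_right, herm_smul_right, hy₁']
    change t + -(t / 2) * 1 + -(t / 2) * 1 = 0
    field_simp
    ring
  set P : Matrix (Fin 2) (Fin 2) E := !![z 0, y 0; z 1, y 1]
  have hP : adj σ P * J * P = !![0, 1; 1, 0] := by
    have key : adj σ P * J * P = !![herm σ J z z, herm σ J z y; herm σ J y z, herm σ J y y] := by
      ext i j
      fin_cases i <;> fin_cases j <;>
        simp [P, adj, herm_eq, Matrix.mul_apply, Fin.sum_univ_two] <;> ring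
    rw [key, hiso, hzy, hyz, hyy]
  have hPdet : P.det ≠ 0 := by
    intro h0
    have := congrArg Matrix.det hP
    rw [Matrix.det_mul, h0, mul_zero, Matrix.det_fin_two_of] at this
    simp at this
  exact ⟨Matrix.GeneralLinearGroup.mkOfDetNeZero P hPdet, hP⟩

theorem S2_entries {γ : S2 σ} {a b c d : E}
    (hγ : ((γ : GL (Fin 2) E) : Matrix (Fin 2) (Fin 2) E) = !![a, b; c, d]) :
    a * σ a + b * σ c = 1 ∧ a * σ b + b * σ d = 0 ∧ c * σ a + d * σ c = 0 ∧
      c * σ b + d * σ d = 1 := by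
  have h : (γ : GL (Fin 2) E) * conjGL σ γ = 1 := γ.2
  have h' : ((γ : GL (Fin 2) E) : Matrix (Fin 2) (Fin 2) E) *
      ((γ : GL (Fin 2) E) : Matrix (Fin 2) (Fin 2) E).map σ = 1 := congrArg Units.val h
  rw [hγ] at h'
  have key : ∀ i j, _ := fun i j => congrFun (congrFun h' i) j
  refine ⟨?_, ?_, ?_, ?_⟩
  · simpa [Matrix.mul_apply, Fin.sum_univ_two] using key 0 0
  · simpa [Matrix.mul_apply, Fin.sum_univ_two] using key 0 1
  · simpa [Matrix.mul_apply, Fin.sum_univ_two] using key 1 0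
  · simpa [Matrix.mul_apply, Fin.sum_univ_two] using key 1 1

theorem ne_zero_of_isRegSS {a b c d e : E}
    (h : IsRegSS !![a, b; c, d] ![0, 1] ![0, e]) : b ≠ 0 ∧ c ≠ 0 ∧ e ≠ 0 := by
  have h1 := LinearIndependent.pair_iff.1 (show LinearIndependent E ![![(0 : E), 1], ![b, d]] by
    convert h.1 using 1
    funext i j
    fin_cases i <;> fin_cases j <;> simp [Matrix.mulVec, dotProduct])
  have h2 := LinearIndependent.pair_iff.1
    (show LinearIndependent E ![![(0 : E), e], ![e * c, e * d]] by
      convert h.2 using 1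
      funext i j
      fin_cases i <;> fin_cases j <;> simp [Matrix.vecMul, dotProduct])
  refine ⟨?_, ?_, ?_⟩
  · rintro rfl
    have := h1 (-d) 1 (by ext i; fin_cases i <;> simp)
    exact one_ne_zero this.2
  · rintro rfl
    have := h2 (-d) 1 (by ext i; fin_cases i <;> simp; ring)
    exact one_ne_zero this.2
  · rintro rfl
    have := h2 1 0 (by ext i; fin_cases i <;> simp)
    exact one_ne_zero this.1

/-- If `1 - d d̄` were `-t t̄`, then the Hermitian space matching `γ` would be isotropic. -/
theorem not_exists_mul_conj_eq (hσ2 : ∀ z, σ (σ z) = z) (h2 : (2 : E) ≠ 0)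
    {γ : S2 σ} {a b c d : E} {e : F}
    (hγ : ((γ : GL (Fin 2) E) : Matrix (Fin 2) (Fin 2) E) = !![a, b; c, d])
    (hrs : IsRegSSMinus γ ![0, 1] ![0, e]) : ¬ ∃ t : E, t * σ t = d * σ d - 1 := by
  rintro ⟨t, ht⟩
  obtain ⟨-, J, ⟨hJ, hdet, hns⟩, g, w, hg, hgrs, P, hP1, hP2, hP3⟩ := hrs
  set u : Fin 2 → E := fun i => algebraMap F E (![0, 1] i)
  set v : Fin 2 → E := fun i => algebraMap F E (![0, e] i)
  set e' := algebraMap F E e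
  have hu : u = ![0, 1] := by ext i; fin_cases i <;> simp [u]
  have hv : v = ![0, e'] := by ext i; fin_cases i <;> simp [v, e']
  have hw : herm σ J w w = e' := by
    rw [herm, ← hP3, ← hP2, ← Matrix.dotProduct_mulVec, Matrix.mulVec_mulVec, ← Units.val_mul,
      inv_mul_cancel, Units.val_one, Matrix.one_mulVec, hu, hv]
    simp
  have hwg : herm σ J w ((g : Matrix (Fin 2) (Fin 2) E) *ᵥ w) = e' * d := by
    rw [herm, ← hP3, ← hP2, ← hP1, ← Matrix.dotProduct_mulVec, Matrix.mulVec_mulVec,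
      Matrix.mulVec_mulVec, ← Units.val_mul, ← Units.val_mul,
      show P⁻¹ * (P * (γ : GL (Fin 2) E) * P⁻¹) * P = γ by group, hγ, hu, hv]
    simp [Matrix.mulVec, dotProduct]
  have hgw : herm σ J ((g : Matrix (Fin 2) (Fin 2) E) *ᵥ w) w = e' * σ d := by
    rw [herm_symm hσ2 hJ w, hwg, map_mul]
    simp [e']
  have hgg : herm σ J ((g : Matrix (Fin 2) (Fin 2) E) *ᵥ w)
      ((g : Matrix (Fin 2) (Fin 2) E) *ᵥ w) = e' := by rw [herm_mulVec _ hg, hw]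
  -- The vector g w - d w is orthogonal to w and has length e(1 - d d̄), while t w has length e t
  -- t̄. These lengths cancel in the sum; regularity keeps it nonzero.
  refine hns (exists_split_of_isotropic hσ2 h2 hJ hdet
    (z := (t - d) • w + (1 : E) • ((g : Matrix (Fin 2) (Fin 2) E) *ᵥ w)) ?_ ?_)
  · intro h0
    have hli := LinearIndependent.pair_iff.1
      (show LinearIndependent E ![w, (g : Matrix (Fin 2) (Fin 2) E) *ᵥ w] by
        convert hgrs.1 using 1
        funext i
        fin_cases i <;> simp)
    exact one_ne_zero (hli _ _ h0).2
  · rw [herm_add_left, herm_smul_left, herm_smul_left, herm_add_right, herm_add_right,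
      herm_smul_right, herm_smul_right, herm_smul_right, herm_smul_right, hw, hwg, hgw, hgg,
      map_sub, map_one]
    linear_combination e' * ht

end Hermitian

/-! ### Valuations of the entries of γ. -/

section Invariants

variable {F E : Type*} [NormedField F] [NormedField E] [NormedAlgebra F E]
  [IsUltrametricDist F] [ProperSpace F] {σ : E ≃ₐ[F] E} {ϖ : F}

/-- The element d d̄ - 1 = -c b̄ lies in F, has valuation v(b) + v(c), and is not a norm from E, so
this valuation is odd. -/
theorem odd_val_add_val_and_pos (hdeg : Module.finrank F E = 2) (hunr : IsUnramified F E)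
    (hσ : σ ≠ AlgEquiv.refl) (hϖ : IsUniformizer ϖ) (h2 : ‖(2 : F)‖ = 1)
    {γ : S2 σ} {a b c d : E} {e : F}
    (hγ : ((γ : GL (Fin 2) E) : Matrix (Fin 2) (Fin 2) E) = !![a, b; c, d])
    (hrs : IsRegSSMinus γ ![0, 1] ![0, e]) (hb : b ≠ 0) (hc : c ≠ 0) :
    Odd (val (algebraMap F E ϖ) b + val (algebraMap F E ϖ) c) ∧
      0 < val (algebraMap F E ϖ) b + val (algebraMap F E ϖ) c := by
  have : IsUltrametricDist E := isUltrametricDist_of_normedAlgebra F E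
  have hϖE := hunr ϖ hϖ
  have hσ2 := conj_conj hdeg hσ
  have hσn := norm_conj hϖ hdeg σ
  have hϖn : ‖algebraMap F E ϖ‖ = ‖ϖ‖ := norm_algebraMap' E ϖ
  obtain ⟨-, -, -, h22⟩ := S2_entries hγ
  have h20 : (2 : E) ≠ 0 := by
    rw [← map_ofNat (algebraMap F E) 2, ne_eq, map_eq_zero]
    exact norm_ne_zero_iff.1 (by rw [h2]; exact one_ne_zero)
  obtain ⟨f, hf⟩ := mem_range_of_fixed hdeg hσ (x := d * σ d - 1) (by
    rw [map_sub, map_mul, hσ2, map_one, mul_comm])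
  have hf' : algebraMap F E f = -(c * σ b) := by rw [hf]; linear_combination h22
  set vb := val (algebraMap F E ϖ) b with hvb
  set vc := val (algebraMap F E ϖ) c with hvc
  have hfn : ‖f‖ = ‖ϖ‖ ^ (vb + vc) := by
    rw [← norm_algebraMap' E, hf', norm_neg, norm_mul, hσn, norm_eq_zpow_val hϖE hb,
      norm_eq_zpow_val hϖE hc, hϖn, ← zpow_add₀ hϖ.norm_pos.ne', add_comm]
  have hf0 : f ≠ 0 := norm_ne_zero_iff.1 (by rw [hfn]; exact (zpow_pos hϖ.norm_pos _).ne')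
  have hvf : val ϖ f = vb + vc := val_eq_of_norm hϖ hfn
  have hodd : Odd (vb + vc) := by
    rw [← Int.not_even_iff_odd, ← hvf]
    intro heven
    refine not_exists_mul_conj_eq hσ2 h20 hγ hrs ?_
    rw [← hf]
    exact exists_mul_conj_eq hdeg hunr hσ hϖ h2 hf0 heven
  refine ⟨hodd, ?_⟩
  -- Were the valuation negative, d d̄ would have the same one, but the valuation of d d̄ is even.
  by_contra hneg
  have hlt : vb + vc < 0 := by obtain ⟨t, ht⟩ := hodd; omega
  have hdd : ‖d * σ d‖ = ‖ϖ‖ ^ (vb + vc) := by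
    rw [show d * σ d = algebraMap F E f + 1 by rw [hf]; ring, norm_add_eq_left]
    · rw [norm_algebraMap', hfn]
    · rw [norm_one, norm_algebraMap', hfn, ← zpow_zero ‖ϖ‖, hϖ.zpow_lt_zpow_iff]
      exact hlt
  have hd0 : d ≠ 0 := by
    rintro rfl
    rw [zero_mul, norm_zero] at hdd
    exact (zpow_pos hϖ.norm_pos _).ne hdd
  rw [norm_mul, hσn, norm_eq_zpow_val hϖE hd0, hϖn, ← zpow_add₀ hϖ.norm_pos.ne',
    hϖ.zpow_inj] at hdd
  rw [← hdd, ← Int.not_even_iff_odd] at hodd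
  exact hodd ⟨_, rfl⟩

/-- The relations in γ γ̄ = 1 give b c̄ = 1 - a ā and (d - a) c̄ = -(c ā + a c̄). Both are fixed by
conjugation, as is c c̄, so all three descend to F; powers of ϖ remove the scale of c. -/
theorem exists_form_coefficients (hdeg : Module.finrank F E = 2) (hunr : IsUnramified F E)
    (hσ : σ ≠ AlgEquiv.refl) (hϖ : IsUniformizer ϖ)
    {γ : S2 σ} {a b c d : E}
    (hγ : ((γ : GL (Fin 2) E) : Matrix (Fin 2) (Fin 2) E) = !![a, b; c, d])
    (hb : b ≠ 0) (hc : c ≠ 0)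
    (hpos : 0 < val (algebraMap F E ϖ) b + val (algebraMap F E ϖ) c) :
    ‖a‖ = 1 ∧ ‖d‖ = 1 ∧ ∃ B D ε : F,
      algebraMap F E B = b * σ c ∧
      algebraMap F E D * algebraMap F E (ϖ ^ val (algebraMap F E ϖ) c) = (d - a) * σ c ∧
      algebraMap F E ε * algebraMap F E (ϖ ^ val (algebraMap F E ϖ) c) ^ 2 = c * σ c ∧
      ‖B‖ = ‖ϖ‖ ^ (val (algebraMap F E ϖ) b + val (algebraMap F E ϖ) c) ∧
      ‖D‖ = ‖d - a‖ ∧ ‖ε‖ = 1 := by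
  have : IsUltrametricDist E := isUltrametricDist_of_normedAlgebra F E
  have hϖE := hunr ϖ hϖ
  have hσ2 := conj_conj hdeg hσ
  have hσn := norm_conj hϖ hdeg σ
  have hϖn : ‖algebraMap F E ϖ‖ = ‖ϖ‖ := norm_algebraMap' E ϖ
  obtain ⟨h11, -, h21, h22⟩ := S2_entries hγ
  set vb := val (algebraMap F E ϖ) b with hvb
  set vc := val (algebraMap F E ϖ) c with hvc
  have hbn : ‖b‖ = ‖ϖ‖ ^ vb := by rw [norm_eq_zpow_val hϖE hb, hϖn]
  have hcn : ‖c‖ = ‖ϖ‖ ^ vc := by rw [norm_eq_zpow_val hϖE hc, hϖn]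
  have hbc : ‖b‖ * ‖c‖ < 1 := by
    rw [hbn, hcn, ← zpow_add₀ hϖ.norm_pos.ne', ← zpow_zero ‖ϖ‖, hϖ.zpow_lt_zpow_iff]
    exact hpos
  have hunit : ∀ x y : E, x * σ x + y = 1 → ‖y‖ < 1 → ‖x‖ = 1 := by
    intro x y hxy hy
    have h1 : ‖x * σ x‖ = 1 := by
      rw [show x * σ x = 1 - y by linear_combination hxy, norm_sub_eq_left (by rwa [norm_one]),
        norm_one]
    rw [norm_mul, hσn, ← sq] at h1
    exact (pow_eq_one_iff_of_nonneg (norm_nonneg _) two_ne_zero).1 h1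
  refine ⟨hunit a _ h11 (by rwa [norm_mul, hσn]),
    hunit d (c * σ b) (by rw [add_comm]; exact h22) (by rwa [norm_mul, hσn, mul_comm]), ?_⟩
  obtain ⟨B, hB⟩ := mem_range_of_fixed hdeg hσ (x := b * σ c) (by
    rw [show b * σ c = 1 - a * σ a by linear_combination h11, map_sub, map_mul, hσ2, map_one,
      mul_comm])
  obtain ⟨D, hD⟩ := mem_range_of_fixed hdeg hσ (x := (d - a) * σ c) (by
    rw [show (d - a) * σ c = -(c * σ a + a * σ c) by linear_combination h21]
    simp only [map_neg, map_add, map_mul, hσ2]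
    ring)
  obtain ⟨ε, hε⟩ := mem_range_of_fixed hdeg hσ (x := c * σ c) (by
    rw [map_mul, hσ2, mul_comm])
  have hp : ϖ ^ vc ≠ 0 := zpow_ne_zero _ hϖ.1
  have hpE : algebraMap F E (ϖ ^ vc) ≠ 0 := by rw [ne_eq, map_eq_zero]; exact hp
  have hpn : ‖ϖ ^ vc‖ = ‖c‖ := by rw [norm_zpow, hcn]
  have hc0 : ‖c‖ ≠ 0 := norm_ne_zero_iff.2 hc
  refine ⟨B, D / ϖ ^ vc, ε / (ϖ ^ vc) ^ 2, hB, ?_, ?_, ?_, ?_, ?_⟩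
  · rw [map_div₀, hD, div_mul_cancel₀ _ hpE]
  · rw [map_div₀, hε, map_pow, div_mul_cancel₀ _ (pow_ne_zero _ hpE)]
  · rw [← norm_algebraMap' E, hB, norm_mul, hσn, hbn, hcn, ← zpow_add₀ hϖ.norm_pos.ne']
  · rw [norm_div, ← norm_algebraMap' E D, hD, norm_mul, hσn, hpn, mul_div_cancel_right₀ _ hc0]
  · rw [norm_div, ← norm_algebraMap' E ε, hε, norm_mul, hσn, norm_pow, hpn]
    field_simp

end Invariants

/-! ### The integrand on triangular matrices. -/

section Integrand

variable {F E : Type*} [NormedField F] [NormedField E] [NormedAlgebra F E]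
  {σ : E ≃ₐ[F] E} {ϖ : F}

theorem extGL_upperGL_val (x y z : F) (hx : x ≠ 0) (hz : z ≠ 0) :
    (extGL E (upperGL x y z hx hz) : Matrix (Fin 2) (Fin 2) E) =
      !![algebraMap F E x, algebraMap F E y; 0, algebraMap F E z] := by
  ext i j
  fin_cases i <;> fin_cases j <;> simp [extGL, upperGL_val]

theorem actS2_upperGL_val {γ : S2 σ} {a b c d : E}
    (hγ : ((γ : GL (Fin 2) E) : Matrix (Fin 2) (Fin 2) E) = !![a, b; c, d])
    (x y z : F) (hx : x ≠ 0) (hz : z ≠ 0) :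
    (((actS2 (upperGL x y z hx hz) γ : S2 σ) : GL (Fin 2) E) : Matrix (Fin 2) (Fin 2) E) =
      !![a + algebraMap F E y * c / algebraMap F E x,
        (algebraMap F E x ^ 2 * b + algebraMap F E x * algebraMap F E y * (d - a)
          - algebraMap F E y ^ 2 * c) / (algebraMap F E x * algebraMap F E z);
        algebraMap F E z * c / algebraMap F E x,
        d - algebraMap F E y * c / algebraMap F E x] := by
  have hx' : algebraMap F E x ≠ 0 := by simpa using hx
  have hz' : algebraMap F E z ≠ 0 := by simpa using hz
  have hinv : (extGL E (upperGL x y z hx hz))⁻¹ = extGL E (upperGL x y z hx hz)⁻¹ :=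
    (map_inv _ _).symm
  change (extGL E (upperGL x y z hx hz) * (γ : GL (Fin 2) E) *
    (extGL E (upperGL x y z hx hz))⁻¹).val = _
  rw [hinv, upperGL_inv, Units.val_mul, Units.val_mul, extGL_upperGL_val, extGL_upperGL_val, hγ]
  simp only [map_inv₀, map_div₀, map_neg, map_mul]
  generalize algebraMap F E x = x at *
  generalize algebraMap F E y = y at *
  generalize algebraMap F E z = z at *
  ext i j
  fin_cases i <;> fin_cases j
  · simp [Matrix.mul_apply, Fin.sum_univ_two]; field_simp
  · simp [Matrix.mul_apply, Fin.sum_univ_two]; field_simp; ring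
  · simp [Matrix.mul_apply, Fin.sum_univ_two]; field_simp
  · simp [Matrix.mul_apply, Fin.sum_univ_two]; field_simp; ring

theorem actS2_mul {γ : S2 σ} (g h : GL (Fin 2) F) : actS2 (g * h) γ = actS2 g (actS2 h γ) := by
  apply Subtype.ext
  change extGL E (g * h) * (γ : GL (Fin 2) E) * (extGL E (g * h))⁻¹ =
    extGL E g * (extGL E h * (γ : GL (Fin 2) E) * (extGL E h)⁻¹) * (extGL E g)⁻¹
  simp only [extGL, map_mul, mul_inv_rev]
  group

variable [IsUltrametricDist F]

/-- The units a and d do not affect the diagonal conditions, which both bound y. The lower left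
entry bounds k, and the upper right entry is the quadratic form divided by c̄ and powers of ϖ. -/
theorem actS2_upperGL_mem_KSle_iff (hϖ : IsUniformizer ϖ) {γ : S2 σ}
    {a b c d : E}
    (hγ : ((γ : GL (Fin 2) E) : Matrix (Fin 2) (Fin 2) E) = !![a, b; c, d])
    (ha : ‖a‖ = 1) (hd : ‖d‖ = 1) {vc : ℤ} (hc : ‖c‖ = ‖ϖ‖ ^ vc) (hσc : ‖σ c‖ = ‖c‖) {B D ε : F}
    (hB : algebraMap F E B = b * σ c)
    (hD : algebraMap F E D * algebraMap F E (ϖ ^ vc) = (d - a) * σ c)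
    (hε : algebraMap F E ε * algebraMap F E (ϖ ^ vc) ^ 2 = c * σ c)
    (r : ℕ) (k : ℤ) (n : ℕ) (y : F) :
    actS2 (upperGL (ϖ ^ (k + vc)) y (ϖ ^ (n : ℤ)) (zpow_ne_zero _ hϖ.1) (zpow_ne_zero _ hϖ.1)) γ
      ∈ KSle σ ϖ r ↔ FormCond ϖ B D ε n r k y := by
  have : IsUltrametricDist E := isUltrametricDist_of_normedAlgebra F E
  have hne := hϖ.norm_pos.ne'
  have hpp : ∀ j : ℤ, 0 < ‖ϖ‖ ^ j := zpow_pos hϖ.norm_pos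
  have hn : ∀ x : F, ‖algebraMap F E x‖ = ‖x‖ := norm_algebraMap' E
  have hr1 : ‖algebraMap F E ϖ ^ r‖ ≤ 1 := by
    rw [norm_pow, hn]; exact pow_le_one₀ hϖ.norm_pos.le hϖ.2.1.le
  have hrn : ‖algebraMap F E ϖ ^ r‖ = ‖ϖ‖ ^ (r : ℤ) := by rw [norm_pow, hn, zpow_natCast]
  have hw : ‖algebraMap F E y * c / algebraMap F E (ϖ ^ (k + vc))‖ = ‖y‖ * ‖ϖ‖ ^ (-k) := by
    rw [norm_div, norm_mul, hn, hn, norm_zpow, hc, zpow_add₀ hne, zpow_neg]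
    field_simp [(hpp vc).ne']
  have hdiag : ‖algebraMap F E ϖ ^ r *
      (algebraMap F E y * c / algebraMap F E (ϖ ^ (k + vc)))‖ ≤ 1 ↔ ‖y‖ ≤ ‖ϖ‖ ^ (k - r) := by
    rw [norm_mul, hrn, hw, mul_left_comm, ← zpow_add₀ hne, show k - r = -(r + -k) by ring,
      zpow_neg, ← one_div, le_div_iff₀ (hpp _)]
  have h00 : ‖algebraMap F E ϖ ^ r * (a + algebraMap F E y * c / algebraMap F E (ϖ ^ (k + vc)))‖ ≤ 1
      ↔ ‖y‖ ≤ ‖ϖ‖ ^ (k - r) := by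
    rw [← hdiag, mul_add]
    have h1 : ‖algebraMap F E ϖ ^ r * a‖ ≤ 1 := by rwa [norm_mul, ha, mul_one]
    refine ⟨fun h => ?_, fun h => norm_add_le_of_le h1 h⟩
    have := norm_sub_le_of_le h h1
    rwa [add_sub_cancel_left] at this
  have h11 : ‖algebraMap F E ϖ ^ r * (d - algebraMap F E y * c / algebraMap F E (ϖ ^ (k + vc)))‖ ≤ 1
      ↔ ‖y‖ ≤ ‖ϖ‖ ^ (k - r) := by
    rw [← hdiag, mul_sub]
    have h1 : ‖algebraMap F E ϖ ^ r * d‖ ≤ 1 := by rwa [norm_mul, hd, mul_one]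
    refine ⟨fun h => ?_, fun h => norm_sub_le_of_le h1 h⟩
    have := norm_sub_le_of_le h1 h
    rwa [sub_sub_cancel] at this
  have h10 : ‖algebraMap F E ϖ ^ r *
      (algebraMap F E (ϖ ^ (n : ℤ)) * c / algebraMap F E (ϖ ^ (k + vc)))‖ ≤ 1 ↔ k ≤ n + r := by
    rw [norm_mul, norm_div, norm_mul, hn, hn, hrn, hc, norm_zpow, norm_zpow, ← zpow_add₀ hne,
      ← zpow_sub₀ hne, ← zpow_add₀ hne, ← zpow_zero ‖ϖ‖, hϖ.zpow_le_zpow_iff]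
    omega
  have hform : ‖algebraMap F E (ϖ ^ (k + vc)) ^ 2 * b + algebraMap F E (ϖ ^ (k + vc)) *
      algebraMap F E y * (d - a) - algebraMap F E y ^ 2 * c‖ =
      ‖ϖ ^ (2 * k) * B + ϖ ^ k * y * D - ε * y ^ 2‖ * ‖ϖ‖ ^ vc := by
    -- Multiplication by the conjugate of c moves the expression into F, at the cost of a known
    -- power of ϖ.
    have hmul : (algebraMap F E (ϖ ^ (k + vc)) ^ 2 * b + algebraMap F E (ϖ ^ (k + vc)) *
      algebraMap F E y * (d - a) - algebraMap F E y ^ 2 * c) * σ c =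
      algebraMap F E ((ϖ ^ vc) ^ 2 * (ϖ ^ (2 * k) * B + ϖ ^ k * y * D - ε * y ^ 2)) := by
      rw [two_mul, zpow_add₀ hϖ.1 k k, zpow_add₀ hϖ.1]
      simp only [map_mul, map_add, map_sub, map_pow]
      linear_combination -algebraMap F E (ϖ ^ vc) ^ 2 * algebraMap F E (ϖ ^ k) ^ 2 * hB -
        algebraMap F E (ϖ ^ vc) * algebraMap F E (ϖ ^ k) * algebraMap F E y * hD +
        algebraMap F E y ^ 2 * hε
    have := congrArg norm hmul
    rw [norm_mul, hσc, hn, norm_mul, norm_pow, norm_zpow, hc] at this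
    refine mul_right_cancel₀ (hpp vc).ne' ?_
    rw [this]; ring
  have h01 : ‖algebraMap F E ϖ ^ r * ((algebraMap F E (ϖ ^ (k + vc)) ^ 2 * b +
      algebraMap F E (ϖ ^ (k + vc)) * algebraMap F E y * (d - a) - algebraMap F E y ^ 2 * c) /
        (algebraMap F E (ϖ ^ (k + vc)) * algebraMap F E (ϖ ^ (n : ℤ))))‖ ≤ 1 ↔
      ‖ϖ ^ (2 * k) * B + ϖ ^ k * y * D - ε * y ^ 2‖ ≤ ‖ϖ‖ ^ (k + n - r) := by
    rw [norm_mul, norm_div, hform, norm_mul, hn, hn, hrn, norm_zpow, norm_zpow, ← mul_div_assoc,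
      mul_left_comm, ← zpow_add₀ hne, ← zpow_add₀ hne, mul_div_assoc, ← zpow_sub₀ hne,
      show k + n - r = -((r : ℤ) + vc - (k + vc + n)) by ring, zpow_neg, ← one_div,
      le_div_iff₀ (hpp _)]
  simp only [KSle, Set.mem_ofPred_eq, actS2_upperGL_val hγ, Fin.forall_fin_two, Matrix.of_apply,
    Matrix.cons_val', Matrix.cons_val_zero, Matrix.cons_val_one, Matrix.cons_val_fin_one]
  rw [h00, h01, h10, h11, FormCond]
  tauto

theorem actS2_mem_KSle {γ : S2 σ} {r : ℕ} {κ : GL (Fin 2) F} (hκ : κ ∈ integralSubgroup F)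
    (hγ : γ ∈ KSle σ ϖ r) : actS2 κ γ ∈ KSle σ ϖ r := by
  have : IsUltrametricDist E := isUltrametricDist_of_normedAlgebra F E
  have h1 : ∀ i j, ‖(extGL E κ : Matrix (Fin 2) (Fin 2) E) i j‖ ≤ 1 := fun i j => by
    simp only [extGL, Matrix.GeneralLinearGroup.map_apply]
    rw [norm_algebraMap']; exact hκ.1 i j
  have h2 : ∀ i j, ‖((extGL E κ)⁻¹ : GL (Fin 2) E) i j‖ ≤ 1 := fun i j => by
    rw [show (extGL E κ)⁻¹ = extGL E κ⁻¹ from (map_inv _ _).symm]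
    simp only [extGL, Matrix.GeneralLinearGroup.map_apply]
    rw [norm_algebraMap']; exact hκ.2 i j
  have key : ∀ x y z ϖ' : E, ‖x‖ ≤ 1 → ‖ϖ' * y‖ ≤ 1 → ‖z‖ ≤ 1 → ‖ϖ' * (x * y * z)‖ ≤ 1 := by
    intro x y z ϖ' hx hy hz
    rw [show ϖ' * (x * y * z) = x * (ϖ' * y) * z by ring, norm_mul, norm_mul]
    exact mul_le_one₀ (mul_le_one₀ hx (norm_nonneg _) hy) (norm_nonneg _) hz
  intro i j
  change ‖_ * ((extGL E κ * (γ : GL (Fin 2) E) * (extGL E κ)⁻¹).val i j)‖ ≤ 1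
  rw [Units.val_mul, Units.val_mul, Matrix.mul_apply, Fin.sum_univ_two, Matrix.mul_apply,
    Matrix.mul_apply, Fin.sum_univ_two, Fin.sum_univ_two]
  simp only [add_mul, mul_add]
  exact norm_add_le_of_le
    (norm_add_le_of_le (key _ _ _ _ (h1 _ _) (hγ _ _) (h2 _ _))
      (key _ _ _ _ (h1 _ _) (hγ _ _) (h2 _ _)))
    (norm_add_le_of_le (key _ _ _ _ (h1 _ _) (hγ _ _) (h2 _ _))
      (key _ _ _ _ (h1 _ _) (hγ _ _) (h2 _ _)))

theorem indKSle_actS2 {γ : S2 σ} {r : ℕ} {κ : GL (Fin 2) F} (hκ : κ ∈ integralSubgroup F) :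
    indKSle σ ϖ r (actS2 κ γ) = indKSle σ ϖ r γ := by
  have hiff : actS2 κ γ ∈ KSle σ ϖ r ↔ γ ∈ KSle σ ϖ r := by
    refine ⟨fun h => ?_, actS2_mem_KSle hκ⟩
    have := actS2_mem_KSle (inv_mem hκ) h
    rw [← actS2_mul, inv_mul_cancel] at this
    convert this
    apply Subtype.ext
    change _ = extGL E 1 * (γ : GL (Fin 2) E) * (extGL E 1)⁻¹
    simp [extGL]
  classical
  simp only [indKSle, Set.indicator_apply, hiff]
  rfl

theorem indInt_integral_mul {κ : GL (Fin 2) F} (hκ : κ ∈ integralSubgroup F) (h : GL (Fin 2) F)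
    (u v : Fin 2 → F) :
    indInt (((κ * h : GL (Fin 2) F) : Matrix (Fin 2) (Fin 2) F) *ᵥ u,
      v ᵥ* (((κ * h)⁻¹ : GL (Fin 2) F) : Matrix (Fin 2) (Fin 2) F)) =
    indInt ((h : Matrix (Fin 2) (Fin 2) F) *ᵥ u,
      v ᵥ* ((h⁻¹ : GL (Fin 2) F) : Matrix (Fin 2) (Fin 2) F)) := by
  have h1 : ∀ κ ∈ integralSubgroup F, ∀ x : Fin 2 → F, (∀ i, ‖x i‖ ≤ 1) →
      ∀ i, ‖((κ : Matrix (Fin 2) (Fin 2) F) *ᵥ x) i‖ ≤ 1 := by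
    intro κ hκ x hx i
    rw [Matrix.mulVec, dotProduct, Fin.sum_univ_two]
    refine norm_add_le_of_le ?_ ?_ <;> rw [norm_mul] <;>
      exact mul_le_one₀ (hκ.1 _ _) (norm_nonneg _) (hx _)
  have h2 : ∀ κ ∈ integralSubgroup F, ∀ x : Fin 2 → F, (∀ i, ‖x i‖ ≤ 1) →
      ∀ i, ‖(x ᵥ* (κ : Matrix (Fin 2) (Fin 2) F)) i‖ ≤ 1 := by
    intro κ hκ x hx i
    rw [Matrix.vecMul, dotProduct, Fin.sum_univ_two]
    refine norm_add_le_of_le ?_ ?_ <;> rw [norm_mul] <;>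
      exact mul_le_one₀ (hx _) (norm_nonneg _) (hκ.1 _ _)
  have key : ∀ κ ∈ integralSubgroup F, ∀ h : GL (Fin 2) F,
      ((∀ i, ‖((h : Matrix (Fin 2) (Fin 2) F) *ᵥ u) i‖ ≤ 1) ∧
        ∀ i, ‖(v ᵥ* ((h⁻¹ : GL (Fin 2) F) : Matrix (Fin 2) (Fin 2) F)) i‖ ≤ 1) →
      ((∀ i, ‖(((κ * h : GL (Fin 2) F) : Matrix (Fin 2) (Fin 2) F) *ᵥ u) i‖ ≤ 1) ∧
        ∀ i, ‖(v ᵥ* (((κ * h)⁻¹ : GL (Fin 2) F) : Matrix (Fin 2) (Fin 2) F)) i‖ ≤ 1) := by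
    rintro κ hκ h ⟨hu, hv⟩
    rw [mul_inv_rev, Units.val_mul, Units.val_mul, ← Matrix.mulVec_mulVec, ← Matrix.vecMul_vecMul]
    exact ⟨h1 κ hκ _ hu, h2 _ (inv_mem hκ) _ hv⟩
  have hiff := Iff.intro (fun hh => by
    have := key κ⁻¹ (inv_mem hκ) (κ * h) hh
    rwa [inv_mul_cancel_left] at this) (key κ hκ h)
  classical
  simp only [indInt, Set.indicator_apply, Set.mem_ofPred_eq, hiff]
  rfl

theorem norm_det_le_one {κ : Matrix (Fin 2) (Fin 2) F} (hκ : ∀ i j, ‖κ i j‖ ≤ 1) :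
    ‖κ.det‖ ≤ 1 := by
  rw [Matrix.det_fin_two]
  refine norm_sub_le_of_le ?_ ?_ <;> rw [norm_mul] <;>
    exact mul_le_one₀ (hκ _ _) (norm_nonneg _) (hκ _ _)

theorem norm_det_integral {κ : GL (Fin 2) F} (hκ : κ ∈ integralSubgroup F) :
    ‖(κ : Matrix (Fin 2) (Fin 2) F).det‖ = 1 := by
  have h1 := norm_det_le_one hκ.1
  have h2 := norm_det_le_one hκ.2
  have h3 : ‖(κ : Matrix (Fin 2) (Fin 2) F).det‖ *
      ‖((κ⁻¹ : GL (Fin 2) F) : Matrix (Fin 2) (Fin 2) F).det‖ = 1 := by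
    rw [← norm_mul, ← Matrix.det_mul, ← Units.val_mul, mul_inv_cancel, Units.val_one,
      Matrix.det_one, norm_one]
  refine le_antisymm h1 ?_
  rw [← h3]
  exact mul_le_of_le_one_right (norm_nonneg _) h2

omit [IsUltrametricDist F] in
open Classical in
-- `val` is defined by a choice that depends on its argument only through the norm.
theorem val_congr {x y : F} (h : ‖x‖ = ‖y‖) : val ϖ x = val ϖ y := by
  change (fun t : ℝ => if h : ∃ n : ℤ, t = ‖ϖ‖ ^ n then h.choose else 0) ‖x‖ = _
  rw [h]
  rfl

theorem orbIntegrand_integral_mul (γ : S2 σ) (u v : Fin 2 → F) (φ : S2 σ → ℂ)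
    (hφ : ∀ κ ∈ integralSubgroup F, ∀ γ, φ (actS2 κ γ) = φ γ) (s : ℂ) {κ : GL (Fin 2) F}
    (hκ : κ ∈ integralSubgroup F) (h : GL (Fin 2) F) :
    orbIntegrand ϖ γ u v φ s (κ * h) = orbIntegrand ϖ γ u v φ s h := by
  have hdet : ‖((κ * h : GL (Fin 2) F) : Matrix (Fin 2) (Fin 2) F).det‖ =
      ‖(h : Matrix (Fin 2) (Fin 2) F).det‖ := by
    rw [Units.val_mul, Matrix.det_mul, norm_mul, norm_det_integral hκ, one_mul]
  rw [orbIntegrand, orbIntegrand, indInt_integral_mul hκ, actS2_mul, hφ κ hκ, eta, eta, absF, absF,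
    val_congr hdet]

omit [IsUltrametricDist F] in
theorem indInt_upperGL (hϖ : IsUniformizer ϖ) (e : F) (he : e ≠ 0) (m n : ℤ) (y : F)
    [Decidable (‖y‖ ≤ 1 ∧ 0 ≤ n ∧ n ≤ val ϖ e)] :
    indInt (((upperGL (ϖ ^ m) y (ϖ ^ n) (zpow_ne_zero _ hϖ.1) (zpow_ne_zero _ hϖ.1) :
        GL (Fin 2) F) : Matrix (Fin 2) (Fin 2) F) *ᵥ ![0, 1],
      ![0, e] ᵥ* (((upperGL (ϖ ^ m) y (ϖ ^ n) (zpow_ne_zero _ hϖ.1) (zpow_ne_zero _ hϖ.1))⁻¹ :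
        GL (Fin 2) F) : Matrix (Fin 2) (Fin 2) F)) =
      if ‖y‖ ≤ 1 ∧ 0 ≤ n ∧ n ≤ val ϖ e then 1 else 0 := by
  have h1 : ‖ϖ ^ n‖ ≤ 1 ↔ 0 ≤ n := by
    rw [norm_zpow, ← zpow_zero ‖ϖ‖, hϖ.zpow_le_zpow_iff]
  have h2 : ‖e * (ϖ ^ n)⁻¹‖ ≤ 1 ↔ n ≤ val ϖ e := by
    rw [norm_mul, norm_inv, norm_zpow, norm_eq_zpow_val hϖ he, ← zpow_neg,
      ← zpow_add₀ hϖ.norm_pos.ne', ← zpow_zero ‖ϖ‖, hϖ.zpow_le_zpow_iff]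
    omega
  classical
  have hu : (!![ϖ ^ m, y; 0, ϖ ^ n] : Matrix (Fin 2) (Fin 2) F) *ᵥ ![0, 1] = ![y, ϖ ^ n] := by
    ext i; fin_cases i <;> simp [Matrix.mulVec, dotProduct]
  have hv : ![0, e] ᵥ* (!![(ϖ ^ m)⁻¹, -y / (ϖ ^ m * ϖ ^ n); 0, (ϖ ^ n)⁻¹] :
      Matrix (Fin 2) (Fin 2) F) = ![0, e * (ϖ ^ n)⁻¹] := by
    ext i; fin_cases i <;> simp [Matrix.vecMul, dotProduct]
  rw [upperGL_inv_val, upperGL_val, hu, hv, indInt, Set.indicator_apply]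
  simp only [Set.mem_ofPred_eq, Fin.forall_fin_two, Matrix.cons_val_zero, Matrix.cons_val_one,
    Matrix.cons_val_fin_one, norm_zero, zero_le_one, true_and, h1, h2, and_assoc]
  rfl

end Integrand

/-! ### The orbital integral as a finite sum. -/

section Orbital

variable {F E : Type*} [NormedField F] [NormedField E] [NormedAlgebra F E]
  [IsUltrametricDist F] {σ : E ≃ₐ[F] E} {ϖ : F}

/-- The weight `η(x) |x|^{-s}` of an element `x` of valuation `j`. -/
noncomputable def weight (F : Type*) [NormedField F] [IsUltrametricDist F] (s : ℂ) (j : ℤ) : ℂ :=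
  (-1) ^ j * (((residueCard F : ℝ) ^ (-j) : ℝ) : ℂ) ^ (-s)

theorem hasDerivAt_weight [ProperSpace F] (hϖ : IsUniformizer ϖ) (j : ℤ) :
    HasDerivAt (fun s => weight F s j)
      (Real.log (residueCard F) * ((-1) ^ j * (j : ℂ))) 0 := by
  have hq : (0 : ℝ) < residueCard F := by
    have := one_lt_residueCard hϖ
    exact_mod_cast (by omega : 0 < residueCard F)
  have hx : (0 : ℝ) < (residueCard F : ℝ) ^ (-j) := zpow_pos hq _
  have h0 : (((residueCard F : ℝ) ^ (-j) : ℝ) : ℂ) ≠ 0 := Complex.ofReal_ne_zero.2 hx.ne'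
  have h := (((hasDerivAt_id (0 : ℂ)).neg).const_cpow (c := (((residueCard F : ℝ) ^ (-j) : ℝ) : ℂ))
    (Or.inl h0)).const_mul ((-1 : ℂ) ^ j)
  refine h.congr_deriv ?_
  rw [← Complex.ofReal_log hx.le, Real.log_zpow]
  simp
  ring

/-- For very negative k the B-term dominates, its valuation 2k + l being less than k, and it then
violates the required precision. Hence the support meets finitely many cosets, which gives
convergence. -/
theorem FormCond.bounds (hϖ : IsUniformizer ϖ) {B D ε : F} {l : ℤ} (hl : 0 < l)
    (hB : ‖B‖ = ‖ϖ‖ ^ l) (hD : ‖D‖ ≤ 1) (hε : ‖ε‖ = 1) {n r : ℕ} {k : ℤ} {y : F}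
    (hy : ‖y‖ ≤ 1) (h : FormCond ϖ B D ε n r k y) : -(r + l) ≤ k ∧ k ≤ n + r := by
  refine ⟨?_, h.2.1⟩
  by_contra hk
  rw [not_le] at hk
  have hB' : ‖ϖ ^ (2 * k) * B‖ = ‖ϖ‖ ^ (2 * k + l) := by
    rw [norm_mul, norm_zpow, hB, ← zpow_add₀ hϖ.norm_pos.ne']
  have h1 : ‖ϖ ^ k * y * D‖ ≤ ‖ϖ‖ ^ k := by
    rw [norm_mul, norm_mul, norm_zpow, mul_assoc]
    exact mul_le_of_le_one_right (zpow_pos hϖ.norm_pos _).le (mul_le_one₀ hy (norm_nonneg _) hD)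
  have h2 : ‖ε * y ^ 2‖ ≤ ‖ϖ‖ ^ k := by
    rw [norm_mul, hε, one_mul, norm_pow]
    refine (pow_le_one₀ (norm_nonneg _) hy).trans ?_
    rw [← zpow_zero ‖ϖ‖, hϖ.zpow_le_zpow_iff]
    omega
  have h3 := h.2.2
  rw [add_sub_assoc, norm_add_eq_left, hB', hϖ.zpow_le_zpow_iff] at h3
  · omega
  · refine (norm_sub_le_of_le h1 h2).trans_lt ?_
    rw [hB', hϖ.zpow_lt_zpow_iff]
    omega

variable {γ : S2 σ} {a b c d : E}

open Classical in
theorem orbIntegrand_upperGL (hϖ : IsUniformizer ϖ)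
    (hγ : ((γ : GL (Fin 2) E) : Matrix (Fin 2) (Fin 2) E) = !![a, b; c, d])
    (ha : ‖a‖ = 1) (hd : ‖d‖ = 1) {vc : ℤ} (hc : ‖c‖ = ‖ϖ‖ ^ vc) (hσc : ‖σ c‖ = ‖c‖) {B D ε : F}
    (hB : algebraMap F E B = b * σ c)
    (hD : algebraMap F E D * algebraMap F E (ϖ ^ vc) = (d - a) * σ c)
    (hε : algebraMap F E ε * algebraMap F E (ϖ ^ vc) ^ 2 = c * σ c)
    {e : F} (he : e ≠ 0) (r₁ r₂ : ℕ) (s : ℂ) (k : ℤ) (n : ℕ) (y : F) :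
    orbIntegrand ϖ γ ![0, 1] ![0, e] (indKSle σ ϖ r₁ + indKSle σ ϖ r₂) s
      (upperGL (ϖ ^ (k + vc)) y (ϖ ^ (n : ℤ)) (zpow_ne_zero _ hϖ.1) (zpow_ne_zero _ hϖ.1)) =
    ((if FormCond ϖ B D ε n r₁ k y then 1 else 0) + (if FormCond ϖ B D ε n r₂ k y then 1 else 0)) *
      (if ‖y‖ ≤ 1 ∧ (0 : ℤ) ≤ n ∧ (n : ℤ) ≤ val ϖ e then 1 else 0) *
      weight F s (k + (n + vc)) := by
  have hind : ∀ r, indKSle σ ϖ r (actS2 (upperGL (ϖ ^ (k + vc)) y (ϖ ^ (n : ℤ))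
      (zpow_ne_zero _ hϖ.1) (zpow_ne_zero _ hϖ.1)) γ) =
      if FormCond ϖ B D ε n r k y then 1 else 0 := by
    intro r
    rw [indKSle, Set.indicator_apply]
    simp only [actS2_upperGL_mem_KSle_iff hϖ hγ ha hd hc hσc hB hD hε]
    rfl
  have hval : val ϖ (upperGL (ϖ ^ (k + vc)) y (ϖ ^ (n : ℤ)) (zpow_ne_zero _ hϖ.1)
      (zpow_ne_zero _ hϖ.1) : Matrix (Fin 2) (Fin 2) F).det = k + (n + vc) := by
    rw [upperGL_val, Matrix.det_fin_two_of, mul_zero, sub_zero, ← zpow_add₀ hϖ.1]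
    exact val_eq_of_norm hϖ (by rw [norm_zpow]; congr 1; ring)
  rw [orbIntegrand, indInt_upperGL hϖ e he, eta, absF, hval, Pi.add_apply, hind, hind, weight,
    mul_assoc]

open Classical in
theorem integrable_and_orb_eq_sum [ProperSpace F] [MeasurableSpace (GL (Fin 2) F)]
    [BorelSpace (GL (Fin 2) F)] (μ : Measure (GL (Fin 2) F)) [μ.IsHaarMeasure]
    (hμ : μ (integralGL F) = 1) (hϖ : IsUniformizer ϖ)
    (hγ : ((γ : GL (Fin 2) E) : Matrix (Fin 2) (Fin 2) E) = !![a, b; c, d])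
    (ha : ‖a‖ = 1) (hd : ‖d‖ = 1) {vc : ℤ} (hc : ‖c‖ = ‖ϖ‖ ^ vc) (hσc : ‖σ c‖ = ‖c‖) {B D ε : F}
    (hB : algebraMap F E B = b * σ c)
    (hD : algebraMap F E D * algebraMap F E (ϖ ^ vc) = (d - a) * σ c)
    (hε : algebraMap F E ε * algebraMap F E (ϖ ^ vc) ^ 2 = c * σ c)
    {e : F} (he : e ≠ 0) (r₁ r₂ : ℕ) {lo hi : ℤ}
    (hbound : ∀ n : ℕ, (n : ℤ) ≤ val ϖ e → ∀ k y, ‖y‖ ≤ 1 →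
      FormCond ϖ B D ε n r₁ k y ∨ FormCond ϖ B D ε n r₂ k y → lo ≤ k ∧ k < hi)
    (Y : ℕ → Finset F) (hY : ∀ n, IsReps ϖ n (Y n)) (s : ℂ) :
    Integrable (orbIntegrand ϖ γ ![0, 1] ![0, e] (indKSle σ ϖ r₁ + indKSle σ ϖ r₂) s) μ ∧
    Orb μ ϖ γ ![0, 1] ![0, e] (indKSle σ ϖ r₁ + indKSle σ ϖ r₂) s =
      ∑ n ∈ Finset.range (val ϖ e + 1).toNat, ∑ k ∈ Finset.Ico lo hi,
        weight F s (k + (n + vc)) *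
          (({y ∈ Y n | FormCond ϖ B D ε n r₁ k y}.card : ℂ) +
            ({y ∈ Y n | FormCond ϖ B D ε n r₂ k y}.card : ℂ)) := by
  set f := orbIntegrand ϖ γ ![0, 1] ![0, e] (indKSle σ ϖ r₁ + indKSle σ ϖ r₂) s with hf
  have hval := orbIntegrand_upperGL (e := e) hϖ hγ ha hd hc hσc hB hD hε he r₁ r₂ s
  have hinv : ∀ κ ∈ integralSubgroup F, ∀ h, f (κ * h) = f h := by
    intro κ hκ h
    refine orbIntegrand_integral_mul γ _ _ _ (fun κ hκ γ => ?_) s hκ h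
    rw [Pi.add_apply, Pi.add_apply, indKSle_actS2 hκ, indKSle_actS2 hκ]
  let T : Finset (Σ _ : ℕ, ℤ × F) :=
    (Finset.range (val ϖ e + 1).toNat).sigma fun n => Finset.Ico lo hi ×ˢ Y n
  have hmem : ∀ i : Σ _ : ℕ, ℤ × F, i ∈ T ↔ (i.1 : ℤ) ≤ val ϖ e ∧ (lo ≤ i.2.1 ∧ i.2.1 < hi) ∧
      i.2.2 ∈ Y i.1 := by
    intro i
    simp only [T, Finset.mem_sigma, Finset.mem_range, Finset.mem_product, Finset.mem_Ico]
    refine and_congr_left fun _ => ?_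
    omega
  obtain ⟨hint, hsum⟩ := integral_eq_sum_of_left_invariant μ hμ hϖ T (fun i => i.2.1 + vc)
    (fun i => (i.1 : ℤ)) (fun i => i.2.2) f hinv (by
      rintro ⟨n, k, y⟩ hi ⟨n', k', y'⟩ hj h1 h2 h3
      simp only at h1 h2 h3
      obtain rfl : n = n' := by exact_mod_cast h2
      obtain rfl : k = k' := by omega
      rw [hmem] at hi hj
      rw [zpow_natCast] at h3
      obtain rfl : y' = y := (hY n).eq_of_norm_sub_le hj.2.2 hi.2.2 h3
      rfl) (by
      intro h hh
      obtain ⟨κ, hκ, m, n, y, rfl⟩ := exists_eq_mul_upperGL hϖ h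
      rw [hinv κ hκ] at hh
      have hcond : ‖y‖ ≤ 1 ∧ 0 ≤ n ∧ n ≤ val ϖ e := by
        by_contra hc
        refine hh ?_
        rw [hf, orbIntegrand, indInt_upperGL hϖ e he, if_neg hc]
        simp
      obtain ⟨hy, hn0, hne⟩ := hcond
      obtain ⟨n, rfl⟩ := Int.eq_ofNat_of_zero_le hn0
      -- Changing y by a multiple of ϖ^n stays in the same coset, so y may be replaced by its
      -- representative.
      obtain ⟨y', ⟨hy', hyy'⟩, -⟩ := (hY n).2 y hy
      obtain ⟨κ', hκ', heq⟩ := upperGL_eq_mul_of_norm_sub_le (x := ϖ ^ m) (z := ϖ ^ (n : ℤ))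
        (hx := zpow_ne_zero _ hϖ.1) (hz := zpow_ne_zero _ hϖ.1)
        (show ‖y - y'‖ ≤ ‖ϖ ^ (n : ℤ)‖ by rw [norm_zpow, zpow_natCast]; exact hyy')
      rw [heq, hinv κ' hκ'] at hh
      have hform : FormCond ϖ B D ε n r₁ (m - vc) y' ∨ FormCond ϖ B D ε n r₂ (m - vc) y' := by
        by_contra hc
        rw [not_or] at hc
        have := hval (m - vc) n y'
        rw [if_neg hc.1, if_neg hc.2, add_zero, zero_mul, zero_mul] at this
        simp only [sub_add_cancel] at this
        exact hh this
      refine ⟨⟨n, m - vc, y'⟩, (hmem _).2 ⟨hne, hbound n hne _ _ ((hY n).1 y' hy') hform, hy'⟩,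
        κ * κ', mul_mem hκ hκ', ?_⟩
      rw [heq, mul_assoc]
      simp only [sub_add_cancel])
  refine ⟨hint, ?_⟩
  rw [Orb, hsum, Finset.sum_sigma]
  refine Finset.sum_congr rfl fun n hn => ?_
  rw [Finset.mem_range] at hn
  rw [Finset.sum_product]
  refine Finset.sum_congr rfl fun k _ => ?_
  rw [Finset.card_filter, Finset.card_filter, Nat.cast_sum, Nat.cast_sum, ← Finset.sum_add_distrib,
    Finset.mul_sum]
  refine Finset.sum_congr rfl fun y hy => ?_
  rw [hf, hval, if_pos (c := ‖y‖ ≤ 1 ∧ _) ⟨(hY n).1 y hy, Int.natCast_nonneg _, by dsimp only; omega⟩]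
  push_cast
  ring

end Orbital

/-! ### The sums over k for the actual counts, and the final formula. -/

section Main

variable {F : Type*} [NormedField F] [IsUltrametricDist F] [ProperSpace F] {ϖ : F}

open Classical in
/-- The derivative at `0` of the orbital integral, for fixed `n`, when the discriminant of the
form has odd valuation. -/
theorem sum_card_single (hϖ : IsUniformizer ϖ) {B D ε : F} {l : ℤ} (hl : Odd l) (hl0 : 0 < l)
    (hB : ‖B‖ = ‖ϖ‖ ^ l) (hD : ‖D‖ ≤ ‖ϖ‖ ^ ((l + 1) / 2)) (hε : ‖ε‖ = 1) {n r : ℕ}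
    {Y : Finset F} (hY : IsReps ϖ n Y) (vc : ℤ) {lo hi : ℤ} (hlo : lo ≤ n - r - l)
    (hhi : n + r < hi) :
    ∑ k ∈ Finset.Ico lo hi, (-1 : ℂ) ^ (k + (n + vc)) * ((k : ℂ) + ((n + vc : ℤ) : ℂ)) *
        ({y ∈ Y | FormCond ϖ B D ε n r k y}.card : ℂ) =
      (-1) ^ (r + vc) * singleRange (residueCard F) ((l - 1) / 2) n r :=
  sum_of_single_range (ballCount (residueCard F) n) n r vc hl hl0 _
    (card_formCond_single hϖ hl hB hD hε hY r) hlo hhi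

variable {B D ε ρ₁ ρ₂ : F} {l δ : ℤ}

open Classical in
-- When R = n - r - δ ≤ 0, balls of radius exponent at most 0 all contain the integers. The ball at
-- the larger root contributes nothing below the threshold, and the other extends the range to
-- exactly n - r - l, as in the unsplit case.
theorem sum_card_split_of_le (hϖ : IsUniformizer ϖ) (hl : Odd l) (hε : ‖ε‖ = 1)
    (hδ : 0 ≤ δ) (hlδ : 2 * δ < l) (hρ₁ : ‖ρ₁‖ = ‖ϖ‖ ^ δ) (hρ₂ : ‖ρ₂‖ = ‖ϖ‖ ^ (l - δ))
    (hD : D = ε * (ρ₁ + ρ₂)) (hB : B = -ε * (ρ₁ * ρ₂)) {n r : ℕ} {Y : Finset F}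
    (hY : IsReps ϖ n Y) (hR : (n - r - δ : ℤ) ≤ 0) (vc : ℤ) {lo hi : ℤ} (hlo : lo ≤ n - r - l)
    (hhi : n + r < hi) :
    ∑ k ∈ Finset.Ico lo hi, (-1 : ℂ) ^ (k + (n + vc)) * ((k : ℂ) + ((n + vc : ℤ) : ℂ)) *
        ({y ∈ Y | FormCond ϖ B D ε n r k y}.card : ℂ) =
      (-1) ^ (r + vc) * singleRange (residueCard F) ((l - 1) / 2) n r := by
  refine sum_of_single_range (ballCount (residueCard F) n) n r vc hl (by omega) _
    (fun k => ?_) hlo hhi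
  rw [card_formCond_split hϖ hε hδ hlδ hρ₁ hρ₂ hD hB hY]
  have hconst : ∀ j : ℤ, j ≤ 0 → ballCount (residueCard F : ℂ) n j =
      ballCount (residueCard F : ℂ) n 0 := fun j hj => by
    rw [ballCount, ballCount, Int.toNat_of_nonpos hj, Int.toNat_zero]
  rw [hconst _ hR]
  by_cases hk : n - r - 2 * δ ≤ k
  · rw [if_pos hk]
    refine if_congr ?_ rfl rfl
    omega
  · rw [if_neg hk, if_neg (by omega), zero_add, hconst ((k + n - r + 1) / 2) (by omega)]
    refine if_congr ?_ rfl rfl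
    omega

open Classical in
theorem sum_card_split_of_ge (hϖ : IsUniformizer ϖ) (hl : Odd l) (hε : ‖ε‖ = 1)
    (hδ : 0 ≤ δ) (hlδ : 2 * δ < l) (hρ₁ : ‖ρ₁‖ = ‖ϖ‖ ^ δ) (hρ₂ : ‖ρ₂‖ = ‖ϖ‖ ^ (l - δ))
    (hD : D = ε * (ρ₁ + ρ₂)) (hB : B = -ε * (ρ₁ * ρ₂)) {n r : ℕ} {Y : Finset F}
    (hY : IsReps ϖ n Y) (hR : 0 ≤ (n - r - δ : ℤ)) (vc : ℤ) {lo hi : ℤ} (hlo : lo ≤ δ - l)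
    (hhi : n + r < hi) :
    ∑ k ∈ Finset.Ico lo hi, (-1 : ℂ) ^ (k + (n + vc)) * ((k : ℂ) + ((n + vc : ℤ) : ℂ)) *
        ({y ∈ Y | FormCond ϖ B D ε n r k y}.card : ℂ) =
      (-1) ^ (r + vc) * threeRange (residueCard F) l δ n r := by
  refine sum_of_three_ranges (ballCount (residueCard F) n) n r vc hl hδ hlδ hR _
    (fun k => ?_) hlo hhi
  rw [card_formCond_split hϖ hε hδ hlδ hρ₁ hρ₂ hD hB hY, min_eq_left hR, add_zero]

theorem neg_one_zpow_mul_self (j : ℤ) : (-1 : ℂ) ^ j * (-1) ^ j = 1 := by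
  rw [← zpow_add₀ (by norm_num), Even.neg_one_zpow ⟨j, rfl⟩]

theorem norm_two_eq_one {p : ℕ} [Fact p.Prime] (hp : p ≠ 2) (K : Type*) [NormedField K]
    [NormedAlgebra ℚ_[p] K] : ‖(2 : K)‖ = 1 := by
  rw [← map_ofNat (algebraMap ℚ_[p] K) 2, norm_algebraMap']
  have h := (Padic.norm_natCast_eq_one_iff (p := p) (n := 2)).2
    ((Nat.coprime_primes Fact.out Nat.prime_two).2 hp)
  exact_mod_cast h

end Main

end SemiLie

theorem mainTheorem4 {p : ℕ} [Fact p.Prime] (hp : p ≠ 2)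
    {F E : Type*} [NormedField F] [NormedAlgebra ℚ_[p] F] [FiniteDimensional ℚ_[p] F]
    [IsUltrametricDist F] [NormedField E] [NormedAlgebra F E]
    (hdeg : Module.finrank F E = 2) (hunr : SemiLie.IsUnramified F E)
    (σ : E ≃ₐ[F] E) (hσ : σ ≠ AlgEquiv.refl)
    (ϖ : F) (hϖ : SemiLie.IsUniformizer ϖ)
    [MeasurableSpace (GL (Fin 2) F)] [BorelSpace (GL (Fin 2) F)]
    (μ : Measure (GL (Fin 2) F)) [μ.IsHaarMeasure] (hμ : μ (SemiLie.integralGL F) = 1)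
    (γ : SemiLie.S2 σ) (a b c d : E) (e : F)
    (hγ : ((γ : GL (Fin 2) E) : Matrix (Fin 2) (Fin 2) E) = !![a, b; c, d])
    (hrs : SemiLie.IsRegSSMinus γ ![0, 1] ![0, e])
    (r : ℕ) (hr : 1 ≤ r) :
    let q : ℕ := SemiLie.residueCard F
    let vb : ℤ := SemiLie.val (algebraMap F E ϖ) b
    let vc : ℤ := SemiLie.val (algebraMap F E ϖ) c
    let ve : ℤ := SemiLie.val ϖ e
    let δ : WithTop ℤ := SemiLie.ord (algebraMap F E ϖ) (d - a)
    let N : ℤ := SemiLie.constN r vb vc ve δ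
    let C : ℚ := SemiLie.constC r vb vc ve δ
    let C' : ℚ := SemiLie.constC' r vb vc ve δ
    let φ : SemiLie.S2 σ → ℂ := SemiLie.indKSle σ ϖ r + SemiLie.indKSle σ ϖ (r - 1)
    (∀ s : ℂ, Integrable (SemiLie.orbIntegrand ϖ γ ![0, 1] ![0, e] φ s) μ) ∧
    DifferentiableAt ℂ (SemiLie.Orb μ ϖ γ ![0, 1] ![0, e] φ) 0 ∧
    (-1 : ℂ) ^ (vc + (r : ℤ)) / (Real.log q : ℂ) * SemiLie.dOrb μ ϖ γ ![0, 1] ![0, e] φ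
      = (∑ j ∈ Finset.Icc (0 : ℤ) N, (q : ℂ) ^ j)
        + (C : ℂ) * (q : ℂ) ^ N + (C' : ℂ) * (q : ℂ) ^ (N - 1) := by
  classical
  intro q vb vc ve δ N C C' φ
  have : ProperSpace F := FiniteDimensional.proper ℚ_[p] F
  have hϖE := hunr ϖ hϖ
  have h2 : ‖(2 : F)‖ = 1 := SemiLie.norm_two_eq_one hp F
  have hσn := SemiLie.norm_conj hϖ hdeg σ
  have hϖn : ‖algebraMap F E ϖ‖ = ‖ϖ‖ := norm_algebraMap' E ϖ
  obtain ⟨hb, hc, he'⟩ : b ≠ 0 ∧ c ≠ 0 ∧ algebraMap F E e ≠ 0 := by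
    refine SemiLie.ne_zero_of_isRegSS (a := a) (d := d) ?_
    have h := hrs.1
    rw [hγ] at h
    convert h using 1
    · ext i; fin_cases i <;> simp
    · ext i; fin_cases i <;> simp
  have he : e ≠ 0 := by rintro rfl; exact he' (map_zero _)
  obtain ⟨hodd, hpos⟩ := SemiLie.odd_val_add_val_and_pos hdeg hunr hσ hϖ h2 hγ hrs hb hc
  obtain ⟨ha, hd, B, D, ε, hB, hD, hε, hBn, hDn, hεn⟩ :=
    SemiLie.exists_form_coefficients hdeg hunr hσ hϖ hγ hb hc hpos
  change Odd (vb + vc) at hodd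
  change 0 < vb + vc at hpos
  change ‖B‖ = ‖ϖ‖ ^ (vb + vc) at hBn
  have : IsUltrametricDist E := SemiLie.isUltrametricDist_of_normedAlgebra F E
  have hD1 : ‖D‖ ≤ 1 := by rw [hDn]; exact SemiLie.norm_sub_le_of_le hd.le ha.le
  have hcn : ‖c‖ = ‖ϖ‖ ^ vc := by rw [SemiLie.norm_eq_zpow_val hϖE hc, hϖn]
  choose Y hY using SemiLie.exists_isReps hϖ
  obtain ⟨r, rfl⟩ : ∃ r', r = r' + 1 := ⟨r - 1, by omega⟩
  have hq1 : 1 < q := SemiLie.one_lt_residueCard hϖ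
  have hlog : (Real.log q : ℂ) ≠ 0 :=
    Complex.ofReal_ne_zero.2 (Real.log_pos (by exact_mod_cast hq1)).ne'
  -- One window for k that serves every n ≤ v(e) and both radii.
  set lo : ℤ := -((r + 1 : ℕ) + (vb + vc)) with hlo
  set hi : ℤ := (ve + 1).toNat + (r + 1 : ℕ) + 1 with hhi
  have hbound : ∀ n : ℕ, (n : ℤ) ≤ ve → ∀ k y, ‖y‖ ≤ 1 →
      SemiLie.FormCond ϖ B D ε n (r + 1) k y ∨ SemiLie.FormCond ϖ B D ε n r k y →
        lo ≤ k ∧ k < hi := by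
    intro n hn k y hy hor
    rcases hor with h | h
    · have := h.bounds hϖ hpos hBn hD1 hεn hy
      omega
    · have := h.bounds hϖ hpos hBn hD1 hεn hy
      omega
  have hmain := SemiLie.integrable_and_orb_eq_sum μ hμ hϖ hγ ha hd hcn (hσn c) hB hD hε he
    (r + 1) r hbound Y hY
  have hderiv := HasDerivAt.fun_sum (u := Finset.range (ve + 1).toNat) fun n _ =>
    HasDerivAt.fun_sum (u := Finset.Ico lo hi) fun k _ =>
      (SemiLie.hasDerivAt_weight hϖ (k + (n + vc))).mul_const
        (({y ∈ Y n | SemiLie.FormCond ϖ B D ε n (r + 1) k y}.card : ℂ) +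
            ({y ∈ Y n | SemiLie.FormCond ϖ B D ε n r k y}.card : ℂ))
  have horb : SemiLie.Orb μ ϖ γ ![0, 1] ![0, e] φ = _ := funext fun s => (hmain s).2
  rw [← horb] at hderiv
  refine ⟨fun s => (hmain s).1, hderiv.differentiableAt, ?_⟩
  rw [SemiLie.dOrb, hderiv.deriv]
  have hsplit : ∀ n : ℕ, ∑ k ∈ Finset.Ico lo hi, (Real.log q : ℂ) *
      ((-1) ^ (k + (n + vc)) * ((k + (n + vc) : ℤ) : ℂ)) *
        (({y ∈ Y n | SemiLie.FormCond ϖ B D ε n (r + 1) k y}.card : ℂ) +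
            ({y ∈ Y n | SemiLie.FormCond ϖ B D ε n r k y}.card : ℂ)) =
      Real.log q * (∑ k ∈ Finset.Ico lo hi,
          (-1 : ℂ) ^ (k + (n + vc)) * ((k : ℂ) + ((n + vc : ℤ) : ℂ)) *
            ({y ∈ Y n | SemiLie.FormCond ϖ B D ε n (r + 1) k y}.card : ℂ) +
        ∑ k ∈ Finset.Ico lo hi, (-1 : ℂ) ^ (k + (n + vc)) * ((k : ℂ) + ((n + vc : ℤ) : ℂ)) *
            ({y ∈ Y n | SemiLie.FormCond ϖ B D ε n r k y}.card : ℂ)) := by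
    intro n
    rw [← Finset.sum_add_distrib, Finset.mul_sum]
    refine Finset.sum_congr rfl fun k _ => ?_
    push_cast
    ring
  -- The signs at r + 1 and r are opposite, so the sum of the two test functions yields a
  -- difference.
  have hsign : ∀ x y : ℂ, (-1 : ℂ) ^ ((r + 1 : ℕ) + vc) * x + (-1) ^ (r + vc) * y =
      (-1) ^ (vc + (r + 1 : ℕ)) * (x - y) := by
    intro x y
    rw [show vc + ((r + 1 : ℕ) : ℤ) = r + vc + 1 by push_cast; ring,
      show ((r + 1 : ℕ) : ℤ) + vc = r + vc + 1 by push_cast; ring,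
      SemiLie.neg_one_zpow_add_one]
    ring
  have hconclude : ∀ T : ℕ → ℂ, (∀ n ∈ Finset.range (ve + 1).toNat, ∑ k ∈ Finset.Ico lo hi,
          (-1 : ℂ) ^ (k + (n + vc)) * ((k : ℂ) + ((n + vc : ℤ) : ℂ)) *
            ({y ∈ Y n | SemiLie.FormCond ϖ B D ε n (r + 1) k y}.card : ℂ) +
        ∑ k ∈ Finset.Ico lo hi, (-1 : ℂ) ^ (k + (n + vc)) * ((k : ℂ) + ((n + vc : ℤ) : ℂ)) *
            ({y ∈ Y n | SemiLie.FormCond ϖ B D ε n r k y}.card : ℂ) =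
          (-1) ^ (vc + (r + 1 : ℕ)) * T n) →
      (-1 : ℂ) ^ (vc + ((r + 1 : ℕ) : ℤ)) / (Real.log q : ℂ) *
        (∑ n ∈ Finset.range (ve + 1).toNat, ∑ k ∈ Finset.Ico lo hi, (Real.log q : ℂ) *
      ((-1) ^ (k + (n + vc)) * ((k + (n + vc) : ℤ) : ℂ)) *
        (({y ∈ Y n | SemiLie.FormCond ϖ B D ε n (r + 1) k y}.card : ℂ) +
            ({y ∈ Y n | SemiLie.FormCond ϖ B D ε n r k y}.card : ℂ))) =
        ∑ n ∈ Finset.range (ve + 1).toNat, T n := by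
    intro T hT
    rw [Finset.mul_sum]
    refine Finset.sum_congr rfl fun n hn => ?_
    rw [hsplit, hT n hn]
    have := SemiLie.neg_one_zpow_mul_self (vc + ((r + 1 : ℕ) : ℤ))
    field_simp
    linear_combination T n * this
  rcases lt_or_ge (δ + δ) ((vb + vc : ℤ) : WithTop ℤ) with hlt | hge
  · obtain ⟨δ', hδ'⟩ : ∃ δ' : ℤ, δ = δ' := by
      refine Option.ne_none_iff_exists'.1 fun hnone => ?_
      have : δ = ⊤ := hnone
      rw [this, top_add] at hlt
      exact not_top_lt hlt
    have hda : d - a ≠ 0 := by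
      intro h0
      have : δ = ⊤ := if_pos h0
      rw [hδ'] at this
      exact WithTop.coe_ne_top this
    have hδval : SemiLie.val (algebraMap F E ϖ) (d - a) = δ' := by
      have : δ = (SemiLie.val (algebraMap F E ϖ) (d - a) : WithTop ℤ) := if_neg hda
      rw [hδ'] at this
      exact (WithTop.coe_injective this).symm
    have hDδ : ‖D‖ = ‖ϖ‖ ^ δ' := by
      rw [hDn, SemiLie.norm_eq_zpow_val hϖE hda, hδval, hϖn]
    have hδ0 : 0 ≤ δ' := by
      rwa [hDδ, ← zpow_zero ‖ϖ‖, hϖ.zpow_le_zpow_iff] at hD1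
    rw [hδ', ← WithTop.coe_add, WithTop.coe_lt_coe] at hlt
    obtain ⟨ρ₁, ρ₂, hρ₁, hρ₂, hDρ, hBρ⟩ :=
      SemiLie.exists_roots hϖ h2 hεn (by omega) hBn hDδ
    have hfinal := SemiLie.sum_three_eq (q : ℂ) r ve hδ0 hlt
    simp only [N, C, C', hδ']
    rw [← hfinal]
    refine hconclude _ fun n hn => ?_
    rw [Finset.mem_range] at hn
    split_ifs with hn'
    · rw [SemiLie.sum_card_split_of_le hϖ hodd hεn hδ0 (by omega) hρ₁ hρ₂ hDρ hBρ (hY n)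
          (by push_cast; omega) vc (by omega) (by omega),
        SemiLie.sum_card_split_of_le hϖ hodd hεn hδ0 (by omega) hρ₁ hρ₂ hDρ hBρ (hY n)
          (by omega) vc (by omega) (by omega)]
      exact hsign _ _
    · rw [SemiLie.sum_card_split_of_ge hϖ hodd hεn hδ0 (by omega) hρ₁ hρ₂ hDρ hBρ (hY n)
          (by push_cast; omega) vc (by omega) (by omega),
        SemiLie.sum_card_split_of_ge hϖ hodd hεn hδ0 (by omega) hρ₁ hρ₂ hDρ hBρ (hY n)
          (by omega) vc (by omega) (by omega)]
      exact hsign _ _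
  -- Equality is excluded because v(b) + v(c) is odd.
  · have hlt : ((vb + vc : ℤ) : WithTop ℤ) < δ + δ := by
      refine lt_of_le_of_ne hge fun heq => ?_
      generalize δ = δ₀ at heq
      induction δ₀ using WithTop.recTopCoe with
      | top => rw [top_add] at heq; exact WithTop.coe_ne_top heq
      | coe t =>
        rw [← WithTop.coe_add] at heq
        exact Int.not_even_iff_odd.2 hodd ⟨t, WithTop.coe_injective heq⟩
    have hDle : ‖D‖ ≤ ‖ϖ‖ ^ ((vb + vc + 1) / 2) := by
      rw [hDn]
      by_cases hda : d - a = 0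
      · rw [hda, norm_zero]; exact (zpow_pos hϖ.norm_pos _).le
      · have hδ : δ = (SemiLie.val (algebraMap F E ϖ) (d - a) : WithTop ℤ) := if_neg hda
        rw [hδ, ← WithTop.coe_add, WithTop.coe_lt_coe] at hlt
        rw [SemiLie.norm_eq_zpow_val hϖE hda, hϖn, hϖ.zpow_le_zpow_iff]
        omega
    rw [← SemiLie.sum_single_eq (q : ℂ) r ve hpos hlt]
    refine hconclude _ fun n hn => ?_
    rw [Finset.mem_range] at hn
    rw [SemiLie.sum_card_single hϖ hodd hpos hBn hDle hεn (hY n) vc (by omega) (by omega),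
      SemiLie.sum_card_single hϖ hodd hpos hBn hDle hεn (hY n) vc (by omega) (by omega)]
    exact hsign _ _
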